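/- Let $(X,g)$ be a smooth Riemannian manifold (Hausdorff, second countable, without boundary) of dimension $m\ge 2$, with Riemannian measure $dg$. For an open set $\Omega\subset X$ let $H^1(\Omega)$ be the space of all complex-valued $u\in L^2(\Omega,g)$ having a weak differential $du\in L^2$, with $\|u\|_{H^1(\Omega)}^2=\|u\|^2_{L^2(\Omega)}+\|du\|^2_{L^2(\Omega)}$, and let $\mathfrak d_\Omega(u,v)=\int_\Omega\langle du,dv\rangle_g\,dg$ on $\operatorname{dom}\mathfrak d_\Omega=H^1(\Omega)$. We call $\mathfrak d_X$ the energy form of $X$ (if $X$ is complete, $H^1(X)$ is the closure of the smooth compactly supported functions) and, for open $\Omega\subset X$, $\mathfrak d_\Omega$ the Neumann energy form of $\Omega$. Let $\Delta_X$, $\Delta_\Omega\ge 0$ be the associated self-adjoint operators (the Laplacian of $X$ and the Neumann Laplacian of $\Omega$). Let $H^2(X)$ be the space of all $u\in H^1(X)$ with weak Hessian $\nabla^2u=\nabla du\in L^2$ ($\nabla$ the Levi-Civita connection), with $\|u\|_{H^2}^2=\|u\|^2+\|du\|^2+\|\nabla^2u\|^2$. Let $\varepsilon_0>0$, let $B_\varepsilon\subset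 X$ be a closed set for each $\varepsilon\in(0,\varepsilon_0]$, and put $X_\varepsilon=X\setminus B_\varepsilon$. Assume that $(B_\varepsilon)_\varepsilon$ is Neumann-asymptotically fading: 1. (non-concentration) there are $\delta'_\varepsilon>0$ with $\delta'_\varepsilon\to0$ as $\varepsilon\to0$ and $\|f\|_{L^2(B_\varepsilon)}\le\delta'_\varepsilon\|f\|_{H^1(X)}$ for all $f\in H^1(X)$ and $\varepsilon\in(0,\varepsilon_0]$; 2. (elliptic regularity) there is $C_{\mathrm{ell.reg}}\ge1$ such that every $f\in\operatorname{dom}\Delta_X$ lies in $H^2(X)$ and $\|f\|_{H^2(X)}\le C_{\mathrm{ell.reg}}\|(\Delta_X+1)f\|_{L^2(X)}$; 3. (uniform extension) there is $C_{\mathrm{ext}}\ge1$ such that for every $\varepsilon\in(0,\varepsilon_0]$ there is a linear operator $E_\varepsilon:H^1(X_\varepsilon)\to H^1(X)$ with $(E_\varepsilon u)|_{X_\varepsilon}=u$ and $\|E_\varepsilon u\|_{H^1(X)}\le C_{\mathrm{ext}}\|u\|_{H^1(X_\varepsilon)}$ for all $u$. Then $\mathfrak d_X$ and $\mathfrak d_{X_\varepsilon}$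 are densely defined, closed, non-negative sesquilinear forms, and for every $\varepsilon\in(0,\varepsilon_0]$ they are $\delta_\varepsilon$-quasi-unitarily equivalent of order $2$ with $\delta_\varepsilon=C_{\mathrm{ext}}C_{\mathrm{ell.reg}}\,\delta'_\varepsilon$. That is, there are bounded linear operators $J:L^2(X)\to L^2(X_\varepsilon)$, $J':L^2(X_\varepsilon)\to L^2(X)$, $J^1:H^1(X)\to H^1(X_\varepsilon)$, $J'^1:H^1(X_\varepsilon)\to H^1(X)$ such that, with $\delta=\delta_\varepsilon$, - $\|Jf\|\le(1+\delta)\|f\|$ and $|\langle Jf,u\rangle-\langle f,J'u\rangle|\le\delta\|f\|\|u\|$ for $f\in L^2(X)$, $u\in L^2(X_\varepsilon)$; - $\|f-J'Jf\|\le\delta\|f\|_{H^1}$ and $\|u-JJ'u\|\le\delta\|u\|_{H^1}$ for $f\in H^1(X)$, $u\in H^1(X_\varepsilon)$; - $\|J^1f-Jf\|\le\delta\|f\|_{H^1}$ and $\|J'^1u-J'u\|\le\delta\|u\|_{H^1}$ for $f\in H^1(X)$, $u\in H^1(X_\varepsilon)$; - $|\mathfrak d_{X_\varepsilon}(J^1f,u)-\mathfrak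 d_X(f,J'^1u)|\le\delta\,\|(\Delta_X+1)f\|_{L^2(X)}\,\|u\|_{H^1(X_\varepsilon)}$ for $f\in\operatorname{dom}\Delta_X$, $u\in H^1(X_\varepsilon)$. Consequently, the Neumann Laplacians $\Delta_{X_\varepsilon}$ converge to $\Delta_X$ in the generalised norm resolvent sense: with $R_0=(\Delta_X+1)^{-1}$ and $R_\varepsilon=(\Delta_{X_\varepsilon}+1)^{-1}$ there are numbers $\eta_\varepsilon\to0$ as $\varepsilon\to0$ and, for every $\varepsilon\in(0,\varepsilon_0]$, bounded operators $J:L^2(X)\to L^2(X_\varepsilon)$ and $J':L^2(X_\varepsilon)\to L^2(X)$ with $$\|(\mathrm{id}-J'J)R_0\|\le\eta_\varepsilon,\qquad\|(\mathrm{id}-JJ')R_\varepsilon\|\le\eta_\varepsilon,\qquad\|JR_0-R_\varepsilon J\|\le\eta_\varepsilon .$$ -/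

import Mathlib

open Set Filter Topology MeasureTheory
open scoped Manifold ContDiff ENNReal ComplexConjugate InnerProductSpace

noncomputable section

/-! ### Quadratic forms in Hilbert spaces -/

/-- A form `form` on a linear subspace `dom` of a complex Hilbert space (no axioms). -/
structure HilbertForm (H : Type*) [NormedAddCommGroup H] [InnerProductSpace ℂ H] where
  dom : Submodule ℂ H
  form : dom → dom → ℂ

namespace HilbertForm

variable {H : Type*} [NormedAddCommGroup H] [InnerProductSpace ℂ H]

/-- The form norm `‖f‖₁ = (‖f‖² + 𝔡(f,f))^{1/2}`. -/
def norm1 (q : HilbertForm H) (f : q.dom) : ℝ :=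
  Real.sqrt (‖(f : H)‖ ^ 2 + (q.form f f).re)

/-- `q` is an energy form: a densely defined, closed, non-negative sesquilinear form (conjugate
linear in the first and linear in the second variable). -/
structure IsEnergyForm (q : HilbertForm H) : Prop where
  add_right : ∀ f u v, q.form f (u + v) = q.form f u + q.form f v
  smul_right : ∀ f (c : ℂ) u, q.form f (c • u) = c * q.form f u
  conj_symm : ∀ f u, conj (q.form u f) = q.form f u
  nonneg : ∀ f, 0 ≤ (q.form f f).re
  dense : Dense (q.dom : Set H)
  closed : ∀ s : ℕ → q.dom,
    (∀ η > 0, ∃ N, ∀ i ≥ N, ∀ j ≥ N, q.norm1 (s i - s j) < η) →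
      ∃ f : q.dom, Tendsto (fun i => q.norm1 (s i - f)) atTop (𝓝 0)

/-- The graph of the energy operator `Δ` of the form `q`: `f ∈ dom Δ` and `Δ f = w` mean that
`f ∈ dom q` and `q(v, f) = ⟪v, w⟫` for all `v ∈ dom q`. -/
def EnergyOperator (q : HilbertForm H) (f : q.dom) (w : H) : Prop :=
  ∀ v : q.dom, q.form v f = inner ℂ (v : H) w

/-- The bounded operator `R` is the resolvent `(Δ + 1)⁻¹` of the energy operator `Δ` of `q`:
`R w = f` if and only if `f ∈ dom Δ` and `Δ f + f = w`. -/
def IsResolvent (q : HilbertForm H) (R : H →L[ℂ] H) : Prop :=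
  ∀ w f : H, R w = f ↔ ∃ h : f ∈ q.dom, q.EnergyOperator ⟨f, h⟩ (w - f)

variable {K : Type*} [NormedAddCommGroup K] [InnerProductSpace ℂ K]

/-- `δ`-quasi-unitary equivalence of order `2` of the forms `q` in `H` and `p` in `K`. The norm
`‖f‖₂ = ‖(Δ + 1) f‖` of `f ∈ dom Δ` appears in the last clause as `‖w + f‖` with `w = Δ f`. -/
def QuasiUnitarilyEquivalentTwo (q : HilbertForm H) (p : HilbertForm K) (δ : ℝ) : Prop :=
  0 ≤ δ ∧
  ∃ (J : H →L[ℂ] K) (J' : K →L[ℂ] H) (J1 : q.dom →ₗ[ℂ] p.dom) (J1' : p.dom →ₗ[ℂ] q.dom),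
    (∃ C : ℝ, ∀ f, p.norm1 (J1 f) ≤ C * q.norm1 f) ∧
    (∃ C : ℝ, ∀ u, q.norm1 (J1' u) ≤ C * p.norm1 u) ∧
    (∀ f, ‖J f‖ ≤ (1 + δ) * ‖f‖) ∧
    (∀ f u, ‖inner ℂ (J f) u - inner ℂ f (J' u)‖ ≤ δ * ‖f‖ * ‖u‖) ∧
    (∀ f : q.dom, ‖(f : H) - J' (J f)‖ ≤ δ * q.norm1 f) ∧
    (∀ u : p.dom, ‖(u : K) - J (J' u)‖ ≤ δ * p.norm1 u) ∧
    (∀ f : q.dom, ‖(J1 f : K) - J f‖ ≤ δ * q.norm1 f) ∧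
    (∀ u : p.dom, ‖(J1' u : H) - J' u‖ ≤ δ * p.norm1 u) ∧
    (∀ (f : q.dom) (w : H), q.EnergyOperator f w →
      ∀ u : p.dom, ‖p.form (J1 f) u - q.form f (J1' u)‖ ≤ δ * ‖w + (f : H)‖ * p.norm1 u)

/-- The energy operators of the forms `p ε` in `L ε`, `0 < ε ≤ ε₀`, converge as `ε → 0` in the
generalised norm resolvent sense (of order `0`) to the energy operator of `q`. -/
def GeneralisedNormResolventConvergence (q : HilbertForm H) {L : ℝ → Type*}
    [∀ ε, NormedAddCommGroup (L ε)] [∀ ε, InnerProductSpace ℂ (L ε)]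
    (p : ∀ ε, HilbertForm (L ε)) (ε₀ : ℝ) : Prop :=
  ∃ R₀ : H →L[ℂ] H, q.IsResolvent R₀ ∧
  ∃ η : ℝ → ℝ, Tendsto η (𝓝[>] 0) (𝓝 0) ∧
    ∀ ε ∈ Ioc 0 ε₀, ∃ R : L ε →L[ℂ] L ε, (p ε).IsResolvent R ∧
      ∃ (J : H →L[ℂ] L ε) (J' : L ε →L[ℂ] H),
        ‖(ContinuousLinearMap.id ℂ H - J' ∘L J) ∘L R₀‖ ≤ η ε ∧
        ‖(ContinuousLinearMap.id ℂ (L ε) - J ∘L J') ∘L R‖ ≤ η ε ∧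
        ‖J ∘L R₀ - R ∘L J‖ ≤ η ε

end HilbertForm

/-! ### Riemannian metrics in coordinates -/

/-- Smooth Riemannian metrics on the tangent bundle of an `m`-dimensional manifold `X`. -/
abbrev RiemMetric (m : ℕ) (X : Type*) [TopologicalSpace X]
    [ChartedSpace (EuclideanSpace ℝ (Fin m)) X] [IsManifold (𝓡 m) ∞ X] :=
  Bundle.ContMDiffRiemannianMetric (𝓡 m) ∞ (EuclideanSpace ℝ (Fin m))
    (fun x : X => TangentSpace (𝓡 m) x)

/-- The standard basis vectors of `ℝᵐ`. -/
def stdVec {m : ℕ} (i : Fin m) : EuclideanSpace ℝ (Fin m) := EuclideanSpace.single i 1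

namespace RiemMetric

variable {m : ℕ} {X : Type*} [TopologicalSpace X] [ChartedSpace (EuclideanSpace ℝ (Fin m)) X]

/-- The coordinate vector field `∂ᵢ` of the chart `e`, at the point with coordinates `y`. -/
def coordVec (e : OpenPartialHomeomorph X (EuclideanSpace ℝ (Fin m)))
    (y : EuclideanSpace ℝ (Fin m)) (i : Fin m) : TangentSpace (𝓡 m) (e.symm y) :=
  letI : ChartedSpace (EuclideanSpace ℝ (Fin m)) (EuclideanSpace ℝ (Fin m)) := chartedSpaceSelf _
  mfderiv (𝓡 m) (𝓡 m) e.symm y (stdVec i)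

/-- Some basis of `T_x X`, namely the standard basis of the model space `ℝᵐ`. -/
def fiberVec (x : X) (i : Fin m) : TangentSpace (𝓡 m) x := (stdVec i : EuclideanSpace ℝ (Fin m))

variable [IsManifold (𝓡 m) ∞ X]

/-- The Gram matrix `(g(vᵢ, vⱼ))ᵢⱼ`. -/
def gram (g : RiemMetric m X) (x : X) (v : Fin m → TangentSpace (𝓡 m) x) :
    Matrix (Fin m) (Fin m) ℝ :=
  Matrix.of fun i j => g.inner x (v i) (v j)

/-- The matrix `(gᵢⱼ)` of the metric in the chart `e`. -/
def coordGram (g : RiemMetric m X) (e : OpenPartialHomeomorph X (EuclideanSpace ℝ (Fin m)))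
    (y : EuclideanSpace ℝ (Fin m)) : Matrix (Fin m) (Fin m) ℝ :=
  g.gram (e.symm y) (coordVec e y)

/-- The Christoffel symbol `Γᵏᵢⱼ` of the Levi-Civita connection in the chart `e`. -/
def christoffel (g : RiemMetric m X) (e : OpenPartialHomeomorph X (EuclideanSpace ℝ (Fin m)))
    (y : EuclideanSpace ℝ (Fin m)) (k i j : Fin m) : ℝ :=
  (1 / 2) * ∑ l, (g.coordGram e y)⁻¹ k l *
    (fderiv ℝ (fun z => g.coordGram e z j l) y (stdVec i)
      + fderiv ℝ (fun z => g.coordGram e z i l) y (stdVec j)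
      - fderiv ℝ (fun z => g.coordGram e z i j) y (stdVec l))

/-- The Riemannian measure on the domain of the chart `e` (and zero outside), i.e. the measure with
density `√det(gᵢⱼ)` with respect to Lebesgue measure in the coordinates. -/
def chartVolume [MeasurableSpace X] (g : RiemMetric m X) (e : OpenPartialHomeomorph X (EuclideanSpace ℝ (Fin m))) :
    Measure X :=
  ((volume.restrict e.target).withDensity
    (fun y => ENNReal.ofReal (Real.sqrt (g.coordGram e y).det))).map e.symm

/-- The Riemannian measure of `(X, g)`: the supremum, in the complete lattice of measures, of the
measures `chartVolume` of all charts. These agree on overlaps, so this is the measure whose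
restriction to the domain of each chart is the `chartVolume` of that chart. -/
def vol [MeasurableSpace X] (g : RiemMetric m X) : Measure X :=
  ⨆ e ∈ atlas (EuclideanSpace ℝ (Fin m)) X, g.chartVolume e

/-- The pairing `⟨α, β⟩_g = gⁱʲ conj(αᵢ) βⱼ` of complex valued covectors at `x` induced by `g`. -/
def cotInner (g : RiemMetric m X) (x : X) (α β : TangentSpace (𝓡 m) x →ₗ[ℝ] ℂ) : ℂ :=
  ∑ i, ∑ j, (((g.gram x (fiberVec x))⁻¹ i j : ℝ) : ℂ) *
    (conj (α (fiberVec x i)) * β (fiberVec x j))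

/-- `|α|²_g = gⁱʲ conj(αᵢ) αⱼ`. -/
def cotNormSq (g : RiemMetric m X) (x : X) (α : TangentSpace (𝓡 m) x →ₗ[ℝ] ℂ) : ℝ :=
  (g.cotInner x α α).re

/-- `|σ|²_g = gⁱᵏ gʲˡ conj(σᵢⱼ) σₖₗ` for a complex valued `2`-tensor at `x`. -/
def tensorNormSq (g : RiemMetric m X) (x : X)
    (σ : TangentSpace (𝓡 m) x →ₗ[ℝ] TangentSpace (𝓡 m) x →ₗ[ℝ] ℂ) : ℝ :=
  (∑ i, ∑ j, ∑ k, ∑ l,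
    (((g.gram x (fiberVec x))⁻¹ i k * (g.gram x (fiberVec x))⁻¹ j l : ℝ) : ℂ) *
      (conj (σ (fiberVec x i) (fiberVec x j)) * σ (fiberVec x k) (fiberVec x l))).re

theorem gram_posDef (g : RiemMetric m X) (x : X) : (g.gram x (fiberVec x)).PosDef := by
  classical
  have hlin : ∀ z : Fin m → ℝ, g.inner x (∑ i, z i • fiberVec x i) (∑ i, z i • fiberVec x i)
      = ∑ i, ∑ j, z i * (g.gram x (fiberVec x) i j * z j) := by
    intro z
    simp only [map_sum, sum_apply, map_smul, smul_apply,
      smul_eq_mul, gram, Matrix.of_apply, Finset.mul_sum]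
    rw [Finset.sum_comm]
    refine Finset.sum_congr rfl fun i _ => Finset.sum_congr rfl fun j _ => by ring
  refine Matrix.PosDef.of_dotProduct_mulVec_pos ?_ fun z hz => ?_
  · ext i j
    simp [gram, g.symm x (fiberVec x i) (fiberVec x j)]
  · have hne : (∑ i, z i • fiberVec x i : TangentSpace (𝓡 m) x) ≠ 0 := by
      intro h
      apply hz
      have h' : (∑ i, z i • stdVec i : EuclideanSpace ℝ (Fin m)) = 0 := h
      ext k
      have := congrArg (fun v : EuclideanSpace ℝ (Fin m) => v k) h'
      simpa [stdVec, Pi.single_apply] using this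
    have := g.pos x _ hne
    rw [hlin] at this
    simpa [dotProduct, Matrix.mulVec, Finset.mul_sum] using this

theorem cotNormSq_eq (g : RiemMetric m X) (x : X) (α : TangentSpace (𝓡 m) x →ₗ[ℝ] ℂ) :
    g.cotNormSq x α = ∑ i, ∑ j, (g.gram x (fiberVec x))⁻¹ i j *
      ((α (fiberVec x i)).re * (α (fiberVec x j)).re
        + (α (fiberVec x i)).im * (α (fiberVec x j)).im) := by
  simp [cotNormSq, cotInner, Complex.re_sum]

theorem cotNormSq_nonneg (g : RiemMetric m X) (x : X) (α : TangentSpace (𝓡 m) x →ₗ[ℝ] ℂ) :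
    0 ≤ g.cotNormSq x α := by
  have h := (g.gram_posDef x).inv.posSemidef
  have h1 := h.dotProduct_mulVec_nonneg (fun i => (α (fiberVec x i)).re)
  have h2 := h.dotProduct_mulVec_nonneg (fun i => (α (fiberVec x i)).im)
  have key : g.cotNormSq x α = star (fun i => (α (fiberVec x i)).re) ⬝ᵥ
        ((g.gram x (fiberVec x))⁻¹.mulVec fun i => (α (fiberVec x i)).re)
      + star (fun i => (α (fiberVec x i)).im) ⬝ᵥ
        ((g.gram x (fiberVec x))⁻¹.mulVec fun i => (α (fiberVec x i)).im) := by
    simp only [cotNormSq_eq, dotProduct, Matrix.mulVec, Finset.mul_sum,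
      ← Finset.sum_add_distrib, Pi.star_apply, star_trivial]
    refine Finset.sum_congr rfl fun i _ => Finset.sum_congr rfl fun j _ => by ring
  linarith

theorem cotNormSq_add_le (g : RiemMetric m X) (x : X) (α β : TangentSpace (𝓡 m) x →ₗ[ℝ] ℂ) :
    g.cotNormSq x (α + β) ≤ 2 * g.cotNormSq x α + 2 * g.cotNormSq x β := by
  have h := g.cotNormSq_nonneg x (α - β)
  have key : g.cotNormSq x (α + β) + g.cotNormSq x (α - β)
      = 2 * g.cotNormSq x α + 2 * g.cotNormSq x β := by
    simp only [cotNormSq_eq, Finset.mul_sum, ← Finset.sum_add_distrib]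
    refine Finset.sum_congr rfl fun i _ => Finset.sum_congr rfl fun j _ => ?_
    simp only [LinearMap.add_apply, LinearMap.sub_apply, Complex.add_re, Complex.add_im,
      Complex.sub_re, Complex.sub_im]
    ring
  linarith

theorem cotNormSq_smul (g : RiemMetric m X) (x : X) (c : ℂ)
    (α : TangentSpace (𝓡 m) x →ₗ[ℝ] ℂ) :
    g.cotNormSq x (c • α) = ‖c‖ ^ 2 * g.cotNormSq x α := by
  rw [← Complex.normSq_eq_norm_sq, Complex.normSq_apply]
  simp only [cotNormSq_eq, Finset.mul_sum]
  refine Finset.sum_congr rfl fun i _ => Finset.sum_congr rfl fun j _ => ?_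
  simp only [LinearMap.smul_apply, smul_eq_mul, Complex.mul_re, Complex.mul_im]
  ring

end RiemMetric

/-! ### Sobolev spaces through weak derivatives -/

/-- In the open set `S ⊆ ℝᵐ`, the locally integrable function `w` is the weak partial derivative
`∂ᵢ u` of the locally integrable function `u`. -/
def HasWeakPartial {m : ℕ} (S : Set (EuclideanSpace ℝ (Fin m))) (i : Fin m)
    (u w : EuclideanSpace ℝ (Fin m) → ℂ) : Prop :=
  LocallyIntegrableOn u S ∧ LocallyIntegrableOn w S ∧
  ∀ φ : EuclideanSpace ℝ (Fin m) → ℝ, ContDiff ℝ ∞ φ → HasCompactSupport φ → tsupport φ ⊆ S →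
    ∫ y in S, ((fderiv ℝ φ y (stdVec i) : ℝ) : ℂ) * u y = -∫ y in S, (φ y : ℂ) * w y

theorem HasWeakPartial.mul_right {m : ℕ} {S : Set (EuclideanSpace ℝ (Fin m))}
    {a : EuclideanSpace ℝ (Fin m) → ℝ} (ha : Continuous a) (hc : HasCompactSupport a)
    (hS : tsupport a ⊆ S) {u : EuclideanSpace ℝ (Fin m) → ℂ} (hu : LocallyIntegrableOn u S) :
    IntegrableOn (fun y => (a y : ℂ) * u y) S := by
  have h1 : IntegrableOn u (tsupport a) := hu.integrableOn_compact_subset hS hc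
  have h2 : IntegrableOn (fun y => (a y : ℂ) * u y) (tsupport a) :=
    h1.continuousOn_mul (Complex.continuous_ofReal.comp ha).continuousOn hc
  have h3 : Integrable (fun y => (a y : ℂ) * u y) := by
    refine (integrableOn_iff_integrable_of_support_subset ?_).1 h2
    intro y hy
    apply subset_tsupport a
    intro h0
    exact hy (by simp [h0])
  exact h3.integrableOn

theorem HasWeakPartial.add {m : ℕ} {S : Set (EuclideanSpace ℝ (Fin m))} {i : Fin m}
    {u w u' w' : EuclideanSpace ℝ (Fin m) → ℂ} (h : HasWeakPartial S i u w)
    (h' : HasWeakPartial S i u' w') : HasWeakPartial S i (u + u') (w + w') := by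
  refine ⟨h.1.add h'.1, h.2.1.add h'.2.1, fun φ hφ hc hS => ?_⟩
  have hd : Continuous fun y => fderiv ℝ φ y (stdVec i) :=
    (hφ.continuous_fderiv (by simp)).clm_apply continuous_const
  have hdc : HasCompactSupport fun y => fderiv ℝ φ y (stdVec i) := hc.fderiv_apply ℝ (stdVec i)
  have hdS : tsupport (fun y => fderiv ℝ φ y (stdVec i)) ⊆ S :=
    (tsupport_fderiv_apply_subset ℝ (stdVec i)).trans hS
  simp only [Pi.add_apply, mul_add]
  rw [integral_add (mul_right hd hdc hdS h.1) (mul_right hd hdc hdS h'.1),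
    integral_add (mul_right hφ.continuous hc hS h.2.1) (mul_right hφ.continuous hc hS h'.2.1),
    h.2.2 φ hφ hc hS, h'.2.2 φ hφ hc hS]
  ring

theorem HasWeakPartial.smul {m : ℕ} {S : Set (EuclideanSpace ℝ (Fin m))} {i : Fin m}
    {u w : EuclideanSpace ℝ (Fin m) → ℂ} (c : ℂ) (h : HasWeakPartial S i u w) :
    HasWeakPartial S i (c • u) (c • w) := by
  refine ⟨h.1.smul c, h.2.1.smul c, fun φ hφ hc hS => ?_⟩
  simp only [Pi.smul_apply, smul_eq_mul, mul_left_comm _ c, integral_const_mul]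
  rw [h.2.2 φ hφ hc hS]
  ring

namespace RiemMetric

variable {m : ℕ} {X : Type*} [TopologicalSpace X] [ChartedSpace (EuclideanSpace ℝ (Fin m)) X]
  [IsManifold (𝓡 m) ∞ X] [MeasurableSpace X]

/-- The part of the domain of the chart `e` in `Ω`, in coordinates. -/
def coordDomain (Ω : Set X) (e : OpenPartialHomeomorph X (EuclideanSpace ℝ (Fin m))) :
    Set (EuclideanSpace ℝ (Fin m)) :=
  e.target ∩ e.symm ⁻¹' Ω

/-- The section `α` of the (complexified) cotangent bundle is the weak differential `du` in the open
set `Ω ⊆ X`: some representative of the class of `u` in `Ω` has the components of `α` as weak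
partial derivatives in every chart. -/
def HasWeakDifferential (g : RiemMetric m X) (Ω : Set X) (u : X → ℂ)
    (α : ∀ x : X, TangentSpace (𝓡 m) x →ₗ[ℝ] ℂ) : Prop :=
  ∃ v : X → ℂ, v =ᵐ[g.vol.restrict Ω] u ∧
    ∀ e ∈ atlas (EuclideanSpace ℝ (Fin m)) X, ∀ i,
      HasWeakPartial (coordDomain Ω e) i (fun y => v (e.symm y))
        (fun y => α (e.symm y) (coordVec e y i))

/-- The `2`-tensor field `σ` is the weak covariant derivative `∇α` in the open set `Ω`: in every
chart `σᵢⱼ = ∂ᵢ αⱼ - Γᵏᵢⱼ αₖ` weakly. -/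
def HasWeakCovDeriv (g : RiemMetric m X) (Ω : Set X)
    (α : ∀ x : X, TangentSpace (𝓡 m) x →ₗ[ℝ] ℂ)
    (σ : ∀ x : X, TangentSpace (𝓡 m) x →ₗ[ℝ] TangentSpace (𝓡 m) x →ₗ[ℝ] ℂ) : Prop :=
  ∀ e ∈ atlas (EuclideanSpace ℝ (Fin m)) X, ∀ i j,
    HasWeakPartial (coordDomain Ω e) i (fun y => α (e.symm y) (coordVec e y j))
      (fun y => σ (e.symm y) (coordVec e y i) (coordVec e y j)
        + ∑ k, (g.christoffel e y k i j : ℂ) * α (e.symm y) (coordVec e y k))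

/-- The non-negative function `ρ` has finite integral over `Ω` (with respect to the Riemannian
measure), expressed by an integrable upper bound; it is only used for functions `ρ` such as
`|du|²_g` and `|∇du|²_g` that are measurable because their components are. -/
def FiniteIntegral (g : RiemMetric m X) (Ω : Set X) (ρ : X → ℝ) : Prop :=
  ∃ F : X → ℝ, IntegrableOn F Ω g.vol ∧ ∀ᵐ x ∂(g.vol.restrict Ω), ρ x ≤ F x

/-- The Hilbert space `L²(Ω, g)` of complex valued functions. -/
abbrev L2 (g : RiemMetric m X) (Ω : Set X) := Lp ℂ 2 (g.vol.restrict Ω)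

/-- The first Sobolev space `H¹(Ω, g)`: all `u ∈ L²(Ω, g)` with a weak differential in `L²`. -/
def sobolevOne (g : RiemMetric m X) (Ω : Set X) : Submodule ℂ (g.L2 Ω) where
  carrier := {u | ∃ α, g.HasWeakDifferential Ω u α ∧
    g.FiniteIntegral Ω (fun x => g.cotNormSq x (α x))}
  zero_mem' := by
    refine ⟨0, ⟨0, (Lp.coeFn_zero ..).symm, fun e _ i => ?_⟩, 0, integrableOn_zero, ?_⟩
    · exact ⟨locallyIntegrableOn_zero, locallyIntegrableOn_zero, by simp⟩
    · exact Eventually.of_forall fun x => by simp [cotNormSq_eq]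
  add_mem' := by
    rintro u u' ⟨α, ⟨v, hv, hα⟩, F, hF, hαF⟩ ⟨β, ⟨v', hv', hβ⟩, F', hF', hβF⟩
    refine ⟨α + β, ⟨v + v', ?_, fun e he i => (hα e he i).add (hβ e he i)⟩,
      fun x => 2 * F x + 2 * F' x, (hF.const_mul 2).add (hF'.const_mul 2), ?_⟩
    · filter_upwards [hv, hv', Lp.coeFn_add u u'] with x h h' h''
      exact (congrArg₂ (· + ·) h h').trans h''.symm
    · filter_upwards [hαF, hβF] with x h h'
      have := g.cotNormSq_add_le x (α x) (β x)
      simp only [Pi.add_apply]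
      linarith
  smul_mem' := by
    rintro c u ⟨α, ⟨v, hv, hα⟩, F, hF, hαF⟩
    refine ⟨fun x => c • α x, ⟨c • v, ?_, fun e he i => (hα e he i).smul c⟩,
      fun x => ‖c‖ ^ 2 * F x, hF.const_mul _, ?_⟩
    · filter_upwards [hv, Lp.coeFn_smul c u] with x h h'
      simp [h, h']
    · filter_upwards [hαF] with x h
      rw [cotNormSq_smul]
      gcongr

open Classical in
/-- The weak differential `du` in `Ω`, unique up to null sets (`0` if there is none). -/
def weakDifferential (g : RiemMetric m X) (Ω : Set X) (u : X → ℂ) :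
    ∀ x : X, TangentSpace (𝓡 m) x →ₗ[ℝ] ℂ :=
  if h : ∃ α, g.HasWeakDifferential Ω u α then h.choose else 0

/-- The energy form `𝔡(u, v) = ∫_Ω ⟨du, dv⟩_g` on `H¹(Ω, g)`. For `Ω = X` this is the energy form of
`(X, g)`, for an open subset `Ω` it is the Neumann energy form of `(Ω, g)`. -/
def energyForm (g : RiemMetric m X) (Ω : Set X) : HilbertForm (g.L2 Ω) where
  dom := g.sobolevOne Ω
  form u v := ∫ x in Ω, g.cotInner x (g.weakDifferential Ω u x) (g.weakDifferential Ω v x) ∂g.vol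

/-- `σ` is the weak Hessian `∇du` of `u` in `Ω`. -/
def HasWeakHessian (g : RiemMetric m X) (Ω : Set X) (u : X → ℂ)
    (σ : ∀ x : X, TangentSpace (𝓡 m) x →ₗ[ℝ] TangentSpace (𝓡 m) x →ₗ[ℝ] ℂ) : Prop :=
  g.HasWeakCovDeriv Ω (g.weakDifferential Ω u) σ

open Classical in
/-- The weak Hessian `∇du` in `Ω`, unique up to null sets (`0` if there is none). -/
def weakHessian (g : RiemMetric m X) (Ω : Set X) (u : X → ℂ) :
    ∀ x : X, TangentSpace (𝓡 m) x →ₗ[ℝ] TangentSpace (𝓡 m) x →ₗ[ℝ] ℂ :=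
  if h : ∃ σ, g.HasWeakHessian Ω u σ then h.choose else 0

/-- Membership in the second Sobolev space `H²(Ω, g)`: `u`, `du` and `∇du` are in `L²`. -/
def MemSobolevTwo (g : RiemMetric m X) (Ω : Set X) (u : g.L2 Ω) : Prop :=
  u ∈ g.sobolevOne Ω ∧ ∃ σ, g.HasWeakHessian Ω u σ ∧
    g.FiniteIntegral Ω (fun x => g.tensorNormSq x (σ x))

/-- The norm `(‖u‖² + ‖du‖² + ‖∇du‖²)^{1/2}` of `H²(Ω, g)`. -/
def sobolevTwoNorm (g : RiemMetric m X) (Ω : Set X) (u : g.L2 Ω) : ℝ :=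
  Real.sqrt (‖u‖ ^ 2 + (∫ x in Ω, g.cotNormSq x (g.weakDifferential Ω u x) ∂g.vol)
    + ∫ x in Ω, g.tensorNormSq x (g.weakHessian Ω u x) ∂g.vol)

/-! ### Fading obstacles -/

/-- For measurable `A ⊆ Ω`, the pair `(A, Ω)` is `δ`-non-concentrating:
`‖f‖_{L²(A)} ≤ δ ‖f‖_{H¹(Ω)}` for all `f ∈ H¹(Ω, g)`. -/
def NonConcentrating (g : RiemMetric m X) (A Ω : Set X) (δ : ℝ) : Prop :=
  0 < δ ∧ ∀ f : (g.energyForm Ω).dom,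
    Real.sqrt (∫ x in A, ‖(f : g.L2 Ω) x‖ ^ 2 ∂g.vol) ≤ δ * (g.energyForm Ω).norm1 f

/-- `(X, g)` is elliptically regular with constant `C`: the domain of the Laplacian `Δ` is contained
in `H²(X, g)` and `‖f‖_{H²} ≤ C ‖(Δ + 1) f‖` for all `f ∈ dom Δ`. -/
def EllipticallyRegular (g : RiemMetric m X) (C : ℝ) : Prop :=
  ∀ (f : (g.energyForm univ).dom) (w : g.L2 univ), (g.energyForm univ).EnergyOperator f w →
    g.MemSobolevTwo univ f ∧ g.sobolevTwoNorm univ f ≤ C * ‖w + (f : g.L2 univ)‖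

/-- There is a bounded linear extension operator `H¹(X ∖ B, g) → H¹(X, g)` of norm at most `C`. -/
def HasExtension (g : RiemMetric m X) (B : Set X) (C : ℝ) : Prop :=
  ∃ E : (g.energyForm Bᶜ).dom →ₗ[ℂ] (g.energyForm univ).dom,
    (∀ u, ((E u : g.L2 univ) : X → ℂ) =ᵐ[g.vol.restrict Bᶜ] (u : g.L2 Bᶜ)) ∧
    ∀ u, (g.energyForm univ).norm1 (E u) ≤ C * (g.energyForm Bᶜ).norm1 u

/-- The family `B ε`, `0 < ε ≤ ε₀`, of closed sets is Neumann-asymptotically fading. -/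
structure NeumannFading (g : RiemMetric m X) (ε₀ : ℝ) (B : ℝ → Set X) (δ' : ℝ → ℝ)
    (Cell Cext : ℝ) : Prop where
  isClosed : ∀ ε ∈ Ioc 0 ε₀, IsClosed (B ε)
  nonConcentrating : ∀ ε ∈ Ioc 0 ε₀, g.NonConcentrating (B ε) univ (δ' ε)
  tendsto : Tendsto δ' (𝓝[>] 0) (𝓝 0)
  one_le_Cell : 1 ≤ Cell
  ellipticallyRegular : g.EllipticallyRegular Cell
  one_le_Cext : 1 ≤ Cext
  extension : ∀ ε ∈ Ioc 0 ε₀, g.HasExtension (B ε) Cext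

end RiemMetric

end

set_option linter.unusedSectionVars false

/-! Four identification operators are used. J is restriction to X_ε, J' is its adjoint (extension by
zero), J¹ is restriction on H¹ and J'¹ is the given extension operator E. With these choices JJ' =
id, J¹ = J on H¹ and ⟨Jf, u⟩ = ⟨f, J'u⟩ hold exactly. The two remaining L² clauses concern f - J'Jf,
which is f on B and zero elsewhere, and Eu - J'u, which is Eu on B and zero elsewhere.
Non-concentration bounds both, the second with the extra factor C_ext.

The difference of the two forms is, up to sign, the integral over B of ⟨df, d(Eu)⟩. By
Cauchy-Schwarz and the bound on E it remains to make df small in L²(B). This is non-concentration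
applied to the function |df|: Kato's inequality |d|df|| ≤ |∇df| bounds its H¹ norm by the H² norm of
f, and elliptic regularity bounds that by C_ell.reg ‖(Δ+1)f‖. The product of the constants is δ_ε.
The key lemmas are `quasiUnitarilyEquivalentTwo_energyForm` and
`NonConcentrating.sqrt_setIntegral_cotNormSq_le`.

Since |df| need not have a smooth chain rule at zeros of df, Kato's inequality is applied to √(|df|²
+ η²) - η, and η tends to 0 only inside the integral over B. Subtracting η keeps the function below
|df|, hence in L² even if X has infinite volume. Its weak differential is found in charts: the
components of df are mollified, the classical chain rule is used and the limit is taken in L¹ on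
compact sets (`HasWeakPartial.sqrt_quadForm`). Compatibility of the Levi-Civita connection with the
metric (`quadForm_covDeriv`) turns the coordinate expression into Re⟨df, ∇df⟩ / √(|df|² + η²).

The energy forms are closed because H¹ is complete (`completeSpace_energyForm`) and densely defined
because smooth compactly supported functions lie in H¹ (`dense_sobolevOne`). Resolvent convergence
is abstract: quasi-unitary equivalence of order 2 bounds all three operator norms by 7δ
(`resolvent_bounds`). -/

noncomputable section

/-! ### Forms in Hilbert spaces: form domain, resolvent, and norm resolvent estimates. -/

section

namespace HilbertForm

variable {H : Type*} [NormedAddCommGroup H] [InnerProductSpace ℂ H]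

/-- `q` is a non-negative sesquilinear form (not necessarily closed or densely defined). -/
structure IsNonnegForm (q : HilbertForm H) : Prop where
  add_right : ∀ f u v, q.form f (u + v) = q.form f u + q.form f v
  smul_right : ∀ f (c : ℂ) u, q.form f (c • u) = c * q.form f u
  conj_symm : ∀ f u, conj (q.form u f) = q.form f u
  nonneg : ∀ f, 0 ≤ (q.form f f).re

theorem IsEnergyForm.isNonnegForm {q : HilbertForm H} (h : q.IsEnergyForm) : q.IsNonnegForm :=
  ⟨h.add_right, h.smul_right, h.conj_symm, h.nonneg⟩

/-- The domain of a non-negative form, to be equipped with the form norm. -/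
def FormDomain {q : HilbertForm H} (_ : q.IsNonnegForm) : Type _ := q.dom

namespace FormDomain

variable {q : HilbertForm H} (h : q.IsNonnegForm)

instance : AddCommGroup (FormDomain h) := inferInstanceAs (AddCommGroup q.dom)

instance : Module ℂ (FormDomain h) := inferInstanceAs (Module ℂ q.dom)

/-- The identity map from the form domain to the domain of the form. -/
def toDom : FormDomain h ≃ₗ[ℂ] q.dom := LinearEquiv.refl ℂ q.dom

/-- The inner product `q(f, u) + ⟪f, u⟫` of the form domain. -/
@[reducible]
def core : InnerProductSpace.Core ℂ (FormDomain h) where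
  inner f u := q.form (toDom h f) (toDom h u) + inner ℂ (toDom h f : H) (toDom h u : H)
  conj_inner_symm f u := by
    rw [map_add, h.conj_symm, inner_conj_symm]
  re_inner_nonneg f := by
    have h1 := h.nonneg (toDom h f)
    have h2 : 0 ≤ (inner ℂ (toDom h f : H) (toDom h f : H)).re := inner_self_nonneg (𝕜 := ℂ)
    simpa using add_nonneg h1 h2
  add_left f u v := by
    rw [map_add, Submodule.coe_add, inner_add_left, ← h.conj_symm, h.add_right, map_add,
      h.conj_symm, h.conj_symm]
    ring
  smul_left f u c := by
    rw [map_smul, Submodule.coe_smul, inner_smul_left, ← h.conj_symm, h.smul_right, map_mul,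
      h.conj_symm]
    ring
  definite f hf := by
    have h1 := h.nonneg (toDom h f)
    rw [inner_self_eq_norm_sq_to_K] at hf
    have h4 : (q.form (toDom h f) (toDom h f)).re + ‖(toDom h f : H)‖ ^ 2 = 0 := by
      have := congrArg Complex.re hf
      simpa [← Complex.ofReal_pow] using this
    have h5 : ‖(toDom h f : H)‖ = 0 := by nlinarith [sq_nonneg ‖(toDom h f : H)‖]
    exact (toDom h).map_eq_zero_iff.1 (Subtype.ext (norm_eq_zero.1 h5))

instance : NormedAddCommGroup (FormDomain h) := (core h).toNormedAddCommGroup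

instance : InnerProductSpace ℂ (FormDomain h) := InnerProductSpace.ofCore (core h).toCore

theorem inner_def (f u : FormDomain h) :
    inner ℂ f u = q.form (toDom h f) (toDom h u) + inner ℂ (toDom h f : H) (toDom h u : H) := rfl

theorem norm_eq (f : FormDomain h) : ‖f‖ = q.norm1 (toDom h f) := by
  rw [norm_eq_sqrt_re_inner (𝕜 := ℂ) f, inner_def, inner_self_eq_norm_sq_to_K, HilbertForm.norm1]
  simp [← Complex.ofReal_pow, add_comm]

theorem norm_coe_le (f : FormDomain h) : ‖(toDom h f : H)‖ ≤ ‖f‖ := by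
  rw [norm_eq]
  exact Real.le_sqrt_of_sq_le (le_add_of_nonneg_right (h.nonneg _))

/-- The inclusion of the form domain into the Hilbert space. -/
def incl : FormDomain h →L[ℂ] H :=
  LinearMap.mkContinuous (q.dom.subtype ∘ₗ (toDom h).toLinearMap) 1 fun f => by
    simpa using norm_coe_le h f

/-- Closedness of a form is completeness of its domain in the form norm. This direction makes the
adjoint of the inclusion available; the converse, `IsEnergyForm.of_completeSpace`, is how the energy
forms are shown to be closed. -/
theorem completeSpace (hq : q.IsEnergyForm) : CompleteSpace (FormDomain hq.isNonnegForm) := by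
  refine Metric.complete_of_cauchySeq_tendsto fun s hs => ?_
  obtain ⟨f, hf⟩ := hq.closed (fun i => toDom _ (s i)) fun η hη => by
    obtain ⟨N, hN⟩ := Metric.cauchySeq_iff.1 hs η hη
    refine ⟨N, fun i hi j hj => ?_⟩
    have := hN i hi j hj
    rwa [dist_eq_norm, norm_eq, map_sub] at this
  refine ⟨(toDom _).symm f, tendsto_iff_norm_sub_tendsto_zero.2 (hf.congr fun i => ?_)⟩
  rw [norm_eq, map_sub, LinearEquiv.apply_symm_apply]

end FormDomain

theorem norm1_nonneg (q : HilbertForm H) (f : q.dom) : 0 ≤ q.norm1 f := Real.sqrt_nonneg _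

theorem IsNonnegForm.norm_le_norm1 {q : HilbertForm H} (h : q.IsNonnegForm) (f : q.dom) :
    ‖(f : H)‖ ≤ q.norm1 f := by
  simpa [FormDomain.norm_eq] using FormDomain.norm_coe_le h ((FormDomain.toDom h).symm f)

theorem IsEnergyForm.of_completeSpace {q : HilbertForm H} (h : q.IsNonnegForm)
    (hd : Dense (q.dom : Set H)) [CompleteSpace (FormDomain h)] : q.IsEnergyForm := by
  refine ⟨h.add_right, h.smul_right, h.conj_symm, h.nonneg, hd, fun s hs => ?_⟩
  have hc : CauchySeq (fun i => (FormDomain.toDom h).symm (s i)) := by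
    refine Metric.cauchySeq_iff.2 fun η hη => ?_
    obtain ⟨N, hN⟩ := hs η hη
    refine ⟨N, fun i hi j hj => ?_⟩
    rw [dist_eq_norm, FormDomain.norm_eq, map_sub, LinearEquiv.apply_symm_apply,
      LinearEquiv.apply_symm_apply]
    exact hN i hi j hj
  obtain ⟨f, hf⟩ := cauchySeq_tendsto_of_complete hc
  refine ⟨FormDomain.toDom h f, (tendsto_iff_norm_sub_tendsto_zero.1 hf).congr fun i => ?_⟩
  rw [FormDomain.norm_eq, map_sub, LinearEquiv.apply_symm_apply]

theorem EnergyOperator.form_add_inner {q : HilbertForm H} {f : q.dom} {w : H}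
    (h : q.EnergyOperator f (w - f)) (v : q.dom) :
    q.form v f + inner ℂ (v : H) (f : H) = inner ℂ (v : H) w := by
  have := h v
  rw [inner_sub_right] at this
  exact eq_sub_iff_add_eq.1 this

/-- Testing the weak equation with f itself gives ‖f‖₁² = ⟨f, w⟩ ≤ ‖f‖₁ ‖w‖. So the resolvent is a
contraction from H into the form domain. -/
theorem EnergyOperator.norm1_le {q : HilbertForm H} (hq : q.IsNonnegForm) {f : q.dom} {w : H}
    (h : q.EnergyOperator f (w - f)) : q.norm1 f ≤ ‖w‖ := by
  have h2 : q.norm1 f * q.norm1 f ≤ q.norm1 f * ‖w‖ := by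
    calc q.norm1 f * q.norm1 f = ‖inner ℂ ((FormDomain.toDom hq).symm f)
            ((FormDomain.toDom hq).symm f)‖ := by
          rw [inner_self_eq_norm_sq_to_K, FormDomain.norm_eq, LinearEquiv.apply_symm_apply]
          simp [sq]
      _ = ‖inner ℂ (f : H) w‖ := by
          rw [FormDomain.inner_def, LinearEquiv.apply_symm_apply, h.form_add_inner]
      _ ≤ ‖(f : H)‖ * ‖w‖ := norm_inner_le_norm _ _
      _ ≤ _ := by gcongr; exact hq.norm_le_norm1 f
  rcases (q.norm1_nonneg f).eq_or_lt with h0 | h0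
  · rw [← h0]; exact norm_nonneg _
  · exact le_of_mul_le_mul_left h2 h0

variable [CompleteSpace H]

/-- The resolvent `(Δ + 1)⁻¹` of the energy operator, as `ι ι*` for the inclusion `ι` of the form
domain. -/
def IsEnergyForm.resolvent {q : HilbertForm H} (hq : q.IsEnergyForm) : H →L[ℂ] H :=
  have := FormDomain.completeSpace hq
  FormDomain.incl hq.isNonnegForm ∘L (FormDomain.incl hq.isNonnegForm).adjoint

/-- The relation ⟨v, ι*w⟩₁ = ⟨ιv, w⟩ defining the adjoint is exactly the weak equation q(v, f) + ⟨v,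
f⟩ = ⟨v, w⟩ for f = ι*w. Non-degeneracy of the form inner product makes the solution unique, which
gives the converse. -/
theorem IsEnergyForm.isResolvent {q : HilbertForm H} (hq : q.IsEnergyForm) :
    q.IsResolvent hq.resolvent := by
  have := FormDomain.completeSpace hq
  set ι := FormDomain.incl hq.isNonnegForm with hι
  set e := FormDomain.toDom hq.isNonnegForm with he
  have key : ∀ (w : H) (v : q.dom),
      q.form v (e (ι.adjoint w)) + inner ℂ (v : H) (e (ι.adjoint w) : H) = inner ℂ (v : H) w := by
    intro w v
    have := ContinuousLinearMap.adjoint_inner_right ι (e.symm v) w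
    rw [FormDomain.inner_def, ← he, LinearEquiv.apply_symm_apply] at this
    exact this
  have hR : ∀ w, hq.resolvent w = e (ι.adjoint w) := fun w => rfl
  intro w f
  constructor
  · rintro rfl
    refine ⟨hR w ▸ (e (ι.adjoint w)).2, fun v => ?_⟩
    rw [inner_sub_right]
    exact eq_sub_of_add_eq (key w v)
  · rintro ⟨hf, h⟩
    have : ι.adjoint w = e.symm ⟨f, hf⟩ := by
      refine ext_inner_left ℂ fun v => ?_
      rw [FormDomain.inner_def, FormDomain.inner_def, ← he, key, LinearEquiv.apply_symm_apply]
      have := h (e v)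
      rw [inner_sub_right] at this
      exact (eq_sub_iff_add_eq.1 this).symm
    rw [hR, this, LinearEquiv.apply_symm_apply]

variable {K : Type*} [NormedAddCommGroup K] [InnerProductSpace ℂ K] [CompleteSpace K]

/-- The first two bounds are the L² clauses applied to functions in the range of a resolvent, where
‖·‖₁ is at most the norm of the datum. For the third, u = (J R₀ - R J) f is paired with itself; with
h = R₀ f and v = R u, the number ⟨u, u⟩ splits into seven terms, each at most δ ‖f‖ ‖u‖. This is the
source of the factor 7. -/
theorem QuasiUnitarilyEquivalentTwo.resolvent_bounds {q : HilbertForm H} {p : HilbertForm K}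
    (hq : q.IsEnergyForm) (hp : p.IsEnergyForm) {δ : ℝ} (h : q.QuasiUnitarilyEquivalentTwo p δ) :
    ∃ (J : H →L[ℂ] K) (J' : K →L[ℂ] H),
      ‖(ContinuousLinearMap.id ℂ H - J' ∘L J) ∘L hq.resolvent‖ ≤ 7 * δ ∧
      ‖(ContinuousLinearMap.id ℂ K - J ∘L J') ∘L hp.resolvent‖ ≤ 7 * δ ∧
      ‖J ∘L hq.resolvent - hp.resolvent ∘L J‖ ≤ 7 * δ := by
  obtain ⟨hδ, J, J', J1, J1', -, -, -, hadj, hJ'J, hJJ', hJ1, hJ1', hform⟩ := h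
  refine ⟨J, J', ?_, ?_, ?_⟩
  · refine ContinuousLinearMap.opNorm_le_bound _ (by positivity) fun w => ?_
    obtain ⟨hd, hop⟩ := (hq.isResolvent w _).1 rfl
    calc _ ≤ δ * q.norm1 ⟨_, hd⟩ := hJ'J ⟨_, hd⟩
      _ ≤ δ * ‖w‖ := by gcongr; exact hop.norm1_le hq.isNonnegForm
      _ ≤ 7 * δ * ‖w‖ := by gcongr; linarith
  · refine ContinuousLinearMap.opNorm_le_bound _ (by positivity) fun w => ?_
    obtain ⟨hd, hop⟩ := (hp.isResolvent w _).1 rfl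
    calc _ ≤ δ * p.norm1 ⟨_, hd⟩ := hJJ' ⟨_, hd⟩
      _ ≤ δ * ‖w‖ := by gcongr; exact hop.norm1_le hp.isNonnegForm
      _ ≤ 7 * δ * ‖w‖ := by gcongr; linarith
  · refine ContinuousLinearMap.opNorm_le_bound _ (by positivity) fun f => ?_
    obtain ⟨hd, hop⟩ := (hq.isResolvent f _).1 rfl
    set h : q.dom := ⟨hq.resolvent f, hd⟩ with hh
    have hn : q.norm1 h ≤ ‖f‖ := hop.norm1_le hq.isNonnegForm
    set u : K := J (h : H) - hp.resolvent (J f) with hu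
    obtain ⟨hd', hop'⟩ := (hp.isResolvent u _).1 rfl
    set v : p.dom := ⟨hp.resolvent u, hd'⟩ with hv
    have hm : p.norm1 v ≤ ‖u‖ := hop'.norm1_le hp.isNonnegForm
    obtain ⟨hd'', hop''⟩ := (hp.isResolvent (J f) _).1 rfl
    have hvn : ‖(v : K)‖ ≤ ‖u‖ := (hp.isNonnegForm.norm_le_norm1 v).trans hm
    have hhn : ‖(h : H)‖ ≤ ‖f‖ := (hq.isNonnegForm.norm_le_norm1 h).trans hn
    have e1 : inner ℂ (J1 h : K) u = p.form (J1 h) v + inner ℂ (J1 h : K) (v : K) :=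
      (hop'.form_add_inner _).symm
    -- Symmetry of the resolvent, read off from the two weak equations for R(Jf) and Ru tested
    -- against each other.
    have e2 : inner ℂ (hp.resolvent (J f)) u = inner ℂ (J f) (v : K) := by
      have a1 := hop'.form_add_inner ⟨_, hd''⟩
      have a2 := congrArg conj (hop''.form_add_inner v)
      rw [map_add, hp.conj_symm, inner_conj_symm, inner_conj_symm] at a2
      exact a1.symm.trans a2
    have e3 : inner ℂ f (J1' v : H) = q.form h (J1' v) + inner ℂ (h : H) (J1' v : H) := by
      have a2 := congrArg conj (hop.form_add_inner (J1' v))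
      rw [map_add, hq.conj_symm, inner_conj_symm, inner_conj_symm] at a2
      exact a2.symm
    have b1 : ‖inner ℂ ((J1 h : K) - J h) u‖ ≤ δ * ‖f‖ * ‖u‖ :=
      (norm_inner_le_norm _ _).trans (by gcongr; exact (hJ1 h).trans (by gcongr))
    have b2 : ‖inner ℂ ((J1 h : K) - J h) (v : K)‖ ≤ δ * ‖f‖ * ‖u‖ :=
      (norm_inner_le_norm _ _).trans (by gcongr; exact (hJ1 h).trans (by gcongr))
    have b3 : ‖inner ℂ (J h) (v : K) - inner ℂ (h : H) (J' v)‖ ≤ δ * ‖f‖ * ‖u‖ :=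
      (hadj _ _).trans (by gcongr)
    have b4 : ‖inner ℂ (J f) (v : K) - inner ℂ f (J' v)‖ ≤ δ * ‖f‖ * ‖u‖ :=
      (hadj _ _).trans (by gcongr)
    have b5 : ‖inner ℂ f ((J1' v : H) - J' v)‖ ≤ δ * ‖f‖ * ‖u‖ := by
      refine (norm_inner_le_norm _ _).trans ?_
      calc ‖f‖ * ‖(J1' v : H) - J' v‖ ≤ ‖f‖ * (δ * ‖u‖) := by
            gcongr; exact (hJ1' v).trans (by gcongr)
        _ = _ := by ring
    have b6 : ‖inner ℂ (h : H) ((J1' v : H) - J' v)‖ ≤ δ * ‖f‖ * ‖u‖ := by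
      refine (norm_inner_le_norm _ _).trans ?_
      calc ‖(h : H)‖ * ‖(J1' v : H) - J' v‖ ≤ ‖f‖ * (δ * ‖u‖) := by
            gcongr; exact (hJ1' v).trans (by gcongr)
        _ = _ := by ring
    have b7 : ‖p.form (J1 h) v - q.form h (J1' v)‖ ≤ δ * ‖f‖ * ‖u‖ := by
      refine (hform h _ hop v).trans ?_
      rw [sub_add_cancel]
      gcongr
    -- J is replaced by J¹ to reach the forms, and J¹ is then undone. The leftover terms pair up
    -- into defects of adjointness, of J¹ and J'¹ against J and J', and of the forms.
    have e4 : inner ℂ u u = -inner ℂ ((J1 h : K) - J h) u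
        + inner ℂ ((J1 h : K) - J h) (v : K)
        + (inner ℂ (J h) (v : K) - inner ℂ (h : H) (J' v))
        - (inner ℂ (J f) (v : K) - inner ℂ f (J' v))
        + inner ℂ f ((J1' v : H) - J' v) - inner ℂ (h : H) ((J1' v : H) - J' v)
        + (p.form (J1 h) v - q.form h (J1' v)) := by
      have e0 : inner ℂ u u = inner ℂ (J h) u - inner ℂ (hp.resolvent (J f)) u := by
        conv_lhs => rw [hu, inner_sub_left, ← hu]
      rw [e0, e2]
      simp only [inner_sub_left, inner_sub_right]
      rw [e1, e3]
      ring
    have e5 : ‖u‖ * ‖u‖ ≤ ‖u‖ * (7 * δ * ‖f‖) := by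
      have : ‖u‖ * ‖u‖ = ‖(inner ℂ u u : ℂ)‖ := by
        rw [inner_self_eq_norm_sq_to_K]; simp [sq]
      rw [this, e4]
      have t1 := norm_add_le (-inner ℂ ((J1 h : K) - J h) u
        + inner ℂ ((J1 h : K) - J h) (v : K)
        + (inner ℂ (J h) (v : K) - inner ℂ (h : H) (J' v))
        - (inner ℂ (J f) (v : K) - inner ℂ f (J' v))
        + inner ℂ f ((J1' v : H) - J' v) - inner ℂ (h : H) ((J1' v : H) - J' v))
        (p.form (J1 h) v - q.form h (J1' v))
      have t2 := norm_sub_le (-inner ℂ ((J1 h : K) - J h) u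
        + inner ℂ ((J1 h : K) - J h) (v : K)
        + (inner ℂ (J h) (v : K) - inner ℂ (h : H) (J' v))
        - (inner ℂ (J f) (v : K) - inner ℂ f (J' v))
        + inner ℂ f ((J1' v : H) - J' v)) (inner ℂ (h : H) ((J1' v : H) - J' v))
      have t3 := norm_add_le (-inner ℂ ((J1 h : K) - J h) u
        + inner ℂ ((J1 h : K) - J h) (v : K)
        + (inner ℂ (J h) (v : K) - inner ℂ (h : H) (J' v))
        - (inner ℂ (J f) (v : K) - inner ℂ f (J' v)))
        (inner ℂ f ((J1' v : H) - J' v))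
      have t4 := norm_sub_le (-inner ℂ ((J1 h : K) - J h) u
        + inner ℂ ((J1 h : K) - J h) (v : K)
        + (inner ℂ (J h) (v : K) - inner ℂ (h : H) (J' v)))
        (inner ℂ (J f) (v : K) - inner ℂ f (J' v))
      have t5 := norm_add_le (-inner ℂ ((J1 h : K) - J h) u
        + inner ℂ ((J1 h : K) - J h) (v : K))
        (inner ℂ (J h) (v : K) - inner ℂ (h : H) (J' v))
      have t6 := norm_add_le (-inner ℂ ((J1 h : K) - J h) u)
        (inner ℂ ((J1 h : K) - J h) (v : K))
      rw [norm_neg] at t6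
      linarith
    change ‖u‖ ≤ 7 * δ * ‖f‖
    rcases (norm_nonneg u).eq_or_lt with h0 | h0
    · rw [← h0]; positivity
    · exact le_of_mul_le_mul_left e5 h0

theorem GeneralisedNormResolventConvergence.of_quasiUnitarilyEquivalentTwo {q : HilbertForm H}
    {L : ℝ → Type*} [∀ ε, NormedAddCommGroup (L ε)] [∀ ε, InnerProductSpace ℂ (L ε)]
    [∀ ε, CompleteSpace (L ε)] {p : ∀ ε, HilbertForm (L ε)} {ε₀ : ℝ} (hq : q.IsEnergyForm)
    (hp : ∀ ε ∈ Ioc 0 ε₀, (p ε).IsEnergyForm) {δ : ℝ → ℝ} (hδ : Tendsto δ (𝓝[>] 0) (𝓝 0))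
    (h : ∀ ε ∈ Ioc 0 ε₀, q.QuasiUnitarilyEquivalentTwo (p ε) (δ ε)) :
    q.GeneralisedNormResolventConvergence p ε₀ := by
  refine ⟨hq.resolvent, hq.isResolvent, fun ε => 7 * δ ε, by simpa using hδ.const_mul 7,
    fun ε hε => ⟨(hp ε hε).resolvent, (hp ε hε).isResolvent, ?_⟩⟩
  exact (h ε hε).resolvent_bounds hq (hp ε hε)

end HilbertForm

end

/-! ### Linear algebra in a tangent space: base change, orthonormal frames, pointwise Kato
inequality. -/

section

namespace RiemMetric

variable {m : ℕ} {X : Type*} [TopologicalSpace X] [ChartedSpace (EuclideanSpace ℝ (Fin m)) X]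

/-- The identification of `T_x X` with the model space under which `fiberVec` is the standard
basis. -/
def fiberEquiv (x : X) : TangentSpace (𝓡 m) x ≃ₗ[ℝ] EuclideanSpace ℝ (Fin m) :=
  LinearEquiv.refl ℝ (EuclideanSpace ℝ (Fin m))

/-- The matrix of the components of the vectors `v i` with respect to `fiberVec`. -/
def frameMatrix {x : X} (v : Fin m → TangentSpace (𝓡 m) x) : Matrix (Fin m) (Fin m) ℝ :=
  Matrix.of fun i k => fiberEquiv (m := m) x (v i) k

theorem sum_frameMatrix_smul {x : X} (v : Fin m → TangentSpace (𝓡 m) x) (i : Fin m) :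
    ∑ k, frameMatrix v i k • (fiberVec x k : TangentSpace (𝓡 m) x) = v i := by
  apply (fiberEquiv (m := m) x).injective
  have h : ∀ k : Fin m, fiberEquiv x (fiberVec x k) = stdVec k := fun k => rfl
  rw [map_sum]
  simp only [map_smul, h]
  ext l
  simp [stdVec, frameMatrix, Pi.single_apply]

theorem isUnit_frameMatrix {x : X} {v : Fin m → TangentSpace (𝓡 m) x}
    (hv : LinearIndependent ℝ v) : IsUnit (frameMatrix v) := by
  rw [← Matrix.linearIndependent_rows_iff_isUnit]
  exact hv.map' ((fiberEquiv x).trans (EuclideanSpace.equiv (Fin m) ℝ).toLinearEquiv).toLinearMap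
    (LinearEquiv.ker _)

variable [IsManifold (𝓡 m) ∞ X]

theorem gram_sum_smul (g : RiemMetric m X) {x : X} (M : Matrix (Fin m) (Fin m) ℝ)
    (w : Fin m → TangentSpace (𝓡 m) x) :
    g.gram x (fun i => ∑ k, M i k • w k) = M * g.gram x w * M.transpose := by
  ext i j
  simp only [gram, Matrix.of_apply, map_sum, map_smul, Matrix.mul_apply, Matrix.transpose_apply,
    sum_apply, smul_apply, smul_eq_mul, Finset.sum_mul, Finset.mul_sum]
  refine Finset.sum_congr rfl fun a _ => Finset.sum_congr rfl fun b _ => by ring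

theorem gram_eq_frameMatrix (g : RiemMetric m X) {x : X} (v : Fin m → TangentSpace (𝓡 m) x) :
    g.gram x v = frameMatrix v * g.gram x (fiberVec x) * (frameMatrix v).transpose := by
  rw [← gram_sum_smul]
  simp only [sum_frameMatrix_smul]

theorem gram_posDef_of_linearIndependent (g : RiemMetric m X) {x : X}
    {v : Fin m → TangentSpace (𝓡 m) x} (hv : LinearIndependent ℝ v) : (g.gram x v).PosDef := by
  rw [gram_eq_frameMatrix]
  have := (g.gram_posDef x).mul_mul_conjTranspose_same (B := frameMatrix v)
    (Matrix.vecMul_injective_iff_isUnit.2 (isUnit_frameMatrix hv))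
  simpa using this

/-- The contraction of a bilinear form with the inverse Gram matrix does not depend on the basis: if
M is the change of basis, the Gram matrix becomes M G Mᵀ, and Mᵀ (M G Mᵀ)⁻¹ M = G⁻¹. This lets norms
defined through `fiberVec` be computed in orthonormal or coordinate frames. -/
theorem sum_gram_inv_smul (g : RiemMetric m X) {x : X} {v : Fin m → TangentSpace (𝓡 m) x}
    (hv : LinearIndependent ℝ v)
    (b : TangentSpace (𝓡 m) x →ₗ[ℝ] TangentSpace (𝓡 m) x →ₗ[ℝ] ℂ) :
    ∑ i, ∑ j, (g.gram x (fiberVec x))⁻¹ i j • b (fiberVec x i) (fiberVec x j)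
      = ∑ i, ∑ j, (g.gram x v)⁻¹ i j • b (v i) (v j) := by
  set M := frameMatrix v with hM
  set G := g.gram x (fiberVec x)
  have hMu : IsUnit M.det := (Matrix.isUnit_iff_isUnit_det _).1 (isUnit_frameMatrix hv)
  have hMt : IsUnit M.transpose.det := by rwa [Matrix.det_transpose]
  have key : M.transpose * (g.gram x v)⁻¹ * M = G⁻¹ := by
    rw [gram_eq_frameMatrix, Matrix.mul_inv_rev, Matrix.mul_inv_rev,
      Matrix.mul_nonsing_inv_cancel_left _ _ hMt, Matrix.nonsing_inv_mul_cancel_right _ _ hMu]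
  have hb : ∀ i j, b (v i) (v j)
      = ∑ k, ∑ l, (M i k * M j l) • b (fiberVec x k) (fiberVec x l) := by
    intro i j
    rw [← sum_frameMatrix_smul v i, ← sum_frameMatrix_smul v j]
    simp only [map_sum, LinearMap.sum_apply, map_smul, LinearMap.smul_apply, ← hM,
      Finset.smul_sum, smul_smul]
    rw [Finset.sum_comm]
    refine Finset.sum_congr rfl fun a _ => Finset.sum_congr rfl fun b _ => by rw [mul_comm]
  simp only [hb, ← key, Matrix.mul_apply, Matrix.transpose_apply, Finset.sum_mul, Finset.sum_smul,
    Finset.smul_sum, smul_smul]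
  have e1 : ∀ F : Fin m → Fin m → Fin m → Fin m → ℂ, ∑ k, ∑ l, ∑ j, ∑ i, F k l j i
      = ∑ i, ∑ j, ∑ k, ∑ l, F k l j i := by
    intro F
    calc _ = ∑ k, ∑ l, ∑ i, ∑ j, F k l j i := by
          refine Finset.sum_congr rfl fun k _ => Finset.sum_congr rfl fun l _ => Finset.sum_comm
      _ = ∑ k, ∑ i, ∑ l, ∑ j, F k l j i := by
          refine Finset.sum_congr rfl fun k _ => Finset.sum_comm
      _ = ∑ i, ∑ k, ∑ l, ∑ j, F k l j i := Finset.sum_comm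
      _ = ∑ i, ∑ k, ∑ j, ∑ l, F k l j i := by
          refine Finset.sum_congr rfl fun k _ => Finset.sum_congr rfl fun l _ => Finset.sum_comm
      _ = _ := Finset.sum_congr rfl fun k _ => Finset.sum_comm
  rw [e1]
  refine Finset.sum_congr rfl fun i _ => Finset.sum_congr rfl fun j _ =>
    Finset.sum_congr rfl fun k _ => Finset.sum_congr rfl fun l _ => ?_
  congr 1
  ring

/-- The real bilinear form `(v, w) ↦ conj (α v) * β w`. -/
def conjMul {x : X} (α β : TangentSpace (𝓡 m) x →ₗ[ℝ] ℂ) :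
    TangentSpace (𝓡 m) x →ₗ[ℝ] TangentSpace (𝓡 m) x →ₗ[ℝ] ℂ :=
  LinearMap.mk₂ ℝ (fun v w => conj (α v) * β w)
    (fun _ _ _ => by simp [add_mul]) (fun _ _ _ => by simp [mul_assoc])
    (fun _ _ _ => by simp [mul_add]) (fun _ _ _ => by simp [mul_left_comm])

omit [IsManifold (𝓡 m) ∞ X] in
theorem conjMul_apply {x : X} (α β : TangentSpace (𝓡 m) x →ₗ[ℝ] ℂ) (v w) :
    conjMul α β v w = conj (α v) * β w := rfl

theorem cotInner_eq_sum (g : RiemMetric m X) {x : X} {v : Fin m → TangentSpace (𝓡 m) x}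
    (hv : LinearIndependent ℝ v) (α β : TangentSpace (𝓡 m) x →ₗ[ℝ] ℂ) :
    g.cotInner x α β = ∑ i, ∑ j, (((g.gram x v)⁻¹ i j : ℝ) : ℂ) * (conj (α (v i)) * β (v j)) := by
  have h := g.sum_gram_inv_smul hv (conjMul α β)
  simp only [Complex.real_smul, conjMul_apply] at h
  exact h

theorem cotInner_add_right (g : RiemMetric m X) (x : X) (α β γ : TangentSpace (𝓡 m) x →ₗ[ℝ] ℂ) :
    g.cotInner x α (β + γ) = g.cotInner x α β + g.cotInner x α γ := by
  simp [cotInner, mul_add, Finset.sum_add_distrib]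

theorem cotInner_smul_right (g : RiemMetric m X) (x : X) (c : ℂ)
    (α β : TangentSpace (𝓡 m) x →ₗ[ℝ] ℂ) :
    g.cotInner x α (c • β) = c * g.cotInner x α β := by
  simp only [cotInner, LinearMap.smul_apply, smul_eq_mul, Finset.mul_sum]
  exact Finset.sum_congr rfl fun i _ => Finset.sum_congr rfl fun j _ => by ring

-- Writing the Gram matrix as G = AᵀA with A invertible, the rows of (A⁻¹)ᵀ are the components of an
-- orthonormal frame. In such a frame the pairings are standard Hermitian sums and Cauchy-Schwarz is
-- the Euclidean one.
open scoped MatrixOrder Matrix.Norms.L2Operator in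
theorem exists_orthonormal_frame (g : RiemMetric m X) (x : X) :
    ∃ v : Fin m → TangentSpace (𝓡 m) x, LinearIndependent ℝ v ∧ g.gram x v = 1 ∧
      ∀ w, w = ∑ i, g.inner x w (v i) • v i := by
  obtain ⟨A, hA, hG⟩ := CStarAlgebra.isStrictlyPositive_iff_eq_star_mul_self.1
    (g.gram_posDef x).isStrictlyPositive
  rw [Matrix.star_eq_conjTranspose, Matrix.conjTranspose_eq_transpose_of_trivial] at hG
  have hAu : IsUnit A.det := (Matrix.isUnit_iff_isUnit_det _).1 hA
  set N : Matrix (Fin m) (Fin m) ℝ := (A⁻¹).transpose with hN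
  set v : Fin m → TangentSpace (𝓡 m) x := fun i => ∑ k, N i k • fiberVec x k with hv
  have hgram : g.gram x v = 1 := by
    rw [hv, gram_sum_smul, hG, hN, Matrix.transpose_transpose,
      Matrix.mul_assoc, Matrix.mul_assoc, Matrix.mul_nonsing_inv _ hAu, Matrix.mul_one,
      ← Matrix.transpose_mul, Matrix.mul_nonsing_inv _ hAu, Matrix.transpose_one]
  have horth : ∀ i j, g.inner x (v i) (v j) = if i = j then 1 else 0 := by
    intro i j
    have := congrFun (congrFun hgram i) j
    simpa [gram, Matrix.one_apply] using this
  have hli : LinearIndependent ℝ v := by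
    rw [Fintype.linearIndependent_iff]
    intro c hc i
    have := congrArg (fun w => g.inner x (v i) w) hc
    simpa [map_sum, horth] using this
  have hspan : ⊤ ≤ Submodule.span ℝ (range v) := by
    have : FiniteDimensional ℝ (TangentSpace (𝓡 m) x) :=
      inferInstanceAs (FiniteDimensional ℝ (EuclideanSpace ℝ (Fin m)))
    have hc : Fintype.card (Fin m) = Module.finrank ℝ (TangentSpace (𝓡 m) x) :=
      (Fintype.card_fin m).trans (finrank_euclideanSpace_fin (𝕜 := ℝ) (n := m)).symm
    exact (hli.span_eq_top_of_card_eq_finrank' hc).ge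
  refine ⟨v, hli, hgram, fun w => ?_⟩
  obtain ⟨c, rfl⟩ := (Submodule.mem_span_range_iff_exists_fun ℝ).1 (hspan (Submodule.mem_top (x := w)))
  refine Finset.sum_congr rfl fun i _ => ?_
  simp [map_sum, sum_apply, horth]

theorem cotInner_of_gram_eq_one (g : RiemMetric m X) {x : X} {v : Fin m → TangentSpace (𝓡 m) x}
    (hv : LinearIndependent ℝ v) (hg : g.gram x v = 1) (α β : TangentSpace (𝓡 m) x →ₗ[ℝ] ℂ) :
    g.cotInner x α β = ∑ i, conj (α (v i)) * β (v i) := by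
  rw [g.cotInner_eq_sum hv, hg]
  simp [Matrix.one_apply, apply_ite]

theorem cotNormSq_of_gram_eq_one (g : RiemMetric m X) {x : X}
    {v : Fin m → TangentSpace (𝓡 m) x} (hv : LinearIndependent ℝ v) (hg : g.gram x v = 1)
    (α : TangentSpace (𝓡 m) x →ₗ[ℝ] ℂ) : g.cotNormSq x α = ∑ i, ‖α (v i)‖ ^ 2 := by
  rw [cotNormSq, g.cotInner_of_gram_eq_one hv hg, Complex.re_sum]
  refine Finset.sum_congr rfl fun i _ => ?_
  rw [mul_comm, Complex.mul_conj, Complex.ofReal_re, Complex.normSq_eq_norm_sq]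

theorem norm_cotInner_sq_le (g : RiemMetric m X) (x : X)
    (α β : TangentSpace (𝓡 m) x →ₗ[ℝ] ℂ) :
    ‖g.cotInner x α β‖ ^ 2 ≤ g.cotNormSq x α * g.cotNormSq x β := by
  obtain ⟨v, hv, hg, -⟩ := g.exists_orthonormal_frame x
  rw [g.cotInner_of_gram_eq_one hv hg, g.cotNormSq_of_gram_eq_one hv hg,
    g.cotNormSq_of_gram_eq_one hv hg]
  calc _ ≤ (∑ i, ‖α (v i)‖ * ‖β (v i)‖) ^ 2 := by
        gcongr
        refine (norm_sum_le _ _).trans_eq (Finset.sum_congr rfl fun i _ => by simp)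
    _ ≤ _ := Finset.sum_mul_sq_le_sq_mul_sq _ _ _

theorem norm_apply_sq_le (g : RiemMetric m X) (x : X) (α : TangentSpace (𝓡 m) x →ₗ[ℝ] ℂ)
    (w : TangentSpace (𝓡 m) x) : ‖α w‖ ^ 2 ≤ g.inner x w w * g.cotNormSq x α := by
  obtain ⟨v, hv, hg, hw⟩ := g.exists_orthonormal_frame x
  have h1 : g.inner x w w = ∑ i, (g.inner x w (v i)) ^ 2 := by
    conv_lhs => enter [2]; rw [hw w]
    simp [map_sum, sq]
  rw [h1, g.cotNormSq_of_gram_eq_one hv hg]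
  calc ‖α w‖ ^ 2 ≤ (∑ i, |g.inner x w (v i)| * ‖α (v i)‖) ^ 2 := by
        gcongr
        conv_lhs => rw [hw w, map_sum]
        refine (norm_sum_le _ _).trans_eq (Finset.sum_congr rfl fun i _ => by simp)
    _ ≤ _ := (Finset.sum_mul_sq_le_sq_mul_sq _ _ _).trans_eq (by simp)

theorem cotInner_conj_symm (g : RiemMetric m X) (x : X) (α β : TangentSpace (𝓡 m) x →ₗ[ℝ] ℂ) :
    conj (g.cotInner x β α) = g.cotInner x α β := by
  obtain ⟨v, hv, hg, -⟩ := g.exists_orthonormal_frame x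
  rw [g.cotInner_of_gram_eq_one hv hg, g.cotInner_of_gram_eq_one hv hg, map_sum]
  exact Finset.sum_congr rfl fun i _ => by simp [mul_comm]

theorem cotInner_self (g : RiemMetric m X) (x : X) (α : TangentSpace (𝓡 m) x →ₗ[ℝ] ℂ) :
    g.cotInner x α α = g.cotNormSq x α := by
  have := g.cotInner_conj_symm x α α
  rw [cotNormSq]
  exact (Complex.conj_eq_iff_re.1 this).symm

theorem cotNormSq_eq_zero_iff (g : RiemMetric m X) (x : X) (α : TangentSpace (𝓡 m) x →ₗ[ℝ] ℂ) :
    g.cotNormSq x α = 0 ↔ α = 0 := by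
  constructor
  · intro h
    ext w
    have := g.norm_apply_sq_le x α w
    rw [h, mul_zero] at this
    simpa using this
  · rintro rfl
    simp [cotNormSq, cotInner]

/-- Summing over the second pair of indices first gives the bilinear form (v, w) ↦ ⟨σ(v), σ(w)⟩, in
which only the first pair still needs a change of basis. -/
theorem tensorNormSq_eq_sum (g : RiemMetric m X) {x : X} {v : Fin m → TangentSpace (𝓡 m) x}
    (hv : LinearIndependent ℝ v)
    (σ : TangentSpace (𝓡 m) x →ₗ[ℝ] TangentSpace (𝓡 m) x →ₗ[ℝ] ℂ) :
    g.tensorNormSq x σ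
      = (∑ i, ∑ k, (((g.gram x v)⁻¹ i k : ℝ) : ℂ) * g.cotInner x (σ (v i)) (σ (v k))).re := by
  let b : TangentSpace (𝓡 m) x →ₗ[ℝ] TangentSpace (𝓡 m) x →ₗ[ℝ] ℂ :=
    LinearMap.mk₂ ℝ (fun v w => g.cotInner x (σ v) (σ w))
      (fun _ _ _ => by simp [cotInner, mul_add, add_mul, Finset.sum_add_distrib])
      (fun c v w => by
        simp only [cotInner, map_smul, LinearMap.smul_apply, Finset.smul_sum, Complex.real_smul,
          map_mul, Complex.conj_ofReal]
        exact Finset.sum_congr rfl fun i _ => Finset.sum_congr rfl fun j _ => by ring)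
      (fun _ _ _ => by simp [cotInner, mul_add, Finset.sum_add_distrib])
      (fun c v w => by
        simp only [cotInner, map_smul, LinearMap.smul_apply, Finset.smul_sum, Complex.real_smul]
        exact Finset.sum_congr rfl fun i _ => Finset.sum_congr rfl fun j _ => by ring)
  have h := g.sum_gram_inv_smul hv b
  simp only [Complex.real_smul] at h
  rw [tensorNormSq]
  congr 1
  refine Eq.trans ?_ h
  refine Finset.sum_congr rfl fun i _ => ?_
  rw [Finset.sum_comm]
  refine Finset.sum_congr rfl fun k _ => ?_
  change _ = _ * g.cotInner x (σ (fiberVec x i)) (σ (fiberVec x k))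
  simp only [cotInner, Finset.mul_sum]
  refine Finset.sum_congr rfl fun j _ => Finset.sum_congr rfl fun l _ => ?_
  push_cast
  ring

theorem tensorNormSq_of_gram_eq_one (g : RiemMetric m X) {x : X}
    {v : Fin m → TangentSpace (𝓡 m) x} (hv : LinearIndependent ℝ v) (hg : g.gram x v = 1)
    (σ : TangentSpace (𝓡 m) x →ₗ[ℝ] TangentSpace (𝓡 m) x →ₗ[ℝ] ℂ) :
    g.tensorNormSq x σ = ∑ i, g.cotNormSq x (σ (v i)) := by
  rw [g.tensorNormSq_eq_sum hv, hg]
  simp [Matrix.one_apply, cotNormSq]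

theorem tensorNormSq_nonneg (g : RiemMetric m X) (x : X)
    (σ : TangentSpace (𝓡 m) x →ₗ[ℝ] TangentSpace (𝓡 m) x →ₗ[ℝ] ℂ) : 0 ≤ g.tensorNormSq x σ := by
  obtain ⟨v, hv, hg, -⟩ := g.exists_orthonormal_frame x
  rw [g.tensorNormSq_of_gram_eq_one hv hg]
  exact Finset.sum_nonneg fun i _ => g.cotNormSq_nonneg x _

/-- The differential of `(|α|² + η²)^{1/2}` for a covector field `α` with covariant derivative
`σ`. -/
def normDiff (g : RiemMetric m X) (η : ℝ) (x : X) (α : TangentSpace (𝓡 m) x →ₗ[ℝ] ℂ)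
    (σ : TangentSpace (𝓡 m) x →ₗ[ℝ] TangentSpace (𝓡 m) x →ₗ[ℝ] ℂ) :
    TangentSpace (𝓡 m) x →ₗ[ℝ] ℂ where
  toFun v := (((g.cotInner x α (σ v)).re / Real.sqrt (g.cotNormSq x α + η ^ 2) : ℝ) : ℂ)
  map_add' v w := by
    rw [map_add, cotInner_add_right, Complex.add_re, add_div, Complex.ofReal_add]
  map_smul' c v := by
    have : σ (c • v) = (c : ℂ) • σ v := by ext; simp
    rw [this, cotInner_smul_right, Complex.re_ofReal_mul, mul_div_assoc]
    simp

/-- Kato's inequality at a point. -/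
theorem cotNormSq_normDiff_le (g : RiemMetric m X) (η : ℝ) (x : X)
    (α : TangentSpace (𝓡 m) x →ₗ[ℝ] ℂ)
    (σ : TangentSpace (𝓡 m) x →ₗ[ℝ] TangentSpace (𝓡 m) x →ₗ[ℝ] ℂ) :
    g.cotNormSq x (g.normDiff η x α σ) ≤ g.tensorNormSq x σ := by
  obtain ⟨v, hv, hg, -⟩ := g.exists_orthonormal_frame x
  rw [g.cotNormSq_of_gram_eq_one hv hg, g.tensorNormSq_of_gram_eq_one hv hg]
  refine Finset.sum_le_sum fun i _ => ?_
  have h0 := g.cotNormSq_nonneg x α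
  have h1 : 0 ≤ g.cotNormSq x α + η ^ 2 := by positivity
  -- Cauchy-Schwarz for covectors; adding η² only enlarges the right-hand side.
  have h2 : (g.cotInner x α (σ (v i))).re ^ 2
      ≤ g.cotNormSq x (σ (v i)) * (g.cotNormSq x α + η ^ 2) := by
    have a1 := g.norm_cotInner_sq_le x α (σ (v i))
    have a2 : (g.cotInner x α (σ (v i))).re ^ 2 ≤ ‖g.cotInner x α (σ (v i))‖ ^ 2 :=
      sq_le_sq.2 (by rw [abs_norm]; exact Complex.abs_re_le_norm _)
    nlinarith [g.cotNormSq_nonneg x (σ (v i)), sq_nonneg η,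
      mul_nonneg (g.cotNormSq_nonneg x (σ (v i))) (sq_nonneg η)]
  change ‖(((g.cotInner x α (σ (v i))).re / Real.sqrt (g.cotNormSq x α + η ^ 2) : ℝ) : ℂ)‖ ^ 2 ≤ _
  rw [Complex.norm_real, Real.norm_eq_abs, sq_abs, div_pow, Real.sq_sqrt h1]
  -- The denominator may vanish when η = 0 and α = 0; the quotient is then 0 by convention and the
  -- bound persists.
  exact div_le_of_le_mul₀ h1 (g.cotNormSq_nonneg x _) h2

end RiemMetric

end

/-! ### Charts: smoothness of the metric coefficients and transformation of the volume density. -/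

section

namespace RiemMetric

attribute [local instance] chartedSpaceSelf

variable {m : ℕ} {X : Type*} [TopologicalSpace X] [ChartedSpace (EuclideanSpace ℝ (Fin m)) X]
  [IsManifold (𝓡 m) ∞ X] {e : OpenPartialHomeomorph X (EuclideanSpace ℝ (Fin m))}

theorem contMDiffOn_symm_of_atlas (he : e ∈ atlas (EuclideanSpace ℝ (Fin m)) X) :
    ContMDiffOn (𝓡 m) (𝓡 m) ∞ e.symm e.target :=
  contMDiffOn_symm_of_mem_maximalAtlas (IsManifold.subset_maximalAtlas he)

theorem mdifferentiable_of_atlas (he : e ∈ atlas (EuclideanSpace ℝ (Fin m)) X) :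
    e.MDifferentiable (𝓡 m) (𝓡 m) :=
  haveI : IsManifold (𝓡 m) 1 X := IsManifold.of_le (n := ∞) (by simp)
  mdifferentiable_of_mem_atlas he

theorem linearIndependent_coordVec (he : e ∈ atlas (EuclideanSpace ℝ (Fin m)) X)
    {y : EuclideanSpace ℝ (Fin m)} (hy : y ∈ e.target) : LinearIndependent ℝ (coordVec e y) := by
  have h1 : LinearIndependent ℝ (stdVec : Fin m → EuclideanSpace ℝ (Fin m)) := by
    have := (EuclideanSpace.basisFun (Fin m) ℝ).toBasis.linearIndependent
    convert! this using 1
    ext i : 1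
    simp [stdVec]
  exact h1.map' (mfderiv (𝓡 m) (𝓡 m) e.symm y).toLinearMap
    (LinearMap.ker_eq_bot.2 ((mdifferentiable_of_atlas he).symm.mfderiv_injective hy))

theorem coordGram_posDef (g : RiemMetric m X) (he : e ∈ atlas (EuclideanSpace ℝ (Fin m)) X)
    {y : EuclideanSpace ℝ (Fin m)} (hy : y ∈ e.target) : (g.coordGram e y).PosDef :=
  g.gram_posDef_of_linearIndependent (linearIndependent_coordVec he hy)

theorem contMDiffOn_coordVec (he : e ∈ atlas (EuclideanSpace ℝ (Fin m)) X) (i : Fin m) :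
    ContMDiffOn (𝓡 m) ((𝓡 m).prod 𝓘(ℝ, EuclideanSpace ℝ (Fin m))) ∞
      (fun y => (Bundle.TotalSpace.mk' (EuclideanSpace ℝ (Fin m)) (e.symm y) (coordVec e y i) :
        TangentBundle (𝓡 m) X)) e.target := by
  have h1 := (contMDiffOn_symm_of_atlas he).contMDiffOn_tangentMapWithin (m := ∞) (by simp)
    e.open_target.uniqueMDiffOn
  have h2 : ContMDiff (𝓡 m) ((𝓡 m).prod 𝓘(ℝ, EuclideanSpace ℝ (Fin m))) ∞
      (fun y => (Bundle.TotalSpace.mk' (EuclideanSpace ℝ (Fin m)) y (stdVec i) :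
        TangentBundle (𝓡 m) (EuclideanSpace ℝ (Fin m)))) :=
    contMDiff_vectorSpace_iff_contDiff.2 contDiff_const
  refine ContMDiffOn.congr (h1.comp h2.contMDiffOn fun y hy => hy) fun y hy => ?_
  simp only [Function.comp, tangentMapWithin, coordVec,
    mfderivWithin_of_isOpen e.open_target hy]

theorem contDiffOn_coordGram (g : RiemMetric m X) (he : e ∈ atlas (EuclideanSpace ℝ (Fin m)) X)
    (i j : Fin m) : ContDiffOn ℝ ∞ (fun y => g.coordGram e y i j) e.target := by
  rw [← contMDiffOn_iff_contDiffOn]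
  intro y hy
  have : ContMDiffWithinAt (𝓡 m) ((𝓡 m).prod 𝓘(ℝ)) ∞
      (fun y ↦ Bundle.TotalSpace.mk' ℝ (E := Bundle.Trivial X ℝ) (e.symm y)
        (g.inner (e.symm y) (coordVec e y i) (coordVec e y j))) e.target y := by
    apply ContMDiffWithinAt.clm_bundle_apply₂ (F₁ := EuclideanSpace ℝ (Fin m))
      (F₂ := EuclideanSpace ℝ (Fin m))
    · exact ContMDiffAt.comp_contMDiffWithinAt y g.contMDiff.contMDiffAt
        (contMDiffOn_symm_of_atlas he y hy)
    · exact contMDiffOn_coordVec he i y hy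
    · exact contMDiffOn_coordVec he j y hy
  simp only [Bundle.contMDiffWithinAt_totalSpace] at this
  exact this.2

/-- By Cramer's rule the entries of the inverse are determinants divided by a determinant that is
positive on the chart. -/
theorem contDiffOn_coordGram_inv (g : RiemMetric m X)
    (he : e ∈ atlas (EuclideanSpace ℝ (Fin m)) X) (i j : Fin m) :
    ContDiffOn ℝ ∞ (fun y => (g.coordGram e y)⁻¹ i j) e.target := by
  have hdet : ∀ A : EuclideanSpace ℝ (Fin m) → Matrix (Fin m) (Fin m) ℝ,
      (∀ i j, ContDiffOn ℝ ∞ (fun y => A y i j) e.target) →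
        ContDiffOn ℝ ∞ (fun y => (A y).det) e.target := by
    intro A hA
    simp only [Matrix.det_apply]
    exact ContDiffOn.sum fun σ _ => (contDiffOn_prod fun k _ => hA _ _).const_smul _
  have hG := g.contDiffOn_coordGram he
  simp only [Matrix.inv_def, Matrix.smul_apply, Matrix.adjugate_apply, Ring.inverse_eq_inv',
    smul_eq_mul]
  refine ((hdet _ hG).inv fun y hy => (g.coordGram_posDef he hy).det_pos.ne').mul (hdet _ ?_)
  intro a b
  simp only [Matrix.updateRow_apply]
  split_ifs
  · exact contDiffOn_const
  · exact hG _ _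

/-- The Riemannian volume density in the coordinates of the chart `e`. -/
def volDensity (g : RiemMetric m X) (e : OpenPartialHomeomorph X (EuclideanSpace ℝ (Fin m)))
    (y : EuclideanSpace ℝ (Fin m)) : ℝ :=
  Real.sqrt (g.coordGram e y).det

theorem volDensity_pos (g : RiemMetric m X) (he : e ∈ atlas (EuclideanSpace ℝ (Fin m)) X)
    {y : EuclideanSpace ℝ (Fin m)} (hy : y ∈ e.target) : 0 < g.volDensity e y :=
  Real.sqrt_pos.2 (g.coordGram_posDef he hy).det_pos

theorem continuousOn_volDensity (g : RiemMetric m X)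
    (he : e ∈ atlas (EuclideanSpace ℝ (Fin m)) X) : ContinuousOn (g.volDensity e) e.target := by
  refine Real.continuous_sqrt.comp_continuousOn ?_
  simp only [Matrix.det_apply]
  exact continuousOn_finsetSum _ fun σ _ => (continuousOn_finsetProd _ fun k _ =>
    (g.contDiffOn_coordGram he _ _).continuousOn).const_smul _

/-- The coordinate vector `∂ᵢ` of the chart `e` as a vector of the model space. -/
def coordVecModel (e : OpenPartialHomeomorph X (EuclideanSpace ℝ (Fin m)))
    (y : EuclideanSpace ℝ (Fin m)) (i : Fin m) : EuclideanSpace ℝ (Fin m) :=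
  fiberEquiv (e.symm y) (coordVec e y i)

/-- The metric at the point `x` as a bilinear map on the model space. -/
def innerModel (g : RiemMetric m X) (x : X) (v w : EuclideanSpace ℝ (Fin m)) : ℝ :=
  g.inner x ((fiberEquiv x).symm v) ((fiberEquiv x).symm w)

theorem innerModel_sum_smul (g : RiemMetric m X) (x : X) (a b : Fin m → ℝ)
    (v : Fin m → EuclideanSpace ℝ (Fin m)) :
    g.innerModel x (∑ k, a k • v k) (∑ l, b l • v l)
      = ∑ k, ∑ l, a k * b l * g.innerModel x (v k) (v l) := by
  simp only [innerModel, map_sum, map_smul, sum_apply, smul_apply, smul_eq_mul, Finset.mul_sum]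
  rw [Finset.sum_comm]
  exact Finset.sum_congr rfl fun k _ => Finset.sum_congr rfl fun l _ => by ring

/-- With vectors taken in the fixed model space, a base point can be rewritten without moving
between tangent spaces. This is needed when two charts are compared. -/
theorem coordGram_eq_innerModel (g : RiemMetric m X)
    (e : OpenPartialHomeomorph X (EuclideanSpace ℝ (Fin m))) (y : EuclideanSpace ℝ (Fin m))
    (i j : Fin m) : g.coordGram e y i j
      = g.innerModel (e.symm y) (coordVecModel e y i) (coordVecModel e y j) := rfl

variable {e' : OpenPartialHomeomorph X (EuclideanSpace ℝ (Fin m))}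

theorem differentiableAt_transition (he : e ∈ atlas (EuclideanSpace ℝ (Fin m)) X)
    (he' : e' ∈ atlas (EuclideanSpace ℝ (Fin m)) X) {y : EuclideanSpace ℝ (Fin m)}
    (hy : y ∈ e.target) (hy' : e.symm y ∈ e'.source) :
    DifferentiableAt ℝ (fun z => e' (e.symm z)) y := by
  rw [← mdifferentiableAt_iff_differentiableAt]
  exact ((mdifferentiable_of_atlas he').mdifferentiableAt hy').comp y
    ((mdifferentiable_of_atlas he).mdifferentiableAt_symm hy)

/-- Chain rule for the identity e⁻¹ = e'⁻¹ ∘ (e' ∘ e⁻¹), which holds near y. -/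
theorem coordVecModel_transition (he : e ∈ atlas (EuclideanSpace ℝ (Fin m)) X)
    (he' : e' ∈ atlas (EuclideanSpace ℝ (Fin m)) X) {y : EuclideanSpace ℝ (Fin m)}
    (hy : y ∈ e.target) (hy' : e.symm y ∈ e'.source) (i : Fin m) :
    coordVecModel e y i = ∑ k, fderiv ℝ (fun z => e' (e.symm z)) y (stdVec i) k •
      coordVecModel e' (e' (e.symm y)) k := by
  have hd := differentiableAt_transition he he' hy hy'
  have h1 : mfderiv (𝓡 m) (𝓡 m) (fun z => e'.symm (e' (e.symm z))) y
      = (mfderiv (𝓡 m) (𝓡 m) e'.symm (e' (e.symm y))).comp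
          (mfderiv (𝓡 m) (𝓡 m) (fun z => e' (e.symm z)) y) :=
    mfderiv_comp y ((mdifferentiable_of_atlas he').mdifferentiableAt_symm (e'.map_source hy'))
      hd.mdifferentiableAt
  have h2 : (fun z => e'.symm (e' (e.symm z))) =ᶠ[𝓝 y] e.symm := by
    have : ∀ᶠ z in 𝓝 y, e.symm z ∈ e'.source :=
      (e.continuousAt_symm hy).eventually (e'.open_source.mem_nhds hy')
    filter_upwards [this] with z hz using e'.left_inv hz
  have h3 := h2.mfderiv_eq (I := 𝓡 m) (I' := 𝓡 m)
  have h5 : coordVecModel e y i = mfderiv (𝓡 m) (𝓡 m) e'.symm (e' (e.symm y))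
      (fderiv ℝ (fun z => e' (e.symm z)) y (stdVec i)) := by
    have := congrArg (fun L => L (stdVec i)) (h3.symm.trans h1)
    rw [mfderiv_eq_fderiv] at this
    exact this
  rw [h5]
  set w := fderiv ℝ (fun z => e' (e.symm z)) y (stdVec i)
  have hw : w = ∑ k, w k • stdVec k := by
    ext l
    simp [stdVec, Pi.single_apply]
  conv_lhs => rw [hw]
  have h6 : ∀ L : EuclideanSpace ℝ (Fin m) →L[ℝ] EuclideanSpace ℝ (Fin m),
      L (∑ k, w k • stdVec k) = ∑ k, w k • L (stdVec k) := fun L => by simp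
  exact h6 (mfderiv (𝓡 m) (𝓡 m) e'.symm (e' (e.symm y)))

/-- If M is the matrix of the derivative of the transition map, the Gram matrices satisfy G = M G'
Mᵀ. So det G = (det M)² det G', and the square root produces |det M|. -/
theorem volDensity_transition (g : RiemMetric m X) (he : e ∈ atlas (EuclideanSpace ℝ (Fin m)) X)
    (he' : e' ∈ atlas (EuclideanSpace ℝ (Fin m)) X) {y : EuclideanSpace ℝ (Fin m)}
    (hy : y ∈ e.target) (hy' : e.symm y ∈ e'.source) :
    g.volDensity e y = |(fderiv ℝ (fun z => e' (e.symm z)) y).det| *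
      g.volDensity e' (e' (e.symm y)) := by
  set D := fderiv ℝ (fun z => e' (e.symm z)) y with hD
  set M : Matrix (Fin m) (Fin m) ℝ := Matrix.of fun i k => D (stdVec i) k with hM
  have h1 : g.coordGram e y = M * g.coordGram e' (e' (e.symm y)) * M.transpose := by
    ext i j
    simp only [coordGram_eq_innerModel, coordVecModel_transition he he' hy hy', Matrix.mul_apply,
      Matrix.transpose_apply, e'.left_inv hy', innerModel_sum_smul, Finset.sum_mul]
    rw [Finset.sum_comm]
    refine Finset.sum_congr rfl fun a _ => Finset.sum_congr rfl fun b _ => ?_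
    simp only [hM, hD, Matrix.of_apply]
    ring
  have h2 : D.det = M.det := by
    rw [← Matrix.det_transpose, ContinuousLinearMap.det,
      ← LinearMap.det_toMatrix (EuclideanSpace.basisFun (Fin m) ℝ).toBasis]
    congr 1
  rw [volDensity, volDensity, h1, Matrix.det_mul, Matrix.det_mul, Matrix.det_transpose, h2,
    mul_right_comm, Real.sqrt_mul (mul_self_nonneg _), Real.sqrt_mul_self_eq_abs]

end RiemMetric

end

/-! ### The Riemannian measure and its comparison with Lebesgue measure in charts. -/

section

namespace RiemMetric

variable {m : ℕ} {X : Type*} [TopologicalSpace X] [ChartedSpace (EuclideanSpace ℝ (Fin m)) X]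
  [MeasurableSpace X] [BorelSpace X]
  {e e' : OpenPartialHomeomorph X (EuclideanSpace ℝ (Fin m))} {Ω : Set X}

omit [ChartedSpace (EuclideanSpace ℝ (Fin m)) X] in
theorem isOpen_coordDomain (e : OpenPartialHomeomorph X (EuclideanSpace ℝ (Fin m)))
    (hΩ : IsOpen Ω) : IsOpen (coordDomain Ω e) :=
  e.isOpen_inter_preimage_symm hΩ

omit [ChartedSpace (EuclideanSpace ℝ (Fin m)) X] in
theorem measurableSet_coordDomain (e : OpenPartialHomeomorph X (EuclideanSpace ℝ (Fin m)))
    (hΩ : MeasurableSet Ω) : MeasurableSet (coordDomain Ω e) := by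
  have h : Measurable (e.target.domRestrict e.symm) :=
    (continuousOn_iff_continuous_domRestrict.1 e.continuousOn_symm).measurable
  have := e.open_target.measurableSet.subtype_image (h hΩ)
  convert this using 1
  ext y
  simp [coordDomain, and_comm]

omit [ChartedSpace (EuclideanSpace ℝ (Fin m)) X] in
theorem aemeasurable_symm (e : OpenPartialHomeomorph X (EuclideanSpace ℝ (Fin m))) :
    AEMeasurable e.symm (volume.restrict e.target) :=
  e.continuousOn_symm.aemeasurable e.open_target.measurableSet

omit [ChartedSpace (EuclideanSpace ℝ (Fin m)) X] in
theorem aemeasurable_symm_coordDomain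
    (e : OpenPartialHomeomorph X (EuclideanSpace ℝ (Fin m))) :
    AEMeasurable e.symm (volume.restrict (coordDomain Ω e)) :=
  (aemeasurable_symm e).mono_set inter_subset_left

variable [IsManifold (𝓡 m) ∞ X] (g : RiemMetric m X)

theorem aemeasurable_volDensity (he : e ∈ atlas (EuclideanSpace ℝ (Fin m)) X) :
    AEMeasurable (fun y => ENNReal.ofReal (g.volDensity e y)) (volume.restrict e.target) :=
  ((g.continuousOn_volDensity he).aemeasurable e.open_target.measurableSet).ennreal_ofReal

theorem chartVolume_apply (e : OpenPartialHomeomorph X (EuclideanSpace ℝ (Fin m)))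
    {s : Set X} (hs : MeasurableSet s) :
    g.chartVolume e s = ∫⁻ y in coordDomain s e, ENNReal.ofReal (g.volDensity e y) := by
  rw [chartVolume, Measure.map_apply_of_aemeasurable
    ((aemeasurable_symm e).mono_ac (withDensity_absolutelyContinuous _ _)) hs, withDensity_apply',
    Measure.restrict_restrict' e.open_target.measurableSet, inter_comm]
  rfl

theorem chartVolume_source_compl : g.chartVolume e e.sourceᶜ = 0 := by
  rw [chartVolume_apply _ _ e.open_source.measurableSet.compl]
  have : coordDomain e.sourceᶜ e = ∅ := by
    ext y
    simp only [coordDomain, mem_inter_iff, mem_preimage, mem_compl_iff, mem_empty_iff_false,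
      iff_false, not_and, not_not]
    exact fun hy => e.map_target hy
  rw [this]
  simp

/-- Change of variables along the transition map: the Jacobian cancels against the transformation of
the density. -/
theorem chartVolume_apply_eq_of_subset (he : e ∈ atlas (EuclideanSpace ℝ (Fin m)) X)
    (he' : e' ∈ atlas (EuclideanSpace ℝ (Fin m)) X) {s : Set X} (hs : MeasurableSet s)
    (hse : s ⊆ e.source) (hse' : s ⊆ e'.source) : g.chartVolume e s = g.chartVolume e' s := by
  rw [chartVolume_apply _ _ hs, chartVolume_apply _ _ hs]
  have himage : (fun z => e' (e.symm z)) '' coordDomain s e = coordDomain s e' := by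
    ext y
    constructor
    · rintro ⟨z, ⟨hz, hzs⟩, rfl⟩
      refine ⟨e'.map_source (hse' hzs), ?_⟩
      rw [mem_preimage, e'.left_inv (hse' hzs)]
      exact hzs
    · rintro ⟨hy, hys⟩
      refine ⟨e (e'.symm y), ⟨e.map_source (hse hys), ?_⟩, ?_⟩
      · rw [mem_preimage, e.left_inv (hse hys)]
        exact hys
      · change e' (e.symm (e (e'.symm y))) = y
        rw [e.left_inv (hse hys), e'.right_inv hy]
  have hinj : InjOn (fun z => e' (e.symm z)) (coordDomain s e) := by
    rintro z ⟨hz, hzs⟩ w ⟨hw, hws⟩ h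
    have := e'.injOn (hse' hzs) (hse' hws) h
    exact e.symm.injOn hz hw this
  have hder : ∀ y ∈ coordDomain s e, HasFDerivWithinAt (fun z => e' (e.symm z))
      (fderiv ℝ (fun z => e' (e.symm z)) y) (coordDomain s e) y := fun y hy =>
    (differentiableAt_transition he he' hy.1 (hse' hy.2)).hasFDerivAt.hasFDerivWithinAt
  rw [← himage, lintegral_image_eq_lintegral_abs_det_fderiv_mul _
    (measurableSet_coordDomain e hs) hder hinj]
  refine setLIntegral_congr_fun (measurableSet_coordDomain e hs) fun y hy => ?_
  rw [g.volDensity_transition he he' hy.1 (hse' hy.2), ENNReal.ofReal_mul (abs_nonneg _)]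

theorem chartVolume_le_vol (he : e ∈ atlas (EuclideanSpace ℝ (Fin m)) X) :
    g.chartVolume e ≤ g.vol :=
  le_iSup₂ (f := fun e (_ : e ∈ atlas (EuclideanSpace ℝ (Fin m)) X) => g.chartVolume e) e he

/-- By agreement on overlaps, the measure of any chart e' is at most the measure of e plus the part
of `vol` outside the domain of e. The supremum obeys the same bound, and restriction to the domain
of e removes the second summand. -/
theorem vol_restrict_source (he : e ∈ atlas (EuclideanSpace ℝ (Fin m)) X) :
    g.vol.restrict e.source = g.chartVolume e := by
  have hU := e.open_source.measurableSet
  have hres : (g.chartVolume e).restrict e.source = g.chartVolume e :=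
    Measure.restrict_eq_self_of_ae_mem (g.chartVolume_source_compl)
  apply le_antisymm
  · have h1 : g.vol ≤ g.chartVolume e + g.vol.restrict e.sourceᶜ := by
      refine iSup₂_le fun e' he' => ?_
      refine Measure.le_iff.2 fun s hs => ?_
      rw [Measure.add_apply, Measure.restrict_apply hs, ← sdiff_eq,
        ← measure_inter_add_sdiff s hU]
      refine add_le_add ?_ ?_
      · rw [← measure_inter_add_sdiff₀ (s ∩ e.source) e'.open_source.measurableSet.nullMeasurableSet]
        have : g.chartVolume e' ((s ∩ e.source) \ e'.source) = 0 :=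
          measure_mono_null (fun x hx => hx.2) g.chartVolume_source_compl
        rw [this, add_zero, ← g.chartVolume_apply_eq_of_subset he he'
          ((hs.inter hU).inter e'.open_source.measurableSet) (fun x hx => hx.1.2)
          fun x hx => hx.2]
        exact measure_mono fun x hx => hx.1.1
      · exact g.chartVolume_le_vol he' _
    calc g.vol.restrict e.source
        ≤ (g.chartVolume e + g.vol.restrict e.sourceᶜ).restrict e.source :=
          Measure.restrict_mono_measure h1 _
      _ = g.chartVolume e := by
          rw [Measure.restrict_add, hres, Measure.restrict_restrict hU, inter_compl_self,
            Measure.restrict_empty, add_zero]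
  · rw [← hres]
    exact Measure.restrict_mono_measure (g.chartVolume_le_vol he) _

/-- The Riemannian measure in the coordinates of the chart `e`, on the part of its domain in `Ω`. -/
def coordVol (Ω : Set X) (e : OpenPartialHomeomorph X (EuclideanSpace ℝ (Fin m))) :
    Measure (EuclideanSpace ℝ (Fin m)) :=
  (volume.restrict (coordDomain Ω e)).withDensity fun y => ENNReal.ofReal (g.volDensity e y)

theorem coordVol_ac : g.coordVol Ω e ≪ volume.restrict (coordDomain Ω e) :=
  withDensity_absolutelyContinuous _ _

/-- The density is positive, so Riemannian and Lebesgue null sets coincide in a chart. All transfers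
of almost-everywhere statements and of measurability rest on this. -/
theorem ac_coordVol (he : e ∈ atlas (EuclideanSpace ℝ (Fin m)) X) (hΩ : MeasurableSet Ω) :
    volume.restrict (coordDomain Ω e) ≪ g.coordVol Ω e := by
  refine withDensity_absolutelyContinuous'
    ((g.aemeasurable_volDensity he).mono_set inter_subset_left) ?_
  filter_upwards [ae_restrict_mem (measurableSet_coordDomain e hΩ)] with y hy
  simpa using g.volDensity_pos he hy.1

theorem vol_restrict_inter_source (he : e ∈ atlas (EuclideanSpace ℝ (Fin m)) X)
    (hΩ : MeasurableSet Ω) : g.vol.restrict (Ω ∩ e.source) = (g.coordVol Ω e).map e.symm := by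
  ext s hs
  rw [Measure.map_apply_of_aemeasurable
    ((aemeasurable_symm_coordDomain e).mono_ac g.coordVol_ac) hs, coordVol, withDensity_apply',
    Measure.restrict_restrict' (measurableSet_coordDomain e hΩ), Measure.restrict_apply hs,
    ← inter_assoc, ← Measure.restrict_apply (hs.inter hΩ), g.vol_restrict_source he,
    chartVolume_apply _ _ (hs.inter hΩ)]
  congr 2
  ext y
  simp only [coordDomain, mem_inter_iff, mem_preimage]
  tauto

theorem ae_coord_of_ae (he : e ∈ atlas (EuclideanSpace ℝ (Fin m)) X) (hΩ : MeasurableSet Ω)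
    {P : X → Prop} (h : ∀ᵐ x ∂g.vol.restrict Ω, P x) :
    ∀ᵐ y ∂volume.restrict (coordDomain Ω e), P (e.symm y) := by
  have h1 : ∀ᵐ x ∂(g.coordVol Ω e).map e.symm, P x := by
    rw [← g.vol_restrict_inter_source he hΩ]
    exact ae_restrict_of_ae_restrict_of_subset inter_subset_left h
  exact (g.ac_coordVol he hΩ).ae_le
    (ae_of_ae_map ((aemeasurable_symm_coordDomain e).mono_ac g.coordVol_ac) h1)

theorem vol_restrict_inter_source_map (he : e ∈ atlas (EuclideanSpace ℝ (Fin m)) X)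
    (hΩ : MeasurableSet Ω) :
    (g.vol.restrict (Ω ∩ e.source)).map e = g.coordVol Ω e := by
  have hm : AEMeasurable e (g.vol.restrict (Ω ∩ e.source)) :=
    (e.continuousOn.aemeasurable e.open_source.measurableSet).mono_set inter_subset_right
  rw [g.vol_restrict_inter_source he hΩ] at hm ⊢
  rw [AEMeasurable.map_map_of_aemeasurable hm
    ((aemeasurable_symm_coordDomain e).mono_ac g.coordVol_ac)]
  have : (e ∘ e.symm) =ᵐ[g.coordVol Ω e] id := by
    refine g.coordVol_ac.ae_le ?_
    filter_upwards [ae_restrict_mem (measurableSet_coordDomain e hΩ)] with y hy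
    exact e.right_inv hy.1
  rw [Measure.map_congr this, Measure.map_id]

theorem lintegral_inter_source (he : e ∈ atlas (EuclideanSpace ℝ (Fin m)) X)
    (hΩ : MeasurableSet Ω) {f : X → ℝ≥0∞} (hf : AEMeasurable f (g.vol.restrict Ω)) :
    ∫⁻ x in Ω ∩ e.source, f x ∂g.vol
      = ∫⁻ y in coordDomain Ω e, ENNReal.ofReal (g.volDensity e y) * f (e.symm y) := by
  have hf' : AEMeasurable f (g.vol.restrict (Ω ∩ e.source)) := hf.mono_set inter_subset_left
  have hs : AEMeasurable e.symm (g.coordVol Ω e) :=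
    (aemeasurable_symm_coordDomain e).mono_ac g.coordVol_ac
  rw [g.vol_restrict_inter_source he hΩ] at hf' ⊢
  have hd : AEMeasurable (fun y => ENNReal.ofReal (g.volDensity e y))
      (volume.restrict (coordDomain Ω e)) :=
    (g.aemeasurable_volDensity he).mono_set inter_subset_left
  have hfs : AEMeasurable (fun y => f (e.symm y)) (volume.restrict (coordDomain Ω e)) :=
    (hf'.comp_aemeasurable hs).mono_ac (g.ac_coordVol he hΩ)
  rw [lintegral_map' hf' hs, coordVol, lintegral_withDensity_eq_lintegral_mul₀ hd hfs]
  rfl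

section Countable

variable [SecondCountableTopology X]

omit [MeasurableSpace X] [BorelSpace X] [IsManifold (𝓡 m) ∞ X] in
theorem exists_countable_atlas_cover (m : ℕ) (X : Type*) [TopologicalSpace X]
    [ChartedSpace (EuclideanSpace ℝ (Fin m)) X] [SecondCountableTopology X] :
    ∃ T : Set (OpenPartialHomeomorph X (EuclideanSpace ℝ (Fin m))), T.Countable ∧
      T ⊆ atlas (EuclideanSpace ℝ (Fin m)) X ∧ ⋃ e ∈ T, e.source = univ := by
  obtain ⟨s, hs, hU⟩ := TopologicalSpace.countable_cover_nhds
    (chart_source_mem_nhds (EuclideanSpace ℝ (Fin m)) : ∀ x : X, _)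
  refine ⟨chartAt (EuclideanSpace ℝ (Fin m)) '' s, hs.image _, ?_, by simpa using hU⟩
  rintro _ ⟨x, -, rfl⟩
  exact chart_mem_atlas _ x

/-- Second countability supplies a countable cover by chart domains, so null sets can be tested
chart by chart. -/
theorem ae_iff_forall_coord (hΩ : MeasurableSet Ω) {P : X → Prop} :
    (∀ᵐ x ∂g.vol.restrict Ω, P x) ↔ ∀ e ∈ atlas (EuclideanSpace ℝ (Fin m)) X,
      ∀ᵐ y ∂volume.restrict (coordDomain Ω e), P (e.symm y) := by
  refine ⟨fun h e he => g.ae_coord_of_ae he hΩ h, fun h => ?_⟩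
  obtain ⟨T, hT, hTa, hU⟩ := exists_countable_atlas_cover m X
  rw [← inter_univ Ω, ← hU, inter_iUnion₂, ae_restrict_biUnion_iff _ hT]
  intro e he
  have h1 : ∀ᵐ y ∂g.coordVol Ω e, P (e.symm y) := g.coordVol_ac.ae_le (h e (hTa he))
  have hm : AEMeasurable e (g.vol.restrict (Ω ∩ e.source)) :=
    (e.continuousOn.aemeasurable e.open_source.measurableSet).mono_set inter_subset_right
  rw [← g.vol_restrict_inter_source_map (hTa he) hΩ] at h1
  filter_upwards [ae_of_ae_map hm h1,
    ae_restrict_mem (hΩ.inter e.open_source.measurableSet)] with x hx hxs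
  rwa [e.left_inv hxs.2] at hx

theorem aestronglyMeasurable_of_forall_coord {F : Type*} [NormedAddCommGroup F]
    (hΩ : MeasurableSet Ω) {f : X → F}
    (h : ∀ e ∈ atlas (EuclideanSpace ℝ (Fin m)) X,
      AEStronglyMeasurable (fun y => f (e.symm y)) (volume.restrict (coordDomain Ω e))) :
    AEStronglyMeasurable f (g.vol.restrict Ω) := by
  obtain ⟨T, hT, hTa, hU⟩ := exists_countable_atlas_cover m X
  have := hT.to_subtype
  rw [← inter_univ Ω, ← hU, biUnion_eq_iUnion, inter_iUnion, aestronglyMeasurable_iUnion_iff]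
  rintro ⟨e, he⟩
  have hm : AEMeasurable e (g.vol.restrict (Ω ∩ e.source)) :=
    (e.continuousOn.aemeasurable e.open_source.measurableSet).mono_set inter_subset_right
  have h1 := (h e (hTa he)).mono_ac (g.coordVol_ac (Ω := Ω))
  rw [← g.vol_restrict_inter_source_map (hTa he) hΩ] at h1
  refine (h1.comp_aemeasurable hm).congr ?_
  filter_upwards [ae_restrict_mem (hΩ.inter e.open_source.measurableSet)] with x hxs
  simp [e.left_inv hxs.2]

theorem aestronglyMeasurable_coord {F : Type*} [NormedAddCommGroup F]
    (he : e ∈ atlas (EuclideanSpace ℝ (Fin m)) X) (hΩ : MeasurableSet Ω) {f : X → F}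
    (h : AEStronglyMeasurable f (g.vol.restrict Ω)) :
    AEStronglyMeasurable (fun y => f (e.symm y)) (volume.restrict (coordDomain Ω e)) := by
  have h1 : AEStronglyMeasurable f (g.vol.restrict (Ω ∩ e.source)) :=
    h.mono_set inter_subset_left
  rw [g.vol_restrict_inter_source he hΩ] at h1
  exact (h1.comp_aemeasurable
    ((aemeasurable_symm_coordDomain e).mono_ac g.coordVol_ac)).mono_ac (g.ac_coordVol he hΩ)

end Countable

/-- On compact subsets of the coordinate domain, Lebesgue integrals are controlled by integrals
with respect to the Riemannian measure. -/
theorem lintegral_coord_le (he : e ∈ atlas (EuclideanSpace ℝ (Fin m)) X) (hΩ : MeasurableSet Ω)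
    {K : Set (EuclideanSpace ℝ (Fin m))} (hK : IsCompact K) (hKΩ : K ⊆ coordDomain Ω e) :
    ∃ C : ℝ≥0∞, C ≠ ⊤ ∧ ∀ f : X → ℝ≥0∞, AEMeasurable f (g.vol.restrict Ω) →
      ∫⁻ y in K, f (e.symm y) ≤ C * ∫⁻ x in Ω, f x ∂g.vol := by
  rcases K.eq_empty_or_nonempty with rfl | hne
  · exact ⟨0, by simp, fun f _ => by simp⟩
  -- The constant is the inverse of the minimum of the density on K, positive by compactness.
  obtain ⟨y₀, hy₀, hmin⟩ := hK.exists_isMinOn hne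
    ((g.continuousOn_volDensity he).mono fun y hy => (hKΩ hy).1)
  have hpos := g.volDensity_pos he (hKΩ hy₀).1
  set c := ENNReal.ofReal (g.volDensity e y₀) with hc
  have hc0 : c ≠ 0 := by simpa [hc] using hpos
  refine ⟨c⁻¹, ENNReal.inv_ne_top.2 hc0, fun f hf => ?_⟩
  rw [← ENNReal.mul_le_iff_le_inv hc0 ENNReal.ofReal_ne_top]
  calc c * ∫⁻ y in K, f (e.symm y) = ∫⁻ y in K, c * f (e.symm y) :=
        (lintegral_const_mul' _ _ ENNReal.ofReal_ne_top).symm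
    _ ≤ ∫⁻ y in K, ENNReal.ofReal (g.volDensity e y) * f (e.symm y) := by
        refine setLIntegral_mono' hK.measurableSet fun y hy => ?_
        gcongr
        exact ENNReal.ofReal_le_ofReal (hmin hy)
    _ ≤ ∫⁻ y in coordDomain Ω e, ENNReal.ofReal (g.volDensity e y) * f (e.symm y) :=
        lintegral_mono_set hKΩ
    _ = ∫⁻ x in Ω ∩ e.source, f x ∂g.vol := (g.lintegral_inter_source he hΩ hf).symm
    _ ≤ _ := lintegral_mono_set inter_subset_left

/-- The density is bounded on compact coordinate neighbourhoods. Local finiteness makes continuous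
compactly supported functions integrable and square-integrable. -/
instance isLocallyFiniteMeasure_vol : IsLocallyFiniteMeasure g.vol := by
  refine ⟨fun x => ?_⟩
  set e := chartAt (EuclideanSpace ℝ (Fin m)) x with he
  have hx : x ∈ e.source := mem_chart_source _ x
  have hea : e ∈ atlas (EuclideanSpace ℝ (Fin m)) X := chart_mem_atlas _ x
  obtain ⟨K, hK, hKx, hKs⟩ := exists_compact_subset e.open_target (e.map_source hx)
  set s : Set X := e.source ∩ e ⁻¹' interior K with hs
  have hso : IsOpen s := e.isOpen_inter_preimage isOpen_interior
  refine ⟨s, hso.mem_nhds ⟨hx, hKx⟩, ?_⟩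
  have h1 : g.vol s = g.chartVolume e s := by
    rw [← g.vol_restrict_source hea, Measure.restrict_apply hso.measurableSet,
      inter_eq_left.2 inter_subset_left]
  have h2 : coordDomain s e ⊆ K := by
    rintro y ⟨hy, hys⟩
    have := hys.2
    rw [mem_preimage, e.right_inv hy] at this
    exact interior_subset this
  obtain ⟨C, hC⟩ := hK.exists_bound_of_continuousOn ((g.continuousOn_volDensity hea).mono hKs)
  rw [h1, chartVolume_apply _ _ hso.measurableSet]
  calc _ ≤ ∫⁻ y in K, ENNReal.ofReal (g.volDensity e y) := lintegral_mono_set h2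
    _ ≤ ∫⁻ y in K, ENNReal.ofReal C := by
        refine setLIntegral_mono' hK.measurableSet fun y hy => ?_
        exact ENNReal.ofReal_le_ofReal ((le_abs_self _).trans (hC y hy))
    _ < ⊤ := by
        rw [setLIntegral_const]
        exact ENNReal.mul_lt_top ENNReal.ofReal_lt_top hK.measure_lt_top

end RiemMetric

end

/-! ### Weak partial derivatives and convergence in L¹. -/

section

namespace HasWeakPartial

variable {m : ℕ} {S : Set (EuclideanSpace ℝ (Fin m))} {i : Fin m}
  {u w u' w' : EuclideanSpace ℝ (Fin m) → ℂ}

theorem setIntegral_mul_eq {φ : EuclideanSpace ℝ (Fin m) → ℝ} (hS : tsupport φ ⊆ S)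
    (u : EuclideanSpace ℝ (Fin m) → ℂ) : ∫ y in S, (φ y : ℂ) * u y = ∫ y, (φ y : ℂ) * u y := by
  refine setIntegral_eq_integral_of_forall_compl_eq_zero fun y hy => ?_
  have : φ y = 0 := by
    by_contra h
    exact hy (hS (subset_tsupport φ h))
  simp [this]

theorem tsupport_fderiv_apply_subset' {φ : EuclideanSpace ℝ (Fin m) → ℝ} (hS : tsupport φ ⊆ S) :
    tsupport (fun y => fderiv ℝ φ y (stdVec i)) ⊆ S :=
  (tsupport_fderiv_apply_subset ℝ (stdVec i)).trans hS

theorem congr (h : HasWeakPartial S i u w) (hu : u =ᵐ[volume.restrict S] u')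
    (hw : w =ᵐ[volume.restrict S] w') (hS : IsOpen S) : HasWeakPartial S i u' w' := by
  have hloc : ∀ {a b : EuclideanSpace ℝ (Fin m) → ℂ}, a =ᵐ[volume.restrict S] b →
      LocallyIntegrableOn a S → LocallyIntegrableOn b S := by
    intro a b hab ha
    rw [locallyIntegrableOn_iff hS.isLocallyClosed] at ha ⊢
    exact fun K hKS hK => (ha K hKS hK).congr_fun_ae
      (ae_restrict_of_ae_restrict_of_subset hKS hab)
  refine ⟨hloc hu h.1, hloc hw h.2.1, fun φ hφ hc hφS => ?_⟩
  refine Eq.trans (integral_congr_ae (hu.mono fun y hy => ?_))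
    ((h.2.2 φ hφ hc hφS).trans (congrArg _ (integral_congr_ae (hw.mono fun y hy => ?_))))
  · simp only [hy]
  · simp only [hy]

/-- The difference of the two derivatives integrates to zero against every test function, so the
fundamental lemma of the calculus of variations applies. -/
theorem unique (hS : IsOpen S) (h : HasWeakPartial S i u w) (h' : HasWeakPartial S i u' w')
    (hu : u =ᵐ[volume.restrict S] u') : w =ᵐ[volume.restrict S] w' := by
  have h1 : ∀ᵐ y, y ∈ S → (w - w') y = 0 := by
    refine hS.ae_eq_zero_of_integral_contDiff_smul_eq_zero (h.2.1.sub h'.2.1) fun φ hφ hc hφS => ?_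
    have e1 := h.2.2 φ hφ hc hφS
    have e2 := h'.2.2 φ hφ hc hφS
    rw [integral_congr_ae (hu.mono fun y hy => by rw [hy]), e2, neg_inj] at e1
    have i1 := HasWeakPartial.mul_right hφ.continuous hc hφS h.2.1
    have i2 := HasWeakPartial.mul_right hφ.continuous hc hφS h'.2.1
    have e3 := integral_sub i1 i2
    rw [e1, sub_self] at e3
    simp only [Pi.sub_apply, Complex.real_smul]
    rw [← setIntegral_mul_eq hφS]
    simpa [mul_sub] using e3
  filter_upwards [ae_restrict_of_ae h1, ae_restrict_mem hS.measurableSet] with y hy hyS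
  simpa [sub_eq_zero] using hy hyS

theorem mono {S' : Set (EuclideanSpace ℝ (Fin m))} (h : HasWeakPartial S i u w) (hSS : S' ⊆ S) :
    HasWeakPartial S' i u w := by
  refine ⟨h.1.mono_set hSS, h.2.1.mono_set hSS, fun φ hφ hc hφS => ?_⟩
  have := h.2.2 φ hφ hc (hφS.trans hSS)
  rw [setIntegral_mul_eq (tsupport_fderiv_apply_subset' hφS),
    setIntegral_mul_eq hφS]
  rwa [setIntegral_mul_eq (tsupport_fderiv_apply_subset' (hφS.trans hSS)),
    setIntegral_mul_eq (hφS.trans hSS)] at this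

theorem integrable_mul {a : EuclideanSpace ℝ (Fin m) → ℝ} {b : EuclideanSpace ℝ (Fin m) → ℂ}
    (ha : Continuous a) (hac : HasCompactSupport a) (haS : tsupport a ⊆ S)
    (hb : LocallyIntegrableOn b S) : Integrable fun y => (a y : ℂ) * b y := by
  have h1 : IntegrableOn (fun y => (a y : ℂ) * b y) (tsupport a) :=
    (hb.integrableOn_compact_subset haS hac).continuousOn_mul
      (Complex.continuous_ofReal.comp ha).continuousOn hac
  refine (integrableOn_iff_integrable_of_support_subset fun y hy => ?_).1 h1
  exact subset_tsupport a fun h0 => hy (by simp [h0])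

theorem of_contDiffOn (hS : IsOpen S) (hu : ContDiffOn ℝ 1 u S) :
    HasWeakPartial S i u (fun y => fderiv ℝ u y (stdVec i)) := by
  have hc : ContinuousOn u S := hu.continuousOn
  have hc' : ContinuousOn (fun y => fderiv ℝ u y (stdVec i)) S :=
    (hu.continuousOn_fderiv_of_isOpen hS le_rfl).clm_apply continuousOn_const
  have hl := hc.locallyIntegrableOn (μ := volume) hS.measurableSet
  have hl' := hc'.locallyIntegrableOn (μ := volume) hS.measurableSet
  refine ⟨hl, hl', fun φ hφ hφc hφS => ?_⟩
  have hd : Continuous fun y => fderiv ℝ φ y (stdVec i) :=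
    (hφ.continuous_fderiv (by simp)).clm_apply continuous_const
  have hdc : HasCompactSupport fun y => fderiv ℝ φ y (stdVec i) := hφc.fderiv_apply ℝ (stdVec i)
  have hdS := tsupport_fderiv_apply_subset' (i := i) hφS
  have key := integral_bilinear_fderiv_right_eq_neg_left_of_integrable (μ := volume)
    (B := ContinuousLinearMap.lsmul ℝ ℝ (E := ℂ)) (f := φ) (g := u) (v := stdVec i)
    (by simpa using integrable_mul hd hdc hdS hl) (by simpa using integrable_mul hφ.continuous hφc hφS hl')
    (by simpa using integrable_mul hφ.continuous hφc hφS hl)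
    (fun y _ => (hφ.differentiable (by simp)) y)
    (fun y hy => (hu.differentiableOn (by simp)).differentiableAt (hS.mem_nhds (hφS hy)))
  rw [setIntegral_mul_eq hdS, setIntegral_mul_eq hφS]
  simp only [ContinuousLinearMap.lsmul_apply, Complex.real_smul] at key
  rw [key, neg_neg]

end HasWeakPartial

/-- Convergence in `L¹(μ)` of a sequence of complex valued functions. -/
structure TendstoL1 {α : Type*} [MeasurableSpace α] (μ : Measure α) (f : ℕ → α → ℂ) (g : α → ℂ) :
    Prop where
  integrable_seq : ∀ n, Integrable (f n) μ
  integrable : Integrable g μ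
  tendsto : Tendsto (fun n => ∫⁻ x, ‖f n x - g x‖ₑ ∂μ) atTop (𝓝 0)

namespace TendstoL1

variable {α : Type*} [MeasurableSpace α] {μ : Measure α} {f f' : ℕ → α → ℂ} {g g' : α → ℂ}

theorem const (hg : Integrable g μ) : TendstoL1 μ (fun _ => g) g :=
  ⟨fun _ => hg, hg, by simp⟩

theorem of_le {F : ℕ → α → ℝ≥0∞} (hf : ∀ n, Integrable (f n) μ) (hg : Integrable g μ)
    (h : ∀ n, ∀ᵐ x ∂μ, ‖f n x - g x‖ₑ ≤ F n x)
    (hF : Tendsto (fun n => ∫⁻ x, F n x ∂μ) atTop (𝓝 0)) : TendstoL1 μ f g :=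
  ⟨hf, hg, tendsto_of_tendsto_of_tendsto_of_le_of_le tendsto_const_nhds hF (fun _ => zero_le)
    fun n => lintegral_mono_ae (h n)⟩

theorem congr_ae (h : TendstoL1 μ f g) (hf : ∀ n, f n =ᵐ[μ] f' n) (hg : g =ᵐ[μ] g') :
    TendstoL1 μ f' g' := by
  refine ⟨fun n => (h.integrable_seq n).congr (hf n), h.integrable.congr hg,
    h.tendsto.congr fun n => lintegral_congr_ae ?_⟩
  filter_upwards [hf n, hg] with x h1 h2
  rw [h1, h2]

theorem add (h : TendstoL1 μ f g) (h' : TendstoL1 μ f' g') :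
    TendstoL1 μ (fun n x => f n x + f' n x) (fun x => g x + g' x) := by
  refine of_le (F := fun n x => ‖f n x - g x‖ₑ + ‖f' n x - g' x‖ₑ)
    (fun n => (h.integrable_seq n).add (h'.integrable_seq n)) (h.integrable.add h'.integrable)
    (fun n => Eventually.of_forall fun x => ?_) ?_
  · rw [add_sub_add_comm]
    exact enorm_add_le _ _
  · have := h.tendsto.add h'.tendsto
    rw [add_zero] at this
    refine this.congr fun n => (lintegral_add_left' ?_ _).symm
    exact ((h.integrable_seq n).sub h.integrable).aestronglyMeasurable.enorm

theorem sum {ι : Type*} (s : Finset ι) {f : ι → ℕ → α → ℂ} {g : ι → α → ℂ}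
    (h : ∀ j ∈ s, TendstoL1 μ (f j) (g j)) :
    TendstoL1 μ (fun n x => ∑ j ∈ s, f j n x) (fun x => ∑ j ∈ s, g j x) := by
  classical
  induction s using Finset.induction_on with
  | empty => exact const (integrable_zero α ℂ μ)
  | insert a s ha ih =>
    simp only [Finset.sum_insert ha]
    exact (h a (Finset.mem_insert_self _ _)).add
      (ih fun j hj => h j (Finset.mem_insert_of_mem hj))

theorem ofReal_re (h : TendstoL1 μ f g) :
    TendstoL1 μ (fun n x => ((f n x).re : ℂ)) (fun x => ((g x).re : ℂ)) := by
  refine of_le (fun n => (h.integrable_seq n).re.ofReal) h.integrable.re.ofReal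
    (fun n => Eventually.of_forall fun x => ?_) h.tendsto
  rw [← Complex.ofReal_sub, ← Complex.sub_re, ← ofReal_norm, ← ofReal_norm, Complex.norm_real]
  exact ENNReal.ofReal_le_ofReal (Complex.abs_re_le_norm _)

theorem of_dominated {C : ℝ} [IsFiniteMeasure μ] (hm : ∀ n, AEStronglyMeasurable (f n) μ)
    (hC : ∀ n, ∀ᵐ x ∂μ, ‖f n x‖ ≤ C)
    (h : ∀ᵐ x ∂μ, Tendsto (fun n => f n x) atTop (𝓝 (g x))) : TendstoL1 μ f g := by
  have hgm : AEStronglyMeasurable g μ := aestronglyMeasurable_of_tendsto_ae atTop hm h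
  have hgC : ∀ᵐ x ∂μ, ‖g x‖ ≤ C := by
    filter_upwards [h, ae_all_iff.2 hC] with x hx hxC
    exact le_of_tendsto hx.norm (Eventually.of_forall hxC)
  have hgi : Integrable g μ := .of_bound hgm C hgC
  refine ⟨fun n => .of_bound (hm n) C (hC n), hgi, ?_⟩
  have := tendsto_lintegral_of_dominated_convergence' (μ := μ)
    (F := fun n x => ‖f n x - g x‖ₑ) (f := fun _ => 0) (fun _ => ENNReal.ofReal (C + C))
    (fun n => ((hm n).sub hgm).enorm) (fun n => ?_) ?_ ?_
  · simpa using this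
  · filter_upwards [hC n, hgC] with x h1 h2
    rw [← ofReal_norm]
    exact ENNReal.ofReal_le_ofReal ((norm_sub_le _ _).trans (add_le_add h1 h2))
  · simpa using ENNReal.mul_ne_top ENNReal.ofReal_ne_top (measure_ne_top μ univ)
  · filter_upwards [h] with x hx
    have := (tendsto_iff_norm_sub_tendsto_zero.1 hx)
    simpa [← ofReal_norm] using ENNReal.tendsto_ofReal this

/-- Split c_n f_n - d g = c_n (f_n - g) + (c_n - d) g. The first part is at most C |f_n - g|, and
the second tends to 0 by dominated convergence with bound 2C |g|. Coefficients thus need only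
pointwise convergence and a uniform bound. -/
theorem bdd_mul {C : ℝ} {c : ℕ → α → ℂ} {d : α → ℂ} (hm : ∀ n, AEStronglyMeasurable (c n) μ)
    (hC : ∀ n, ∀ᵐ x ∂μ, ‖c n x‖ ≤ C)
    (hc : ∀ᵐ x ∂μ, Tendsto (fun n => c n x) atTop (𝓝 (d x))) (h : TendstoL1 μ f g) :
    TendstoL1 μ (fun n x => c n x * f n x) (fun x => d x * g x) := by
  have hdm : AEStronglyMeasurable d μ := aestronglyMeasurable_of_tendsto_ae atTop hm hc
  have hdC : ∀ᵐ x ∂μ, ‖d x‖ ≤ C := by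
    filter_upwards [hc, ae_all_iff.2 hC] with x hx hxC
    exact le_of_tendsto hx.norm (Eventually.of_forall hxC)
  refine of_le (F := fun n x => ENNReal.ofReal C * ‖f n x - g x‖ₑ + ‖c n x - d x‖ₑ * ‖g x‖ₑ)
    (fun n => (h.integrable_seq n).bdd_mul (hm n) (hC n)) (h.integrable.bdd_mul hdm hdC)
    (fun n => ?_) ?_
  · filter_upwards [hC n] with x hx
    have : c n x * f n x - d x * g x = c n x * (f n x - g x) + (c n x - d x) * g x := by ring
    rw [this]
    refine (enorm_add_le _ _).trans ?_
    rw [enorm_mul, enorm_mul]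
    gcongr
    rw [← ofReal_norm]
    exact ENNReal.ofReal_le_ofReal hx
  · have h1 : Tendsto (fun n => ENNReal.ofReal C * ∫⁻ x, ‖f n x - g x‖ₑ ∂μ) atTop (𝓝 0) := by
      simpa using ENNReal.Tendsto.const_mul h.tendsto (Or.inr ENNReal.ofReal_ne_top)
    have h2 : Tendsto (fun n => ∫⁻ x, ‖c n x - d x‖ₑ * ‖g x‖ₑ ∂μ) atTop (𝓝 0) := by
      have := tendsto_lintegral_of_dominated_convergence' (μ := μ)
        (F := fun n x => ‖c n x - d x‖ₑ * ‖g x‖ₑ) (f := fun _ => 0)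
        (fun x => ENNReal.ofReal (C + C) * ‖g x‖ₑ)
        (fun n => ((hm n).sub hdm).enorm.mul h.integrable.aestronglyMeasurable.enorm)
        (fun n => ?_) ?_ ?_
      · simpa using this
      · filter_upwards [hC n, hdC] with x h1 h2
        gcongr
        rw [← ofReal_norm]
        exact ENNReal.ofReal_le_ofReal ((norm_sub_le _ _).trans (add_le_add h1 h2))
      · rw [lintegral_const_mul' _ _ ENNReal.ofReal_ne_top]
        exact ENNReal.mul_ne_top ENNReal.ofReal_ne_top h.integrable.hasFiniteIntegral.ne
      · filter_upwards [hc] with x hx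
        have h3 : Tendsto (fun n => ‖c n x - d x‖ₑ) atTop (𝓝 0) := by
          simpa [← ofReal_norm] using
            ENNReal.tendsto_ofReal (tendsto_iff_norm_sub_tendsto_zero.1 hx)
        simpa using ENNReal.Tendsto.mul_const h3 (Or.inr enorm_ne_top)
    have := h1.add h2
    rw [add_zero] at this
    refine this.congr fun n => ?_
    rw [lintegral_add_left', lintegral_const_mul' _ _ ENNReal.ofReal_ne_top]
    exact ((h.integrable_seq n).sub h.integrable).aestronglyMeasurable.enorm.const_mul _

theorem tendsto_integral (h : TendstoL1 μ f g) :
    Tendsto (fun n => ∫ x, f n x ∂μ) atTop (𝓝 (∫ x, g x ∂μ)) :=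
  tendsto_integral_of_L1 g h.integrable.1 (Eventually.of_forall h.integrable_seq) h.tendsto

end TendstoL1

/-- The approximating sequence may depend on K because a test function sees only its own compact
support. -/
theorem HasWeakPartial.of_tendsto {m : ℕ} {S : Set (EuclideanSpace ℝ (Fin m))} {i : Fin m}
    (hS : IsOpen S) {u w : EuclideanSpace ℝ (Fin m) → ℂ}
    (h : ∀ K ⊆ S, IsCompact K → ∃ a b : ℕ → EuclideanSpace ℝ (Fin m) → ℂ,
      (∀ n, HasWeakPartial S i (a n) (b n)) ∧ TendstoL1 (volume.restrict K) a u ∧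
        TendstoL1 (volume.restrict K) b w) : HasWeakPartial S i u w := by
  refine ⟨(locallyIntegrableOn_iff hS.isLocallyClosed).2 fun K hKS hK => ?_,
    (locallyIntegrableOn_iff hS.isLocallyClosed).2 fun K hKS hK => ?_, fun φ hφ hc hφS => ?_⟩
  · obtain ⟨a, b, -, h1, -⟩ := h K hKS hK
    exact h1.integrable
  · obtain ⟨a, b, -, -, h1⟩ := h K hKS hK
    exact h1.integrable
  · obtain ⟨a, b, hab, ha, hb⟩ := h _ hφS hc
    have hK : ∀ (ψ : EuclideanSpace ℝ (Fin m) → ℝ) (v : EuclideanSpace ℝ (Fin m) → ℂ),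
        tsupport ψ ⊆ tsupport φ →
        ∫ y in S, (ψ y : ℂ) * v y = ∫ y in tsupport φ, (ψ y : ℂ) * v y := fun ψ v hψ => by
      rw [setIntegral_mul_eq (hψ.trans hφS), setIntegral_mul_eq hψ]
    have hlim : ∀ (ψ : EuclideanSpace ℝ (Fin m) → ℝ), Continuous ψ → HasCompactSupport ψ →
        ∀ {f : ℕ → EuclideanSpace ℝ (Fin m) → ℂ} {v},
        TendstoL1 (volume.restrict (tsupport φ)) f v →
        Tendsto (fun n => ∫ y in tsupport φ, (ψ y : ℂ) * f n y) atTop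
          (𝓝 (∫ y in tsupport φ, (ψ y : ℂ) * v y)) := by
      intro ψ hψ hψc f v hf
      obtain ⟨C, hC⟩ := hψ.bounded_above_of_compact_support hψc
      refine (TendstoL1.bdd_mul (C := C) (c := fun _ y => (ψ y : ℂ)) (d := fun y => (ψ y : ℂ))
        (fun n => (Complex.continuous_ofReal.comp hψ).aestronglyMeasurable)
        (fun n => Eventually.of_forall fun y => ?_)
        (Eventually.of_forall fun y => tendsto_const_nhds) hf).tendsto_integral
      simpa using hC y
    have hd : Continuous fun y => fderiv ℝ φ y (stdVec i) :=
      (hφ.continuous_fderiv (by simp)).clm_apply continuous_const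
    have hdc : HasCompactSupport fun y => fderiv ℝ φ y (stdVec i) := hc.fderiv_apply ℝ (stdVec i)
    have hdS : tsupport (fun y => fderiv ℝ φ y (stdVec i)) ⊆ tsupport φ :=
      tsupport_fderiv_apply_subset ℝ (stdVec i)
    have l1 := hlim _ hd hdc ha
    have l2 := (hlim _ hφ.continuous hc hb).neg
    rw [hK _ _ hdS, hK _ _ subset_rfl]
    refine tendsto_nhds_unique l1 (l2.congr fun n => ?_)
    have := (hab n).2.2 φ hφ hc hφS
    rw [hK _ _ hdS, hK _ _ subset_rfl] at this
    exact this.symm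

end

/-! ### Mollification and local smooth approximation of weakly differentiable functions. -/

section

section Mollification

open scoped Convolution

variable {m : ℕ}

/-- The standard sequence of mollifiers. -/
def mollifier (m n : ℕ) : ContDiffBump (0 : EuclideanSpace ℝ (Fin m)) where
  rIn := 1 / (n + 1)
  rOut := 2 / (n + 1)
  rIn_pos := by positivity
  rIn_lt_rOut := by gcongr; norm_num

/-- The mollification of `f` at scale `1 / (n + 1)`. -/
def mollify (n : ℕ) (f : EuclideanSpace ℝ (Fin m) → ℂ) : EuclideanSpace ℝ (Fin m) → ℂ :=
  (mollifier m n).normed volume ⋆[ContinuousLinearMap.lsmul ℝ ℝ, volume] f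

theorem tendsto_mollifier_rOut (m : ℕ) :
    Tendsto (fun n => (mollifier m n).rOut) atTop (𝓝 0) := by
  have := (tendsto_one_div_add_atTop_nhds_zero_nat (𝕜 := ℝ)).const_mul 2
  rw [mul_zero] at this
  refine this.congr fun n => ?_
  simp only [mollifier]
  ring

theorem integrable_mollifier (m n : ℕ) :
    Integrable ((mollifier m n).normed (volume : Measure (EuclideanSpace ℝ (Fin m)))) :=
  (mollifier m n).integrable_normed

variable {f g : EuclideanSpace ℝ (Fin m) → ℂ}

theorem integrable_mollify (n : ℕ) (hf : Integrable f) : Integrable (mollify n f) :=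
  (integrable_mollifier m n).integrable_convolution _ hf

/-- The outer radius is twice the inner one at every scale. This fixed ratio is what the Lebesgue
differentiation argument needs. -/
theorem ae_tendsto_mollify (hf : Integrable f) :
    ∀ᵐ y, Tendsto (fun n => mollify n f y) atTop (𝓝 (f y)) := by
  refine ContDiffBump.ae_convolution_tendsto_right_of_locallyIntegrable (K := 2)
    (tendsto_mollifier_rOut m) (Eventually.of_forall fun n => ?_) hf.locallyIntegrable
  simp only [mollifier]
  exact le_of_eq (by ring)

theorem convolutionExistsAt_mollifier (n : ℕ) (hf : Integrable f) (y) :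
    ConvolutionExistsAt ((mollifier m n).normed volume) f y (ContinuousLinearMap.lsmul ℝ ℝ)
      volume :=
  (mollifier m n).hasCompactSupport_normed.convolutionExists_left _
    (mollifier m n).continuous_normed hf.locallyIntegrable y

theorem mollify_sub (n : ℕ) (hf : Integrable f) (hg : Integrable g) :
    mollify n (f - g) = mollify n f - mollify n g := by
  ext y
  have h1 := (convolutionExistsAt_mollifier n hf y).integrable
  have h2 := (convolutionExistsAt_mollifier n hg y).integrable
  simp only [mollify, convolution_def, Pi.sub_apply, map_sub]
  exact integral_sub h1 h2

theorem lintegral_enorm_mollify_le (n : ℕ) (hf : Integrable f) :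
    ∫⁻ y, ‖mollify n f y‖ₑ ≤ ∫⁻ y, ‖f y‖ₑ := by
  rw [← ofReal_integral_norm_eq_lintegral_enorm (integrable_mollify n hf),
    ← ofReal_integral_norm_eq_lintegral_enorm hf]
  refine ENNReal.ofReal_le_ofReal ?_
  set ρ := (mollifier m n).normed (volume : Measure (EuclideanSpace ℝ (Fin m))) with hρ
  have h1 : ∫ y, (ρ ⋆[ContinuousLinearMap.lsmul ℝ ℝ, volume] fun y => ‖f y‖) y = ∫ y, ‖f y‖ := by
    rw [integral_convolution _ (integrable_mollifier m n) hf.norm]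
    simp [(mollifier m n).integral_normed]
  rw [← h1]
  refine integral_mono (integrable_mollify n hf).norm
    ((integrable_mollifier m n).integrable_convolution _ hf.norm) fun y => ?_
  refine (norm_integral_le_integral_norm _).trans_eq (integral_congr_ae
    (Eventually.of_forall fun t => ?_))
  simp [hρ, abs_of_nonneg ((mollifier m n).nonneg_normed t)]

theorem norm_mollify_le (n : ℕ) {C : ℝ} (hC : ∀ y, ‖f y‖ ≤ C) (y) : ‖mollify n f y‖ ≤ C := by
  set ρ := (mollifier m n).normed (volume : Measure (EuclideanSpace ℝ (Fin m))) with hρ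
  refine (norm_integral_le_of_norm_le (g := fun t => ρ t * C)
    ((integrable_mollifier m n).mul_const C) (Eventually.of_forall fun t => ?_)).trans_eq ?_
  · simp only [ContinuousLinearMap.lsmul_apply, norm_smul, Real.norm_eq_abs,
      abs_of_nonneg ((mollifier m n).nonneg_normed t)]
    exact mul_le_mul_of_nonneg_left (hC _) ((mollifier m n).nonneg_normed t)
  · rw [integral_mul_const, (mollifier m n).integral_normed, one_mul]

/-- Density argument: f is replaced by a continuous compactly supported c within ε/3 in L¹, and
mollification does not increase the L¹ norm. For c the supremum bound and pointwise convergence give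
dominated convergence on K. -/
theorem tendstoL1_mollify (hf : Integrable f) {K : Set (EuclideanSpace ℝ (Fin m))}
    (hK : IsCompact K) : TendstoL1 (volume.restrict K) (fun n => mollify n f) f := by
  have : IsFiniteMeasure (volume.restrict K) := ⟨by simpa using hK.measure_lt_top⟩
  refine ⟨fun n => (integrable_mollify n hf).restrict, hf.restrict, ?_⟩
  refine ENNReal.tendsto_nhds_zero.2 fun ε hε => ?_
  have hε3 : ε / 3 ≠ 0 := (ENNReal.div_pos hε.ne' (by simp)).ne'
  obtain ⟨c, hcs, hfc, hcc, hci⟩ := hf.exists_hasCompactSupport_lintegral_sub_le hε3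
  obtain ⟨C, hC⟩ := hcc.bounded_above_of_compact_support hcs
  have h1 : TendstoL1 (volume.restrict K) (fun n => mollify n c) c :=
    TendstoL1.of_dominated (C := C) (fun n => (integrable_mollify n hci).restrict.1)
      (fun n => Eventually.of_forall fun y => norm_mollify_le n hC y)
      (ae_restrict_of_ae (ae_tendsto_mollify hci))
  filter_upwards [ENNReal.tendsto_nhds_zero.1 h1.tendsto (ε / 3) hε3.bot_lt] with n hn
  have hm1 : AEStronglyMeasurable (mollify n (f - c)) (volume.restrict K) :=
    (integrable_mollify n (hf.sub hci)).restrict.1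
  have hm2 : AEStronglyMeasurable (fun y => mollify n c y - c y) (volume.restrict K) :=
    ((integrable_mollify n hci).sub hci).restrict.1
  calc ∫⁻ y in K, ‖mollify n f y - f y‖ₑ
      ≤ ∫⁻ y in K, (‖mollify n (f - c) y‖ₑ + (‖mollify n c y - c y‖ₑ + ‖f y - c y‖ₑ)) := by
        refine lintegral_mono fun y => ?_
        have : mollify n f y - f y
            = mollify n (f - c) y + ((mollify n c y - c y) - (f y - c y)) := by
          rw [mollify_sub n hf hci, Pi.sub_apply]
          ring
        simp only [this]
        exact (enorm_add_le _ _).trans (by gcongr; exact enorm_sub_le)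
    _ = (∫⁻ y in K, ‖mollify n (f - c) y‖ₑ)
          + ((∫⁻ y in K, ‖mollify n c y - c y‖ₑ) + ∫⁻ y in K, ‖f y - c y‖ₑ) := by
        rw [lintegral_add_left' hm1.enorm, lintegral_add_left' hm2.enorm]
    _ ≤ ε / 3 + (ε / 3 + ε / 3) := by
        gcongr
        · exact (setLIntegral_le_lintegral _ _).trans
            ((lintegral_enorm_mollify_le n (hf.sub hci)).trans hfc)
        · exact (setLIntegral_le_lintegral _ _).trans hfc
    _ = ε := by rw [← add_assoc, ENNReal.add_thirds]

theorem contDiff_mollify (n : ℕ) (hf : Integrable f) : ContDiff ℝ 1 (mollify n f) :=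
  (mollifier m n).hasCompactSupport_normed.contDiff_convolution_left _
    (n := 1) (mollifier m n).contDiff_normed hf.locallyIntegrable

/-- The derivative of the convolution falls on the bump ρ. As t ↦ ρ(y - t) is itself a test
function, the weak derivative of f moves it to g; the two minus signs cancel. -/
theorem fderiv_mollify (n : ℕ) {i : Fin m} (hf : Integrable f)
    (h : ∀ φ : EuclideanSpace ℝ (Fin m) → ℝ, ContDiff ℝ ∞ φ → HasCompactSupport φ →
      ∫ y, ((fderiv ℝ φ y (stdVec i) : ℝ) : ℂ) * f y = -∫ y, (φ y : ℂ) * g y) (y) :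
    fderiv ℝ (mollify n f) y (stdVec i) = mollify n g y := by
  set ρ := (mollifier m n).normed (volume : Measure (EuclideanSpace ℝ (Fin m))) with hρ
  have hρs : ContDiff ℝ ∞ ρ := (mollifier m n).contDiff_normed
  have hρc : HasCompactSupport ρ := (mollifier m n).hasCompactSupport_normed
  have hρd : ∀ t, DifferentiableAt ℝ ρ t := fun t => hρs.differentiable (by simp) t
  have h1 : HasFDerivAt (mollify n f)
      ((fderiv ℝ ρ ⋆[(ContinuousLinearMap.lsmul ℝ ℝ).precompL _, volume] f) y) y :=
    hρc.hasFDerivAt_convolution_left _ (hρs.of_le (by simp)) hf.locallyIntegrable y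
  have hex : ConvolutionExistsAt (fderiv ℝ ρ) f y
      ((ContinuousLinearMap.lsmul ℝ ℝ : ℝ →L[ℝ] ℂ →L[ℝ] ℂ).precompL _) volume :=
    (hρc.fderiv ℝ).convolutionExists_left _ (hρs.continuous_fderiv (by simp))
      hf.locallyIntegrable y
  rw [h1.fderiv, convolution_def, ContinuousLinearMap.integral_apply hex.integrable]
  simp only [ContinuousLinearMap.precompL_apply, ContinuousLinearMap.lsmul_apply,
    Complex.real_smul, mollify, convolution_def]
  set φ : EuclideanSpace ℝ (Fin m) → ℝ := fun t => ρ (y - t) with hφ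
  have hφs : ContDiff ℝ ∞ φ := hρs.comp (contDiff_const.sub contDiff_id)
  have hφc : HasCompactSupport φ := hρc.comp_homeomorph (Homeomorph.subLeft y)
  have hφd : ∀ t, fderiv ℝ φ t (stdVec i) = -fderiv ℝ ρ (y - t) (stdVec i) := by
    intro t
    have := (hρd (y - t)).hasFDerivAt.comp t ((hasFDerivAt_id t).const_sub y)
    have h2 : HasFDerivAt φ _ t := this
    rw [h2.fderiv]
    simp
  have h3 := h φ hφs hφc
  rw [← integral_sub_left_eq_self _ volume y]
  rw [← integral_sub_left_eq_self (fun t => ((ρ t : ℝ) : ℂ) * g (y - t)) volume y]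
  simp only [sub_sub_cancel, hφd, Complex.ofReal_neg, neg_mul, integral_neg, neg_inj] at h3 ⊢
  exact h3

end Mollification

theorem exists_cutoff {m : ℕ} {K S : Set (EuclideanSpace ℝ (Fin m))} (hK : IsCompact K)
    (hS : IsOpen S) (hKS : K ⊆ S) : ∃ χ : EuclideanSpace ℝ (Fin m) → ℝ, ContDiff ℝ ∞ χ ∧
      HasCompactSupport χ ∧ tsupport χ ⊆ S ∧ ∀ y ∈ K, χ y = 1 ∧ fderiv ℝ χ y = 0 := by
  obtain ⟨K', hK', hKK', hKS'⟩ := exists_compact_between hK hS hKS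
  obtain ⟨f, h1, h0, -⟩ := exists_contMDiffMap_one_nhds_of_subset_interior
    (𝓘(ℝ, EuclideanSpace ℝ (Fin m))) (n := (⊤ : ℕ∞)) hK.isClosed hKK'
  have hsub : tsupport f ⊆ K' := closure_minimal (fun y hy => by
    by_contra h
    exact hy (h0 y h)) hK'.isClosed
  refine ⟨f, f.contMDiff.contDiff, hK'.of_isClosed_subset (isClosed_tsupport _) hsub,
    hsub.trans hKS', fun y hy => ?_⟩
  have h2 : f =ᶠ[𝓝 y] fun _ => (1 : ℝ) := (eventually_nhdsSet_iff_forall.1 h1) y hy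
  refine ⟨h2.eq_of_nhds, ?_⟩
  rw [h2.fderiv_eq]
  simp

/-- With a cutoff χ that is 1 near K, the function χa has the weak derivative χw + (∂χ)a on the
whole space and can be mollified there. On K both agree with a and w. Almost everywhere convergence
is recorded in addition to L¹ convergence because a nonlinear function of the approximants is formed
later. -/
theorem HasWeakPartial.exists_approx {m : ℕ} {S : Set (EuclideanSpace ℝ (Fin m))} {i : Fin m}
    {a w : EuclideanSpace ℝ (Fin m) → ℂ} (h : HasWeakPartial S i a w) (hS : IsOpen S)
    {K : Set (EuclideanSpace ℝ (Fin m))} (hKS : K ⊆ S) (hK : IsCompact K) :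
    ∃ b : ℕ → EuclideanSpace ℝ (Fin m) → ℂ, (∀ n, ContDiff ℝ 1 (b n)) ∧
      (∀ᵐ y ∂volume.restrict K, Tendsto (fun n => b n y) atTop (𝓝 (a y))) ∧
      TendstoL1 (volume.restrict K) b a ∧
      TendstoL1 (volume.restrict K) (fun n y => fderiv ℝ (b n) y (stdVec i)) w := by
  obtain ⟨χ, hχ, hχc, hχS, hχK⟩ := exists_cutoff hK hS hKS
  have hd : Continuous fun y => fderiv ℝ χ y (stdVec i) :=
    (hχ.continuous_fderiv (by simp)).clm_apply continuous_const
  have hdc : HasCompactSupport fun y => fderiv ℝ χ y (stdVec i) := hχc.fderiv_apply ℝ (stdVec i)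
  have hdS := tsupport_fderiv_apply_subset' (i := i) hχS
  set A : EuclideanSpace ℝ (Fin m) → ℂ := fun y => (χ y : ℂ) * a y with hA
  set W : EuclideanSpace ℝ (Fin m) → ℂ :=
    fun y => (χ y : ℂ) * w y + ((fderiv ℝ χ y (stdVec i) : ℝ) : ℂ) * a y with hW
  have hAi : Integrable A := integrable_mul hχ.continuous hχc hχS h.1
  have hWi1 := integrable_mul hχ.continuous hχc hχS h.2.1
  have hWi2 := integrable_mul hd hdc hdS h.1
  have hWi : Integrable W := hWi1.add hWi2
  have hbd : ∀ {φ : EuclideanSpace ℝ (Fin m) → ℝ} {f : EuclideanSpace ℝ (Fin m) → ℂ},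
      Continuous φ → HasCompactSupport φ → Integrable f →
      Integrable fun y => (φ y : ℂ) * f y := fun hφ hφc hf =>
    integrable_mul hφ hφc (subset_univ _) (hf.locallyIntegrable.locallyIntegrableOn univ)
  have hweak : ∀ φ : EuclideanSpace ℝ (Fin m) → ℝ, ContDiff ℝ ∞ φ → HasCompactSupport φ →
      ∫ y, ((fderiv ℝ φ y (stdVec i) : ℝ) : ℂ) * A y = -∫ y, (φ y : ℂ) * W y := by
    intro φ hφ hφc
    have hφd : Continuous fun y => fderiv ℝ φ y (stdVec i) :=
      (hφ.continuous_fderiv (by simp)).clm_apply continuous_const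
    -- φ need not be supported in S, but φχ is, so the weak derivative is tested with φχ.
    have hsub : tsupport (fun y => φ y * χ y) ⊆ S := (tsupport_mul_subset_right).trans hχS
    have h1 := h.2.2 (fun y => φ y * χ y) (hφ.mul hχ) hχc.mul_left hsub
    rw [setIntegral_mul_eq (tsupport_fderiv_apply_subset' hsub), setIntegral_mul_eq hsub] at h1
    have h2 : ∀ y, fderiv ℝ (fun y => φ y * χ y) y (stdVec i)
        = φ y * fderiv ℝ χ y (stdVec i) + χ y * fderiv ℝ φ y (stdVec i) := by
      intro y
      rw [fderiv_fun_mul (hφ.differentiable (by simp) y) (hχ.differentiable (by simp) y)]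
      simp
    have h3 : ∫ y, ((fderiv ℝ (fun y => φ y * χ y) y (stdVec i) : ℝ) : ℂ) * a y
        = (∫ y, (φ y : ℂ) * (((fderiv ℝ χ y (stdVec i) : ℝ) : ℂ) * a y))
          + ∫ y, ((fderiv ℝ φ y (stdVec i) : ℝ) : ℂ) * A y := by
      rw [← integral_add (hbd hφ.continuous hφc hWi2)
        (hbd hφd (hφc.fderiv_apply ℝ (stdVec i)) hAi)]
      congr 1
      ext y
      rw [h2, hA]
      push_cast
      ring
    have h4 : ∫ y, (φ y : ℂ) * W y = (∫ y, ((φ y * χ y : ℝ) : ℂ) * w y)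
        + ∫ y, (φ y : ℂ) * (((fderiv ℝ χ y (stdVec i) : ℝ) : ℂ) * a y) := by
      have e1 : (fun y => ((φ y * χ y : ℝ) : ℂ) * w y) = fun y => (φ y : ℂ) * ((χ y : ℂ) * w y) := by
        ext y
        push_cast
        ring
      rw [e1, ← integral_add (hbd hφ.continuous hφc hWi1) (hbd hφ.continuous hφc hWi2)]
      congr 1
      ext y
      rw [hW]
      ring
    rw [h3] at h1
    rw [h4, ← neg_eq_iff_eq_neg.2 h1.symm.symm]
    ring
  have hAK : ∀ᵐ y ∂volume.restrict K, A y = a y := by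
    filter_upwards [ae_restrict_mem hK.measurableSet] with y hy
    simp [hA, (hχK y hy).1]
  have hWK : ∀ᵐ y ∂volume.restrict K, W y = w y := by
    filter_upwards [ae_restrict_mem hK.measurableSet] with y hy
    simp [hW, (hχK y hy).1, (hχK y hy).2]
  refine ⟨fun n => mollify n A, fun n => contDiff_mollify n hAi, ?_, ?_, ?_⟩
  · filter_upwards [ae_restrict_of_ae (ae_tendsto_mollify hAi), hAK] with y h1 h2
    rwa [h2] at h1
  · exact (tendstoL1_mollify hAi hK).congr_ae (fun n => ae_eq_refl _) hAK
  · simp only [fderiv_mollify _ hAi hweak]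
    exact (tendstoL1_mollify hWi hK).congr_ae (fun n => ae_eq_refl _) hWK

end

/-! ### Chain rule for the regularised norm of a weakly differentiable vector. -/

section

/-- The real bilinear form `∑ Pⱼₖ Re(conj bⱼ cₖ)` of complex vectors. -/
def quadForm {m : ℕ} (P : Matrix (Fin m) (Fin m) ℝ) (b c : Fin m → ℂ) : ℝ :=
  ∑ j, ∑ k, P j k * (conj (b j) * c k).re

section

variable {m : ℕ}

theorem quadForm_symm {P : Matrix (Fin m) (Fin m) ℝ} (hP : ∀ j k, P j k = P k j)
    (b c : Fin m → ℂ) : quadForm P b c = quadForm P c b := by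
  rw [quadForm, Finset.sum_comm]
  refine Finset.sum_congr rfl fun k _ => Finset.sum_congr rfl fun j _ => ?_
  rw [hP j k]
  simp only [Complex.mul_re, Complex.conj_re, Complex.conj_im]
  ring

theorem HasDerivAt.quadForm {P' : Matrix (Fin m) (Fin m) ℝ} {p : ℝ → Matrix (Fin m) (Fin m) ℝ}
    {b c : ℝ → Fin m → ℂ} {b' c' : Fin m → ℂ} {t : ℝ}
    (hp : ∀ j k, HasDerivAt (fun s => p s j k) (P' j k) t)
    (hb : ∀ j, HasDerivAt (fun s => b s j) (b' j) t)
    (hc : ∀ j, HasDerivAt (fun s => c s j) (c' j) t) :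
    HasDerivAt (fun s => _root_.quadForm (p s) (b s) (c s))
      (_root_.quadForm P' (b t) (c t) + (_root_.quadForm (p t) b' (c t)
        + _root_.quadForm (p t) (b t) c')) t := by
  simp only [_root_.quadForm, ← Finset.sum_add_distrib]
  refine HasDerivAt.fun_sum fun j _ => HasDerivAt.fun_sum fun k _ => ?_
  have h1 : HasDerivAt (fun s => conj (b s j) * c s k) (conj (b' j) * c t k + conj (b t j) * c' k) t :=
    (hb j).star.mul (hc k)
  have h2 : HasDerivAt (fun s => (conj (b s j) * c s k).re)
      (conj (b' j) * c t k + conj (b t j) * c' k).re t :=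
    Complex.reCLM.hasFDerivAt.comp_hasDerivAt t h1
  refine ((hp j k).mul h2).congr_deriv ?_
  rw [Complex.add_re]
  ring

theorem continuousOn_quadForm {α : Type*} [TopologicalSpace α] {s : Set α}
    {p : α → Matrix (Fin m) (Fin m) ℝ} {b c : α → Fin m → ℂ}
    (hp : ∀ j k, ContinuousOn (fun y => p y j k) s) (hb : ∀ j, ContinuousOn (fun y => b y j) s)
    (hc : ∀ j, ContinuousOn (fun y => c y j) s) :
    ContinuousOn (fun y => quadForm (p y) (b y) (c y)) s :=
  continuousOn_finsetSum _ fun j _ => continuousOn_finsetSum _ fun k _ => (hp j k).mul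
    (Complex.continuous_re.comp_continuousOn
      ((Complex.continuous_conj.comp_continuousOn (hb j)).mul (hc k)))

theorem tendsto_quadForm {ι : Type*} {l : Filter ι} (P : Matrix (Fin m) (Fin m) ℝ)
    {b c : ι → Fin m → ℂ} {b' c' : Fin m → ℂ} (hb : ∀ j, Tendsto (fun n => b n j) l (𝓝 (b' j)))
    (hc : ∀ j, Tendsto (fun n => c n j) l (𝓝 (c' j))) :
    Tendsto (fun n => quadForm P (b n) (c n)) l (𝓝 (quadForm P b' c')) :=
  tendsto_finsetSum _ fun j _ => tendsto_finsetSum _ fun k _ => tendsto_const_nhds.mul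
    ((Complex.continuous_re.tendsto _).comp
      (((Complex.continuous_conj.tendsto _).comp (hb j)).mul (hc k)))

theorem contDiffOn_quadForm {s : Set (EuclideanSpace ℝ (Fin m))}
    {p : EuclideanSpace ℝ (Fin m) → Matrix (Fin m) (Fin m) ℝ}
    {b c : EuclideanSpace ℝ (Fin m) → Fin m → ℂ}
    (hp : ∀ j k, ContDiffOn ℝ 1 (fun y => p y j k) s) (hb : ∀ j, ContDiffOn ℝ 1 (fun y => b y j) s)
    (hc : ∀ j, ContDiffOn ℝ 1 (fun y => c y j) s) :
    ContDiffOn ℝ 1 (fun y => quadForm (p y) (b y) (c y)) s :=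
  ContDiffOn.sum fun j _ => ContDiffOn.sum fun k _ => (hp j k).mul
    (Complex.reCLM.contDiff.comp_contDiffOn
      ((Complex.conjCLE.contDiff.comp_contDiffOn (hb j)).mul (hc k)))

/-- The classical case, computed along a line in direction v. Symmetry of P merges the two terms in
which b is differentiated, cancelling the 1/2 from the square root; the derivative of P keeps it. -/
theorem fderiv_sqrt_quadForm {S : Set (EuclideanSpace ℝ (Fin m))} (hS : IsOpen S)
    {P : EuclideanSpace ℝ (Fin m) → Matrix (Fin m) (Fin m) ℝ}
    (hP : ∀ j k, ContDiffOn ℝ 1 (fun y => P y j k) S) (hsymm : ∀ y ∈ S, ∀ j k, P y j k = P y k j)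
    (hpos : ∀ y ∈ S, ∀ b, 0 ≤ quadForm (P y) b b) {η : ℝ} (hη : 0 < η)
    {b : Fin m → EuclideanSpace ℝ (Fin m) → ℂ} (hb : ∀ j, ContDiff ℝ 1 (b j))
    {y : EuclideanSpace ℝ (Fin m)} (hy : y ∈ S) (v : EuclideanSpace ℝ (Fin m)) :
    ContDiffOn ℝ 1 (fun y => ((Real.sqrt (quadForm (P y) (b · y) (b · y) + η ^ 2) - η : ℝ) : ℂ)) S ∧
    fderiv ℝ (fun y => ((Real.sqrt (quadForm (P y) (b · y) (b · y) + η ^ 2) - η : ℝ) : ℂ)) y v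
      = (((quadForm (P y) (b · y) (fun k => fderiv ℝ (b k) y v)
          + quadForm (fun j k => (1 / 2) * fderiv ℝ (fun z => P z j k) y v) (b · y) (b · y))
            / Real.sqrt (quadForm (P y) (b · y) (b · y) + η ^ 2) : ℝ) : ℂ) := by
  have hne : ∀ y ∈ S, quadForm (P y) (b · y) (b · y) + η ^ 2 ≠ 0 := fun y hy =>
    (add_pos_of_nonneg_of_pos (hpos y hy _) (by positivity)).ne'
  have hq : ContDiffOn ℝ 1 (fun y => quadForm (P y) (b · y) (b · y)) S :=
    contDiffOn_quadForm hP (fun j => (hb j).contDiffOn) fun j => (hb j).contDiffOn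
  have hcd : ContDiffOn ℝ 1
      (fun y => ((Real.sqrt (quadForm (P y) (b · y) (b · y) + η ^ 2) - η : ℝ) : ℂ)) S :=
    Complex.ofRealCLM.contDiff.comp_contDiffOn
      (((hq.add contDiffOn_const).sqrt hne).sub contDiffOn_const)
  refine ⟨hcd, ?_⟩
  rw [← ((hcd.differentiableOn (by simp)).differentiableAt (hS.mem_nhds hy)).lineDeriv_eq_fderiv]
  refine HasLineDerivAt.lineDeriv ?_
  have h1 : ∀ j k, HasDerivAt (fun t : ℝ => P (y + t • v) j k)
      (fderiv ℝ (fun z => P z j k) y v) 0 := fun j k =>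
    ((((hP j k).differentiableOn (by simp)).differentiableAt
      (hS.mem_nhds hy)).hasFDerivAt.hasLineDerivAt v)
  have h2 : ∀ j, HasDerivAt (fun t : ℝ => b j (y + t • v)) (fderiv ℝ (b j) y v) 0 := fun j =>
    (((hb j).differentiable (by simp)) y).hasFDerivAt.hasLineDerivAt v
  have h3 := HasDerivAt.quadForm (p := fun t => P (y + t • v)) (b := fun t j => b j (y + t • v))
    (c := fun t j => b j (y + t • v)) (P' := fun j k => fderiv ℝ (fun z => P z j k) y v) h1 h2 h2
  have h4 := ((h3.add_const (η ^ 2)).sqrt (by simpa using hne y hy)).sub_const η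
  have h5 := h4.ofReal_comp
  simp only [zero_smul, add_zero] at h5
  have e1 := quadForm_symm (hsymm y hy) (fun k => fderiv ℝ (b k) y v) (b · y)
  have e2 : quadForm (fun j k => (1 / 2) * fderiv ℝ (fun z => P z j k) y v) (b · y) (b · y)
      = 1 / 2 * quadForm (fun j k => fderiv ℝ (fun z => P z j k) y v) (b · y) (b · y) := by
    simp only [quadForm, Finset.mul_sum, mul_assoc]
  unfold HasLineDerivAt
  refine h5.congr_deriv ?_
  rw [e2, e1]
  congr 1
  ring

/-- The components a_j are approximated on K by smooth b_j. Each term of the derivative is an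
L¹-convergent factor times a coefficient T_{jk} conj(b_j) / √(P(b, b) + η²). Coercivity of P (the
function κ) bounds |b_j| by a constant times the root, so the coefficients stay bounded although b_j
itself need not. -/
theorem HasWeakPartial.sqrt_quadForm {S : Set (EuclideanSpace ℝ (Fin m))} (hS : IsOpen S)
    {P : EuclideanSpace ℝ (Fin m) → Matrix (Fin m) (Fin m) ℝ}
    (hP : ∀ j k, ContDiffOn ℝ 1 (fun y => P y j k) S) (hsymm : ∀ y ∈ S, ∀ j k, P y j k = P y k j)
    (hpos : ∀ y ∈ S, ∀ b, 0 ≤ quadForm (P y) b b)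
    {κ : Fin m → EuclideanSpace ℝ (Fin m) → ℝ} (hκ : ∀ j, ContinuousOn (κ j) S)
    (hκb : ∀ y ∈ S, ∀ b : Fin m → ℂ, ∀ j, ‖b j‖ ^ 2 ≤ κ j y * quadForm (P y) b b)
    {η : ℝ} (hη : 0 < η) {i : Fin m}
    {a w : Fin m → EuclideanSpace ℝ (Fin m) → ℂ} (h : ∀ j, HasWeakPartial S i (a j) (w j)) :
    HasWeakPartial S i
      (fun y => ((Real.sqrt (quadForm (P y) (a · y) (a · y) + η ^ 2) - η : ℝ) : ℂ))
      (fun y => (((quadForm (P y) (a · y) (w · y)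
        + quadForm (fun j k => (1 / 2) * fderiv ℝ (fun z => P z j k) y (stdVec i)) (a · y) (a · y))
          / Real.sqrt (quadForm (P y) (a · y) (a · y) + η ^ 2) : ℝ) : ℂ)) := by
  refine HasWeakPartial.of_tendsto hS fun K hKS hK => ?_
  have : IsFiniteMeasure (volume.restrict K) := ⟨by simpa using hK.measure_lt_top⟩
  choose b hb hae hL hL' using fun j => (h j).exists_approx hS hKS hK
  have hF0 : ∀ y ∈ S, ∀ b, η ≤ Real.sqrt (quadForm (P y) b b + η ^ 2) := fun y hy b =>
    Real.le_sqrt_of_sq_le (le_add_of_nonneg_left (hpos y hy b))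
  have hbc : ∀ n j, ContinuousOn (b j n) K := fun n j => (hb j n).continuous.continuousOn
  have hFc : ∀ n, ContinuousOn
      (fun y => Real.sqrt (quadForm (P y) (b · n y) (b · n y) + η ^ 2)) K := fun n =>
    Real.continuous_sqrt.comp_continuousOn ((continuousOn_quadForm
      (fun j k => (hP j k).continuousOn.mono hKS) (hbc n) (hbc n)).add continuousOn_const)
  have hFt : ∀ᵐ y ∂volume.restrict K,
      Tendsto (fun n => Real.sqrt (quadForm (P y) (b · n y) (b · n y) + η ^ 2)) atTop
        (𝓝 (Real.sqrt (quadForm (P y) (a · y) (a · y) + η ^ 2))) := by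
    filter_upwards [ae_all_iff.2 hae] with y hy
    exact (Real.continuous_sqrt.tendsto _).comp ((tendsto_quadForm _ hy hy).add_const _)
  -- One limit statement for all quotients: T is P or half its derivative, and f is b or its partial
  -- derivative.
  have main : ∀ (T : EuclideanSpace ℝ (Fin m) → Matrix (Fin m) (Fin m) ℝ)
      (_ : ∀ j k, ContinuousOn (fun y => T y j k) K)
      (f : Fin m → ℕ → EuclideanSpace ℝ (Fin m) → ℂ) (g : Fin m → EuclideanSpace ℝ (Fin m) → ℂ)
      (_ : ∀ k, TendstoL1 (volume.restrict K) (f k) (g k)),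
      TendstoL1 (volume.restrict K)
        (fun n y => ((quadForm (T y) (b · n y) (f · n y)
          / Real.sqrt (quadForm (P y) (b · n y) (b · n y) + η ^ 2) : ℝ) : ℂ))
        (fun y => ((quadForm (T y) (a · y) (g · y)
          / Real.sqrt (quadForm (P y) (a · y) (a · y) + η ^ 2) : ℝ) : ℂ)) := by
    intro T hT f g hfg
    have e : ∀ (T : Matrix (Fin m) (Fin m) ℝ) (b f : Fin m → ℂ) (r : ℝ),
        ((quadForm T b f / r : ℝ) : ℂ)
          = ∑ j, ∑ k, ((((T j k / r : ℝ) : ℂ) * conj (b j) * f k).re : ℂ) := by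
      intro T b f r
      rw [quadForm, Finset.sum_div, Complex.ofReal_sum]
      refine Finset.sum_congr rfl fun j _ => ?_
      rw [Finset.sum_div, Complex.ofReal_sum]
      refine Finset.sum_congr rfl fun k _ => ?_
      rw [mul_assoc, Complex.re_ofReal_mul]
      congr 1
      ring
    simp only [e]
    refine TendstoL1.sum _ fun j _ => TendstoL1.sum _ fun k _ => TendstoL1.ofReal_re ?_
    obtain ⟨C₁, hC₁⟩ := hK.exists_bound_of_continuousOn (hT j k)
    obtain ⟨C₂, hC₂⟩ := hK.exists_bound_of_continuousOn ((hκ j).mono hKS)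
    refine TendstoL1.bdd_mul (C := C₁ * Real.sqrt C₂) (fun n => ?_) (fun n => ?_) ?_ (hfg k)
    · refine ContinuousOn.aestronglyMeasurable ?_ hK.measurableSet
      refine (Complex.continuous_ofReal.comp_continuousOn ((hT j k).div (hFc n) fun y hy =>
        (hη.trans_le (hF0 y (hKS hy) _)).ne')).mul
        (Complex.continuous_conj.comp_continuousOn (hbc n j))
    · filter_upwards [ae_restrict_mem hK.measurableSet] with y hy
      have hpos' := hη.trans_le (hF0 y (hKS hy) (b · n y))
      have hC₁0 : 0 ≤ C₁ := (norm_nonneg _).trans (hC₁ y hy)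
      have h1 : ‖b j n y‖ ≤ Real.sqrt C₂ *
          Real.sqrt (quadForm (P y) (b · n y) (b · n y) + η ^ 2) := by
        have h0 := hpos y (hKS hy) (b · n y)
        have hC₂0 : 0 ≤ C₂ := (norm_nonneg _).trans (hC₂ y hy)
        rw [← Real.sqrt_mul hC₂0]
        refine Real.le_sqrt_of_sq_le ((hκb y (hKS hy) (b · n y) j).trans ?_)
        exact mul_le_mul ((le_abs_self _).trans (hC₂ y hy)) (le_add_of_nonneg_right (sq_nonneg _))
          h0 hC₂0
      rw [norm_mul, Complex.norm_real, norm_div, RCLike.norm_conj, Real.norm_of_nonneg hpos'.le,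
        div_mul_eq_mul_div, div_le_iff₀ hpos', mul_assoc]
      exact mul_le_mul (hC₁ y hy) h1 (norm_nonneg _) hC₁0
    · filter_upwards [ae_all_iff.2 hae, hFt, ae_restrict_mem hK.measurableSet] with y h1 h2 hy
      refine Tendsto.mul ((Complex.continuous_ofReal.tendsto _).comp (tendsto_const_nhds.div h2
        (hη.trans_le (hF0 y (hKS hy) _)).ne')) ?_
      exact (Complex.continuous_conj.tendsto _).comp (h1 j)
  refine ⟨fun n y => ((Real.sqrt (quadForm (P y) (b · n y) (b · n y) + η ^ 2) - η : ℝ) : ℂ),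
    fun n y => (((quadForm (P y) (b · n y) (fun k => fderiv ℝ (b k n) y (stdVec i))
      + quadForm (fun j k => (1 / 2) * fderiv ℝ (fun z => P z j k) y (stdVec i))
          (b · n y) (b · n y))
        / Real.sqrt (quadForm (P y) (b · n y) (b · n y) + η ^ 2) : ℝ) : ℂ),
    fun n => HasWeakPartial.congr (HasWeakPartial.of_contDiffOn (i := i) hS ?_) (ae_eq_refl _) ?_ hS,
    ?_, ?_⟩
  -- The smoothness statement comes attached to a point of S, so the empty set is treated apart.
  · rcases S.eq_empty_or_nonempty with rfl | ⟨y, hy⟩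
    · exact contDiffOn_empty
    · exact (fderiv_sqrt_quadForm hS hP hsymm hpos hη (fun j => hb j n) hy (stdVec i)).1
  · filter_upwards [ae_restrict_mem hS.measurableSet] with y hy
    exact (fderiv_sqrt_quadForm hS hP hsymm hpos hη (fun j => hb j n) hy (stdVec i)).2
  -- With r = √(Q + η²), r - η = Q/r + (η²/r - η): the first summand has the form covered by `main`,
  -- and the second is bounded by 2η, so it converges by domination.
  · have e : ∀ y ∈ S, ∀ b : Fin m → ℂ,
        ((Real.sqrt (quadForm (P y) b b + η ^ 2) - η : ℝ) : ℂ)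
        = ((quadForm (P y) b b / Real.sqrt (quadForm (P y) b b + η ^ 2) : ℝ) : ℂ)
          + ((η ^ 2 / Real.sqrt (quadForm (P y) b b + η ^ 2) - η : ℝ) : ℂ) := by
      intro y hy b
      rw [← Complex.ofReal_add]
      congr 1
      have h1 := hη.trans_le (hF0 y hy b)
      have h2 := Real.sq_sqrt (add_nonneg (hpos y hy b) (sq_nonneg η))
      field_simp
      linear_combination h2
    have h1 := main P (fun j k => (hP j k).continuousOn.mono hKS) b a hL
    have h2 : TendstoL1 (volume.restrict K)
        (fun n y => ((η ^ 2 / Real.sqrt (quadForm (P y) (b · n y) (b · n y) + η ^ 2) - η : ℝ) : ℂ))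
        (fun y => ((η ^ 2 / Real.sqrt (quadForm (P y) (a · y) (a · y) + η ^ 2) - η : ℝ) : ℂ)) := by
      refine TendstoL1.of_dominated (C := η + η) (fun n => ?_) (fun n => ?_) ?_
      · refine ContinuousOn.aestronglyMeasurable ?_ hK.measurableSet
        exact Complex.continuous_ofReal.comp_continuousOn ((continuousOn_const.div (hFc n)
          fun y hy => (hη.trans_le (hF0 y (hKS hy) _)).ne').sub continuousOn_const)
      · filter_upwards [ae_restrict_mem hK.measurableSet] with y hy
        rw [Complex.norm_real]
        have h3 := hF0 y (hKS hy) (b · n y)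
        refine (norm_sub_le _ _).trans (add_le_add ?_ (Real.norm_of_nonneg hη.le).le)
        rw [Real.norm_of_nonneg (by positivity), div_le_iff₀ (hη.trans_le h3), sq η]
        rw [sq] at h3
        exact mul_le_mul_of_nonneg_left h3 hη.le
      · filter_upwards [hFt, ae_restrict_mem hK.measurableSet] with y h2 hy
        exact (Complex.continuous_ofReal.tendsto _).comp ((tendsto_const_nhds.div h2
          (hη.trans_le (hF0 y (hKS hy) _)).ne').sub_const _)
    exact (h1.add h2).congr_ae
      (fun n => (ae_restrict_mem hK.measurableSet).mono fun y hy => (e y (hKS hy) _).symm)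
      ((ae_restrict_mem hK.measurableSet).mono fun y hy => (e y (hKS hy) _).symm)
  · have h1 := main P (fun j k => (hP j k).continuousOn.mono hKS) _ w hL'
    have h2 := main (fun y j k => (1 / 2) * fderiv ℝ (fun z => P z j k) y (stdVec i))
      (fun j k => continuousOn_const.mul ((((hP j k).continuousOn_fderiv_of_isOpen hS le_rfl).mono
        hKS).clm_apply continuousOn_const)) b a hL
    refine (h1.add h2).congr_ae (fun n => Eventually.of_forall fun y => ?_)
      (Eventually.of_forall fun y => ?_)
    · simp only [add_div, Complex.ofReal_add]
    · simp only [add_div, Complex.ofReal_add]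

end

end

/-! ### Square-integrable covector fields, weak differentials and the energy form. -/

section

namespace RiemMetric

variable {m : ℕ} {X : Type*} [TopologicalSpace X] [ChartedSpace (EuclideanSpace ℝ (Fin m)) X]
  [IsManifold (𝓡 m) ∞ X] {e : OpenPartialHomeomorph X (EuclideanSpace ℝ (Fin m))} {Ω : Set X}
  {α β : ∀ x : X, TangentSpace (𝓡 m) x →ₗ[ℝ] ℂ}

theorem cotInner_coord (g : RiemMetric m X) (he : e ∈ atlas (EuclideanSpace ℝ (Fin m)) X)
    {y : EuclideanSpace ℝ (Fin m)} (hy : y ∈ e.target)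
    (α β : TangentSpace (𝓡 m) (e.symm y) →ₗ[ℝ] ℂ) :
    g.cotInner (e.symm y) α β = ∑ i, ∑ j, (((g.coordGram e y)⁻¹ i j : ℝ) : ℂ) *
      (conj (α (coordVec e y i)) * β (coordVec e y j)) :=
  g.cotInner_eq_sum (linearIndependent_coordVec he hy) α β

theorem ext_coordVec (he : e ∈ atlas (EuclideanSpace ℝ (Fin m)) X)
    {y : EuclideanSpace ℝ (Fin m)} (hy : y ∈ e.target)
    {α β : TangentSpace (𝓡 m) (e.symm y) →ₗ[ℝ] ℂ}
    (h : ∀ i, α (coordVec e y i) = β (coordVec e y i)) : α = β := by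
  have hli := linearIndependent_coordVec he hy
  have : FiniteDimensional ℝ (TangentSpace (𝓡 m) (e.symm y)) :=
    inferInstanceAs (FiniteDimensional ℝ (EuclideanSpace ℝ (Fin m)))
  have hc : Fintype.card (Fin m) = Module.finrank ℝ (TangentSpace (𝓡 m) (e.symm y)) :=
    (Fintype.card_fin m).trans (finrank_euclideanSpace_fin (𝕜 := ℝ) (n := m)).symm
  refine LinearMap.ext_on_range (hli.span_eq_top_of_card_eq_finrank' hc) h

/-- The components of the covector field `α` in the charts are measurable on `Ω`. -/
def AEMeasurableCovector (Ω : Set X) (α : ∀ x : X, TangentSpace (𝓡 m) x →ₗ[ℝ] ℂ) : Prop :=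
  ∀ e ∈ atlas (EuclideanSpace ℝ (Fin m)) X, ∀ i, AEStronglyMeasurable
    (fun y => α (e.symm y) (coordVec e y i)) (volume.restrict (coordDomain Ω e))

omit [IsManifold (𝓡 m) ∞ X] in
theorem AEMeasurableCovector.sub (hα : AEMeasurableCovector Ω α)
    (hβ : AEMeasurableCovector Ω β) : AEMeasurableCovector Ω (α - β) :=
  fun e he i => (hα e he i).sub (hβ e he i)

variable [MeasurableSpace X] [BorelSpace X] [SecondCountableTopology X] (g : RiemMetric m X)

theorem aestronglyMeasurable_cotInner (hΩ : MeasurableSet Ω) (hα : AEMeasurableCovector Ω α)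
    (hβ : AEMeasurableCovector Ω β) :
    AEStronglyMeasurable (fun x => g.cotInner x (α x) (β x)) (g.vol.restrict Ω) := by
  refine g.aestronglyMeasurable_of_forall_coord hΩ fun e he => ?_
  have h : AEStronglyMeasurable (fun y => ∑ i, ∑ j, (((g.coordGram e y)⁻¹ i j : ℝ) : ℂ) *
      (conj (α (e.symm y) (coordVec e y i)) * β (e.symm y) (coordVec e y j)))
      (volume.restrict (coordDomain Ω e)) := by
    refine Finset.aestronglyMeasurable_fun_sum _ fun i _ =>
      Finset.aestronglyMeasurable_fun_sum _ fun j _ => ?_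
    refine AEStronglyMeasurable.mul ?_
      ((Complex.continuous_conj.comp_aestronglyMeasurable (hα e he i)).mul (hβ e he j))
    refine Complex.continuous_ofReal.comp_aestronglyMeasurable ?_
    exact ((g.contDiffOn_coordGram_inv he i j).continuousOn.aestronglyMeasurable
      e.open_target.measurableSet).mono_set inter_subset_left
  refine h.congr ?_
  filter_upwards [ae_restrict_mem (measurableSet_coordDomain e hΩ)] with y hy
  exact (g.cotInner_coord he hy.1 _ _).symm

theorem aestronglyMeasurable_cotNormSq (hΩ : MeasurableSet Ω) (hα : AEMeasurableCovector Ω α) :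
    AEStronglyMeasurable (fun x => g.cotNormSq x (α x)) (g.vol.restrict Ω) :=
  Complex.continuous_re.comp_aestronglyMeasurable (g.aestronglyMeasurable_cotInner hΩ hα hα)

/-- The covector field `α` is square integrable on `Ω`. -/
structure MemL2Covector (Ω : Set X) (α : ∀ x : X, TangentSpace (𝓡 m) x →ₗ[ℝ] ℂ) : Prop where
  aemeasurable : AEMeasurableCovector Ω α
  integrable : Integrable (fun x => g.cotNormSq x (α x)) (g.vol.restrict Ω)

variable {g}

/-- `FiniteIntegral` only provides an integrable majorant; measurability of the components upgrades
it to integrability. -/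
theorem MemL2Covector.of_finiteIntegral (hΩ : MeasurableSet Ω) (hα : AEMeasurableCovector Ω α)
    (h : g.FiniteIntegral Ω (fun x => g.cotNormSq x (α x))) : g.MemL2Covector Ω α := by
  obtain ⟨F, hF, hle⟩ := h
  refine ⟨hα, hF.mono' (g.aestronglyMeasurable_cotNormSq hΩ hα) ?_⟩
  filter_upwards [hle] with x hx
  rwa [Real.norm_of_nonneg (g.cotNormSq_nonneg _ _)]

omit [BorelSpace X] [SecondCountableTopology X] in
theorem MemL2Covector.finiteIntegral (h : g.MemL2Covector Ω α) :
    g.FiniteIntegral Ω (fun x => g.cotNormSq x (α x)) :=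
  ⟨_, h.integrable, Eventually.of_forall fun _ => le_rfl⟩

omit [BorelSpace X] [SecondCountableTopology X] in
theorem MemL2Covector.mono {Ω' : Set X} (h : g.MemL2Covector Ω α) (hΩ : Ω' ⊆ Ω) :
    g.MemL2Covector Ω' α :=
  ⟨fun e he i => (h.aemeasurable e he i).mono_set (inter_subset_inter_right _ (preimage_mono hΩ)),
    h.integrable.mono_measure (Measure.restrict_mono hΩ le_rfl)⟩

theorem MemL2Covector.integrable_cotInner (hΩ : MeasurableSet Ω) (hα : g.MemL2Covector Ω α)
    (hβ : g.MemL2Covector Ω β) :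
    Integrable (fun x => g.cotInner x (α x) (β x)) (g.vol.restrict Ω) := by
  refine (hα.integrable.add hβ.integrable).mono'
    (g.aestronglyMeasurable_cotInner hΩ hα.aemeasurable hβ.aemeasurable)
    (Eventually.of_forall fun x => ?_)
  have h1 := g.norm_cotInner_sq_le x (α x) (β x)
  have h2 := g.cotNormSq_nonneg x (α x)
  have h3 := g.cotNormSq_nonneg x (β x)
  simp only [Pi.add_apply]
  refine abs_le_of_sq_le_sq' (h1.trans ?_) (by positivity) |>.2
  nlinarith [mul_nonneg h2 h3]

/-- Pointwise Cauchy-Schwarz for covectors followed by Hölder's inequality with exponents 2 and 2.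
-/
theorem MemL2Covector.norm_integral_cotInner_le (hΩ : MeasurableSet Ω)
    (hα : g.MemL2Covector Ω α) (hβ : g.MemL2Covector Ω β) :
    ‖∫ x in Ω, g.cotInner x (α x) (β x) ∂g.vol‖
      ≤ Real.sqrt (∫ x in Ω, g.cotNormSq x (α x) ∂g.vol)
        * Real.sqrt (∫ x in Ω, g.cotNormSq x (β x) ∂g.vol) := by
  have hm : ∀ {γ : ∀ x : X, TangentSpace (𝓡 m) x →ₗ[ℝ] ℂ}, g.MemL2Covector Ω γ →
      MemLp (fun x => Real.sqrt (g.cotNormSq x (γ x))) (ENNReal.ofReal 2) (g.vol.restrict Ω) := by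
    intro γ hγ
    rw [show ENNReal.ofReal 2 = 2 by simp, memLp_two_iff_integrable_sq
      (Real.continuous_sqrt.comp_aestronglyMeasurable hγ.integrable.1)]
    exact hγ.integrable.congr (Eventually.of_forall fun x =>
      (Real.sq_sqrt (g.cotNormSq_nonneg _ _)).symm)
  have h := integral_mul_le_Lp_mul_Lq_of_nonneg (p := 2) (q := 2) Real.HolderConjugate.two_two
    (Eventually.of_forall fun x => Real.sqrt_nonneg (g.cotNormSq x (α x)))
    (Eventually.of_forall fun x => Real.sqrt_nonneg (g.cotNormSq x (β x))) (hm hα) (hm hβ)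
  simp only [Real.rpow_ofNat, Real.sq_sqrt (g.cotNormSq_nonneg _ _), ← Real.sqrt_eq_rpow] at h
  refine (norm_integral_le_integral_norm _).trans (le_trans (integral_mono
    (hα.integrable_cotInner hΩ hβ).norm ?_ fun x => ?_) h)
  · have h2 : ENNReal.ofReal 2 = 2 := by simp
    exact (h2 ▸ hm hα).integrable_mul (h2 ▸ hm hβ)
  · rw [← Real.sqrt_mul (g.cotNormSq_nonneg _ _)]
    exact Real.le_sqrt_of_sq_le (g.norm_cotInner_sq_le _ _ _)

variable {u u' : X → ℂ}

omit [BorelSpace X] [SecondCountableTopology X] in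
theorem HasWeakDifferential.add (h : g.HasWeakDifferential Ω u α)
    (h' : g.HasWeakDifferential Ω u' β) : g.HasWeakDifferential Ω (u + u') (α + β) := by
  obtain ⟨v, hv, hα⟩ := h
  obtain ⟨v', hv', hβ⟩ := h'
  exact ⟨v + v', hv.add hv', fun e he i => (hα e he i).add (hβ e he i)⟩

omit [BorelSpace X] [SecondCountableTopology X] in
theorem HasWeakDifferential.smul (c : ℂ) (h : g.HasWeakDifferential Ω u α) :
    g.HasWeakDifferential Ω (c • u) (fun x => c • α x) := by
  obtain ⟨v, hv, hα⟩ := h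
  exact ⟨c • v, hv.const_smul c, fun e he i => (hα e he i).smul c⟩

omit [BorelSpace X] [SecondCountableTopology X] in
theorem HasWeakDifferential.congr (h : g.HasWeakDifferential Ω u α)
    (hu : u =ᵐ[g.vol.restrict Ω] u') : g.HasWeakDifferential Ω u' α := by
  obtain ⟨v, hv, hα⟩ := h
  exact ⟨v, hv.trans hu, hα⟩

omit [BorelSpace X] [SecondCountableTopology X] in
theorem HasWeakDifferential.mono {Ω' : Set X} (h : g.HasWeakDifferential Ω u α) (hΩ : Ω' ⊆ Ω) :
    g.HasWeakDifferential Ω' u α := by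
  obtain ⟨v, hv, hα⟩ := h
  exact ⟨v, ae_restrict_of_ae_restrict_of_subset hΩ hv, fun e he i =>
    (hα e he i).mono (inter_subset_inter_right _ (preimage_mono hΩ))⟩

omit [IsManifold (𝓡 m) ∞ X] [MeasurableSpace X] [BorelSpace X] [SecondCountableTopology X] in
theorem aemeasurableCovector_of_hasWeakPartial {v : X → ℂ}
    (h : ∀ e ∈ atlas (EuclideanSpace ℝ (Fin m)) X, ∀ i,
      HasWeakPartial (coordDomain Ω e) i (fun y => v (e.symm y))
        (fun y => α (e.symm y) (coordVec e y i))) : AEMeasurableCovector Ω α :=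
  fun e he i => (h e he i).2.1.aestronglyMeasurable

omit [BorelSpace X] [SecondCountableTopology X] in
theorem HasWeakDifferential.aemeasurable (h : g.HasWeakDifferential Ω u α) :
    AEMeasurableCovector Ω α := by
  obtain ⟨v, -, hα⟩ := h
  exact aemeasurableCovector_of_hasWeakPartial hα

theorem ae_eq_of_forall_coord (hΩ : MeasurableSet Ω)
    (h : ∀ e ∈ atlas (EuclideanSpace ℝ (Fin m)) X, ∀ i,
      (fun y => α (e.symm y) (coordVec e y i)) =ᵐ[volume.restrict (coordDomain Ω e)]
        fun y => β (e.symm y) (coordVec e y i)) : ∀ᵐ x ∂g.vol.restrict Ω, α x = β x := by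
  refine (g.ae_iff_forall_coord hΩ).2 fun e he => ?_
  filter_upwards [ae_all_iff.2 (h e he), ae_restrict_mem (measurableSet_coordDomain e hΩ)]
    with y hy hyΩ
  exact ext_coordVec he hyΩ.1 hy

theorem HasWeakDifferential.unique (hΩ : IsOpen Ω) (h : g.HasWeakDifferential Ω u α)
    (h' : g.HasWeakDifferential Ω u' β) (hu : u =ᵐ[g.vol.restrict Ω] u') :
    ∀ᵐ x ∂g.vol.restrict Ω, α x = β x := by
  obtain ⟨v, hv, hα⟩ := h
  obtain ⟨v', hv', hβ⟩ := h'
  exact ae_eq_of_forall_coord hΩ.measurableSet fun e he i => (hα e he i).unique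
    (isOpen_coordDomain e hΩ) (hβ e he i)
    (g.ae_coord_of_ae he hΩ.measurableSet (hv.trans (hu.trans hv'.symm)))

omit [BorelSpace X] [SecondCountableTopology X] in
theorem HasWeakDifferential.weakDifferential (h : g.HasWeakDifferential Ω u α) :
    g.HasWeakDifferential Ω u (g.weakDifferential Ω u) := by
  have h' : ∃ α, g.HasWeakDifferential Ω u α := ⟨α, h⟩
  rw [RiemMetric.weakDifferential, dif_pos h']
  exact h'.choose_spec

theorem HasWeakDifferential.weakDifferential_ae_eq (hΩ : IsOpen Ω)
    (h : g.HasWeakDifferential Ω u α) :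
    ∀ᵐ x ∂g.vol.restrict Ω, g.weakDifferential Ω u x = α x :=
  h.weakDifferential.unique hΩ h (ae_eq_refl _)

omit [BorelSpace X] [SecondCountableTopology X] in
theorem hasWeakDifferential_weakDifferential (f : g.sobolevOne Ω) :
    g.HasWeakDifferential Ω f (g.weakDifferential Ω f) := by
  obtain ⟨α, hα, -⟩ := f.2
  exact hα.weakDifferential

omit [SecondCountableTopology X] in
theorem MemL2Covector.congr_ae (hΩ : MeasurableSet Ω) (h : g.MemL2Covector Ω α)
    (hαβ : ∀ᵐ x ∂g.vol.restrict Ω, α x = β x) : g.MemL2Covector Ω β := by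
  refine ⟨fun e he i => (h.aemeasurable e he i).congr ?_, h.integrable.congr ?_⟩
  · filter_upwards [g.ae_coord_of_ae he hΩ hαβ] with y hy
    rw [hy]
  · filter_upwards [hαβ] with x hx
    rw [hx]

theorem memL2Covector_weakDifferential (hΩ : IsOpen Ω) (f : g.sobolevOne Ω) :
    g.MemL2Covector Ω (g.weakDifferential Ω f) := by
  obtain ⟨α, hα, hF⟩ := f.2
  refine (MemL2Covector.of_finiteIntegral hΩ.measurableSet hα.aemeasurable hF).congr_ae
    hΩ.measurableSet ?_
  filter_upwards [hα.weakDifferential_ae_eq hΩ] with x hx using hx.symm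

omit [BorelSpace X] [SecondCountableTopology X] in
theorem HasWeakDifferential.mem_sobolevOne {f : g.L2 Ω} (h : g.HasWeakDifferential Ω f α)
    (hα : g.MemL2Covector Ω α) : f ∈ g.sobolevOne Ω := ⟨α, h, hα.finiteIntegral⟩

/-- By uniqueness almost everywhere the form may be computed from any weak differentials, not only
the chosen ones. Sums, multiples and restrictions are handled through this. -/
theorem energyForm_apply (hΩ : IsOpen Ω) {f k : (g.energyForm Ω).dom}
    (hf : g.HasWeakDifferential Ω (f : g.L2 Ω) α) (hk : g.HasWeakDifferential Ω (k : g.L2 Ω) β) :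
    (g.energyForm Ω).form f k = ∫ x in Ω, g.cotInner x (α x) (β x) ∂g.vol := by
  refine integral_congr_ae ?_
  filter_upwards [hf.weakDifferential_ae_eq hΩ, hk.weakDifferential_ae_eq hΩ] with x h1 h2
  rw [h1, h2]

theorem energyForm_self (hΩ : IsOpen Ω) {f : (g.energyForm Ω).dom}
    (hf : g.HasWeakDifferential Ω (f : g.L2 Ω) α) :
    (g.energyForm Ω).form f f = ((∫ x in Ω, g.cotNormSq x (α x) ∂g.vol : ℝ) : ℂ) := by
  rw [energyForm_apply hΩ hf hf, ← integral_complex_ofReal]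
  simp only [g.cotInner_self]

theorem isNonnegForm_energyForm (g : RiemMetric m X) (hΩ : IsOpen Ω) :
    (g.energyForm Ω).IsNonnegForm where
  add_right f u v := by
    have hf := hasWeakDifferential_weakDifferential f
    have hu := hasWeakDifferential_weakDifferential u
    have hv := hasWeakDifferential_weakDifferential v
    have huv : g.HasWeakDifferential Ω ((u + v : (g.energyForm Ω).dom) : g.L2 Ω) _ :=
      (hu.add hv).congr (Lp.coeFn_add (u : g.L2 Ω) (v : g.L2 Ω)).symm
    rw [energyForm_apply hΩ hf huv, energyForm_apply hΩ hf hu, energyForm_apply hΩ hf hv,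
      ← integral_add]
    · exact integral_congr_ae (Eventually.of_forall fun x => g.cotInner_add_right _ _ _ _)
    · exact (memL2Covector_weakDifferential hΩ f).integrable_cotInner hΩ.measurableSet
        (memL2Covector_weakDifferential hΩ u)
    · exact (memL2Covector_weakDifferential hΩ f).integrable_cotInner hΩ.measurableSet
        (memL2Covector_weakDifferential hΩ v)
  smul_right f c u := by
    have hf := hasWeakDifferential_weakDifferential f
    have hu := hasWeakDifferential_weakDifferential u
    have hcu : g.HasWeakDifferential Ω ((c • u : (g.energyForm Ω).dom) : g.L2 Ω) _ :=
      (hu.smul c).congr (Lp.coeFn_smul c (u : g.L2 Ω)).symm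
    rw [energyForm_apply hΩ hf hcu, energyForm_apply hΩ hf hu, ← integral_const_mul]
    exact integral_congr_ae (Eventually.of_forall fun x => g.cotInner_smul_right _ _ _ _)
  conj_symm f u := by
    change conj (∫ x in Ω, _ ∂g.vol) = ∫ x in Ω, _ ∂g.vol
    rw [← integral_conj]
    exact integral_congr_ae (Eventually.of_forall fun x => g.cotInner_conj_symm _ _ _)
  nonneg f := by
    rw [energyForm_self hΩ (hasWeakDifferential_weakDifferential f), Complex.ofReal_re]
    exact integral_nonneg fun x => g.cotNormSq_nonneg _ _

theorem norm1_sq_energyForm (hΩ : IsOpen Ω) {f : (g.energyForm Ω).dom}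
    (hf : g.HasWeakDifferential Ω (f : g.L2 Ω) α) :
    (g.energyForm Ω).norm1 f ^ 2 = ‖(f : g.L2 Ω)‖ ^ 2 + ∫ x in Ω, g.cotNormSq x (α x) ∂g.vol := by
  have h : 0 ≤ ∫ x in Ω, g.cotNormSq x (α x) ∂g.vol :=
    integral_nonneg fun x => g.cotNormSq_nonneg _ _
  rw [HilbertForm.norm1, energyForm_self hΩ hf, Complex.ofReal_re, Real.sq_sqrt (by positivity)]

end RiemMetric

end

/-! ### Smooth functions lie in H¹; density of the form domain. -/

section

namespace RiemMetric

attribute [local instance] chartedSpaceSelf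

variable {m : ℕ} {X : Type*} [TopologicalSpace X] [ChartedSpace (EuclideanSpace ℝ (Fin m)) X]
  {e : OpenPartialHomeomorph X (EuclideanSpace ℝ (Fin m))} {Ω : Set X}

/-- The differential of a differentiable complex valued function. -/
def differential (m : ℕ) {X : Type*} [TopologicalSpace X]
    [ChartedSpace (EuclideanSpace ℝ (Fin m)) X] (f : X → ℂ) (x : X) :
    TangentSpace (𝓡 m) x →ₗ[ℝ] ℂ :=
  (mfderiv (𝓡 m) 𝓘(ℝ, ℂ) f x).toLinearMap

theorem differential_eq_zero {f : X → ℂ} {x : X} (hx : x ∉ tsupport f) :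
    differential m f x = 0 := by
  have h : f =ᶠ[𝓝 x] fun _ => 0 := notMem_tsupport_iff_eventuallyEq.1 hx
  ext v
  rw [differential, h.mfderiv_eq, mfderiv_const]
  rfl

variable [IsManifold (𝓡 m) ∞ X]

theorem contDiffOn_comp_symm {f : X → ℂ} (hf : ContMDiff (𝓡 m) 𝓘(ℝ, ℂ) ∞ f)
    (he : e ∈ atlas (EuclideanSpace ℝ (Fin m)) X) :
    ContDiffOn ℝ ∞ (fun y => f (e.symm y)) e.target := by
  rw [← contMDiffOn_iff_contDiffOn]
  exact hf.comp_contMDiffOn (contMDiffOn_symm_of_atlas he)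

theorem differential_coordVec {f : X → ℂ} (hf : ContMDiff (𝓡 m) 𝓘(ℝ, ℂ) ∞ f)
    (he : e ∈ atlas (EuclideanSpace ℝ (Fin m)) X) {y : EuclideanSpace ℝ (Fin m)}
    (hy : y ∈ e.target) (i : Fin m) :
    differential m f (e.symm y) (coordVec e y i)
      = fderiv ℝ (fun y => f (e.symm y)) y (stdVec i) := by
  have h1 := mfderiv_comp y (hf.mdifferentiable (by simp) (e.symm y))
    ((mdifferentiable_of_atlas he).symm.mdifferentiableAt hy)
  rw [← mfderiv_eq_fderiv]
  exact (congrArg (fun L : EuclideanSpace ℝ (Fin m) →L[ℝ] ℂ => L (stdVec i)) h1).symm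

theorem continuous_cotNormSq_differential (g : RiemMetric m X) {f : X → ℂ}
    (hf : ContMDiff (𝓡 m) 𝓘(ℝ, ℂ) ∞ f) :
    Continuous fun x => g.cotNormSq x (differential m f x) := by
  refine continuous_iff_continuousAt.2 fun x => ?_
  set e := chartAt (EuclideanSpace ℝ (Fin m)) x with he
  have hx : x ∈ e.source := mem_chart_source _ x
  have hea : e ∈ atlas (EuclideanSpace ℝ (Fin m)) X := chart_mem_atlas _ x
  have hd : ∀ i, ContinuousOn (fun y => fderiv ℝ (fun y => f (e.symm y)) y (stdVec i)) e.target :=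
    fun i => ((contDiffOn_comp_symm hf hea).continuousOn_fderiv_of_isOpen e.open_target
      (by simp)).clm_apply continuousOn_const
  have hF : ContinuousOn (fun y => (∑ i, ∑ j, (((g.coordGram e y)⁻¹ i j : ℝ) : ℂ) *
      (conj (fderiv ℝ (fun y => f (e.symm y)) y (stdVec i)) *
        fderiv ℝ (fun y => f (e.symm y)) y (stdVec j))).re) e.target := by
    refine Complex.continuous_re.comp_continuousOn (continuousOn_finsetSum _ fun i _ =>
      continuousOn_finsetSum _ fun j _ => ContinuousOn.mul ?_ (ContinuousOn.mul ?_ (hd j)))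
    · exact Complex.continuous_ofReal.comp_continuousOn (g.contDiffOn_coordGram_inv hea i j).continuousOn
    · exact Complex.continuous_conj.comp_continuousOn (hd i)
  have h2 : ContinuousOn (fun x => g.cotNormSq x (differential m f x)) e.source := by
    refine (hF.comp e.continuousOn e.mapsTo).congr fun z hz => ?_
    have h3 := g.cotInner_coord hea (e.map_source hz) (differential m f (e.symm (e z)))
      (differential m f (e.symm (e z)))
    simp only [differential_coordVec hf hea (e.map_source hz)] at h3
    change g.cotNormSq z (differential m f z) = _
    have h4 : g.cotNormSq z (differential m f z)
      = g.cotNormSq (e.symm (e z)) (differential m f (e.symm (e z))) := by rw [e.left_inv hz]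
    rw [h4, cotNormSq, h3]
    rfl
  exact h2.continuousAt (e.open_source.mem_nhds hx)

variable [MeasurableSpace X] [BorelSpace X] [SecondCountableTopology X] (g : RiemMetric m X)

omit [SecondCountableTopology X] in
theorem hasWeakDifferential_differential (hΩ : IsOpen Ω) {f : X → ℂ}
    (hf : ContMDiff (𝓡 m) 𝓘(ℝ, ℂ) ∞ f) : g.HasWeakDifferential Ω f (differential m f) := by
  refine ⟨f, ae_eq_refl _, fun e he i => ?_⟩
  refine (HasWeakPartial.of_contDiffOn (isOpen_coordDomain e hΩ) (((contDiffOn_comp_symm hf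
    he).mono inter_subset_left).of_le (by simp))).congr (ae_eq_refl _) ?_ (isOpen_coordDomain e hΩ)
  filter_upwards [ae_restrict_mem (measurableSet_coordDomain e hΩ.measurableSet)] with y hy
  exact (differential_coordVec hf he hy.1 i).symm

omit [SecondCountableTopology X] in
theorem memL2Covector_differential (hΩ : IsOpen Ω) {f : X → ℂ}
    (hf : ContMDiff (𝓡 m) 𝓘(ℝ, ℂ) ∞ f) (hc : HasCompactSupport f) :
    g.MemL2Covector Ω (differential m f) := by
  refine ⟨(g.hasWeakDifferential_differential hΩ hf).aemeasurable, Integrable.restrict ?_⟩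
  refine (g.continuous_cotNormSq_differential hf).integrable_of_hasCompactSupport ?_
  refine hc.mono' fun x hx => ?_
  by_contra h
  exact hx (by simp [differential_eq_zero h, (g.cotNormSq_eq_zero_iff x 0).2])

/-- An f orthogonal to H¹(Ω) is orthogonal to the restrictions of all smooth compactly supported
functions on X. Hence f vanishes almost everywhere for the measure restricted to Ω. The test
functions need not be supported in Ω. -/
theorem dense_sobolevOne [T2Space X] (hΩ : IsOpen Ω) : Dense (g.sobolevOne Ω : Set (g.L2 Ω)) := by
  rw [Submodule.dense_iff_topologicalClosure_eq_top, Submodule.topologicalClosure_eq_top_iff,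
    Submodule.eq_bot_iff]
  intro f hf
  have : LocallyCompactSpace X := Manifold.locallyCompact_of_finiteDimensional (𝓡 m)
  rw [Lp.eq_zero_iff_ae_eq_zero]
  refine ae_eq_zero_of_integral_contMDiff_smul_eq_zero (𝓡 m)
    ((Lp.memLp f).locallyIntegrable (by norm_num)) fun φ hφ hc => ?_
  have hφ' : ContMDiff (𝓡 m) 𝓘(ℝ, ℂ) ∞ (fun x => (φ x : ℂ)) :=
    Complex.ofRealCLM.contDiff.contMDiff.comp hφ
  have hc' : HasCompactSupport (fun x => (φ x : ℂ)) := hc.comp_left Complex.ofReal_zero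
  have hL : MemLp (fun x => (φ x : ℂ)) 2 (g.vol.restrict Ω) :=
    hφ'.continuous.memLp_of_hasCompactSupport hc'
  have hmem : hL.toLp ∈ g.sobolevOne Ω :=
    ((g.hasWeakDifferential_differential hΩ hφ').congr hL.coeFn_toLp.symm).mem_sobolevOne
      (g.memL2Covector_differential hΩ hφ' hc')
  have h0 := (Submodule.mem_orthogonal _ _).1 hf _ hmem
  rw [L2.inner_def] at h0
  rw [← h0]
  refine integral_congr_ae ?_
  filter_upwards [hL.coeFn_toLp] with x hx
  rw [hx]
  simp [mul_comm]

end RiemMetric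

end

/-! ### Completeness of H¹ and closedness of the energy form. -/

section

theorem TendstoL1.of_tendsto_sq {α : Type*} [MeasurableSpace α] {μ : Measure α}
    [IsFiniteMeasure μ] {f : ℕ → α → ℂ} {g : α → ℂ} (hf : ∀ n, Integrable (f n) μ)
    (hg : AEStronglyMeasurable g μ)
    (h : Tendsto (fun n => ∫⁻ x, ‖f n x - g x‖ₑ ^ 2 ∂μ) atTop (𝓝 0)) : TendstoL1 μ f g := by
  have hle : ∀ n, ∫⁻ x, ‖f n x - g x‖ₑ ∂μ
      ≤ (∫⁻ x, ‖f n x - g x‖ₑ ^ 2 ∂μ) ^ (1 / 2 : ℝ) * μ univ ^ (1 - 1 / 2 : ℝ) := by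
    intro n
    have := eLpNorm_le_eLpNorm_mul_rpow_measure_univ (p := 1) (q := 2) (by norm_num)
      ((hf n).1.sub hg)
    rw [eLpNorm_one_eq_lintegral_enorm,
      eLpNorm_eq_lintegral_rpow_enorm_toReal (by norm_num) (by norm_num)] at this
    simpa using this
  have hC : μ univ ^ (1 - 1 / 2 : ℝ) ≠ ⊤ :=
    ENNReal.rpow_ne_top_of_nonneg (by norm_num) (measure_ne_top _ _)
  have hlim : Tendsto (fun n => ∫⁻ x, ‖f n x - g x‖ₑ ∂μ) atTop (𝓝 0) := by
    refine tendsto_of_tendsto_of_tendsto_of_le_of_le tendsto_const_nhds ?_ (fun _ => zero_le) hle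
    have h1 := (ENNReal.continuous_rpow_const (y := 1 / 2)).tendsto 0 |>.comp h
    have h2 := ENNReal.Tendsto.mul_const h1 (Or.inr hC)
    simpa using h2
  refine ⟨hf, ?_, hlim⟩
  obtain ⟨n, hn⟩ := (hlim.eventually (gt_mem_nhds ENNReal.zero_lt_top)).exists
  have h1 : Integrable (fun x => f n x - g x) μ := ⟨(hf n).1.sub hg, hn⟩
  exact ((hf n).sub h1).congr (Eventually.of_forall fun x => by simp)

namespace RiemMetric

variable {m : ℕ} {X : Type*} [TopologicalSpace X] [ChartedSpace (EuclideanSpace ℝ (Fin m)) X]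
  [IsManifold (𝓡 m) ∞ X] {e : OpenPartialHomeomorph X (EuclideanSpace ℝ (Fin m))} {Ω : Set X}

theorem tendsto_cotNormSq (g : RiemMetric m X) {ι : Type*} {l : Filter ι} {x : X}
    {α : ι → TangentSpace (𝓡 m) x →ₗ[ℝ] ℂ} {β : TangentSpace (𝓡 m) x →ₗ[ℝ] ℂ}
    (h : ∀ w, Tendsto (fun n => α n w) l (𝓝 (β w))) :
    Tendsto (fun n => g.cotNormSq x (α n)) l (𝓝 (g.cotNormSq x β)) := by
  refine (Complex.continuous_re.tendsto _).comp (tendsto_finsetSum _ fun i _ =>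
    tendsto_finsetSum _ fun j _ => tendsto_const_nhds.mul (Tendsto.mul ?_ (h _)))
  exact (Complex.continuous_conj.tendsto _).comp (h _)

variable [MeasurableSpace X] [BorelSpace X] [SecondCountableTopology X] {g : RiemMetric m X}

theorem MemL2Covector.sub {α β : ∀ x : X, TangentSpace (𝓡 m) x →ₗ[ℝ] ℂ}
    (hΩ : MeasurableSet Ω) (hα : g.MemL2Covector Ω α) (hβ : g.MemL2Covector Ω β) :
    g.MemL2Covector Ω (α - β) := by
  refine .of_finiteIntegral hΩ (hα.aemeasurable.sub hβ.aemeasurable)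
    ⟨_, (hα.integrable.const_mul 2).add (hβ.integrable.const_mul 2),
      Eventually.of_forall fun x => ?_⟩
  have h1 := g.cotNormSq_add_le x (α x) ((-1 : ℂ) • β x)
  rw [g.cotNormSq_smul] at h1
  simpa [sub_eq_add_neg] using h1

omit [BorelSpace X] [SecondCountableTopology X] in
theorem MemL2Covector.lintegral_eq {α : ∀ x : X, TangentSpace (𝓡 m) x →ₗ[ℝ] ℂ}
    (hα : g.MemL2Covector Ω α) :
    ∫⁻ x in Ω, ENNReal.ofReal (g.cotNormSq x (α x)) ∂g.vol
      = ENNReal.ofReal (∫ x in Ω, g.cotNormSq x (α x) ∂g.vol) :=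
  (ofReal_integral_eq_lintegral_ofReal hα.integrable
    (Eventually.of_forall fun _ => g.cotNormSq_nonneg _ _)).symm

-- Finiteness of the series bounds 4ⁿ |α_n - α_{n+1}|², so on each vector w the increments are at
-- most a constant times 2⁻ⁿ and the values form a Cauchy sequence.
omit [MeasurableSpace X] [BorelSpace X] [SecondCountableTopology X] in
theorem exists_tendsto_of_summable_sq (g : RiemMetric m X) {x : X}
    {α : ℕ → TangentSpace (𝓡 m) x →ₗ[ℝ] ℂ}
    (h : ∑' n, ENNReal.ofReal (4 ^ n * g.cotNormSq x (α n - α (n + 1))) < ⊤) :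
    ∃ β : TangentSpace (𝓡 m) x →ₗ[ℝ] ℂ, ∀ w, Tendsto (fun n => α n w) atTop (𝓝 (β w)) := by
  set C := (∑' n, ENNReal.ofReal (4 ^ n * g.cotNormSq x (α n - α (n + 1)))).toReal with hC
  have hC0 : 0 ≤ C := ENNReal.toReal_nonneg
  have hle : ∀ n, 4 ^ n * g.cotNormSq x (α n - α (n + 1)) ≤ C := fun n =>
    (ENNReal.ofReal_le_iff_le_toReal h.ne).1 (ENNReal.le_tsum n)
  have hc : ∀ w, ∃ z, Tendsto (fun n => α n w) atTop (𝓝 z) := by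
    intro w
    refine cauchySeq_tendsto_of_complete (cauchySeq_of_le_geometric (1 / 2)
      (Real.sqrt (g.inner x w w * C)) (by norm_num) fun n => ?_)
    have h1 := g.norm_apply_sq_le x (α n - α (n + 1)) w
    have h0 : 0 ≤ g.inner x w w := by
      by_cases hw : w = 0
      · simp [hw]
      · exact (g.pos x w hw).le
    have h2 : (2 ^ n * ‖(α n - α (n + 1)) w‖) ^ 2 ≤ g.inner x w w * C := by
      have h3 := mul_le_mul_of_nonneg_left (hle n) h0
      have h4 : ((2 : ℝ) ^ n) ^ 2 = 4 ^ n := by rw [← pow_mul, mul_comm, pow_mul]; norm_num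
      rw [mul_pow, h4]
      refine le_trans ?_ h3
      rw [mul_left_comm]
      gcongr
    rw [dist_eq_norm, one_div, inv_pow, ← div_eq_mul_inv, le_div_iff₀ (by positivity), mul_comm]
    exact Real.le_sqrt_of_sq_le h2
  choose β hβ using hc
  exact ⟨linearMapOfTendsto β α (tendsto_pi_nhds.2 hβ), hβ⟩

/-- Riesz-Fischer for covector fields: the limit is taken pointwise on each tangent space, and
Fatou's lemma carries the L² bounds over to it. -/
theorem MemL2Covector.exists_limit (hΩ : MeasurableSet Ω)
    {α : ℕ → ∀ x : X, TangentSpace (𝓡 m) x →ₗ[ℝ] ℂ} (hα : ∀ n, g.MemL2Covector Ω (α n))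
    (h : ∀ N n k, N ≤ n → N ≤ k →
      ∫ x in Ω, g.cotNormSq x (α n x - α k x) ∂g.vol ≤ (1 / 16) ^ N) :
    ∃ β, g.MemL2Covector Ω β ∧
      ∀ N, ∫ x in Ω, g.cotNormSq x (α N x - β x) ∂g.vol ≤ (1 / 16) ^ N := by
  have hm : ∀ n k, AEMeasurable (fun x => ENNReal.ofReal (g.cotNormSq x (α n x - α k x)))
      (g.vol.restrict Ω) := fun n k =>
    ((hα n).sub hΩ (hα k)).integrable.1.aemeasurable.ennreal_ofReal
  have hl : ∀ N n k, N ≤ n → N ≤ k →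
      ∫⁻ x in Ω, ENNReal.ofReal (g.cotNormSq x (α n x - α k x)) ∂g.vol
        ≤ ENNReal.ofReal ((1 / 16) ^ N) := fun N n k hn hk => by
    have := ((hα n).sub hΩ (hα k)).lintegral_eq
    simp only [Pi.sub_apply] at this
    rw [this]
    exact ENNReal.ofReal_le_ofReal (h N n k hn hk)
  have e4 : ∀ (n : ℕ) (r : ℝ), ENNReal.ofReal (4 ^ n * r) = ENNReal.ofReal (4 ^ n) *
      ENNReal.ofReal r := fun n r => ENNReal.ofReal_mul (by positivity)
  -- The weights 4ⁿ leave increments of integral at most 4ⁿ · 16⁻ⁿ = 4⁻ⁿ, which is summable.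
  have hfin : ∀ᵐ x ∂g.vol.restrict Ω,
      ∑' n, ENNReal.ofReal (4 ^ n * g.cotNormSq x (α n x - α (n + 1) x)) < ⊤ := by
    refine ae_lt_top' (AEMeasurable.tsum fun n => ?_) (ne_of_lt ?_)
    · simp only [e4]
      exact (hm _ _).const_mul _
    · rw [lintegral_tsum fun n => by simp only [e4]; exact (hm _ _).const_mul _]
      have : ∀ n, ∫⁻ x in Ω, ENNReal.ofReal (4 ^ n * g.cotNormSq x (α n x - α (n + 1) x)) ∂g.vol
          ≤ ENNReal.ofReal ((1 / 4) ^ n) := by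
        intro n
        simp only [e4]
        rw [lintegral_const_mul' _ _ ENNReal.ofReal_ne_top]
        refine (mul_le_mul_right (hl n n (n + 1) le_rfl n.le_succ) _).trans_eq ?_
        rw [← ENNReal.ofReal_mul (by positivity), ← mul_pow]
        norm_num
      refine (ENNReal.tsum_le_tsum this).trans_lt ?_
      rw [← ENNReal.ofReal_tsum_of_nonneg (fun n => by positivity)
        (summable_geometric_of_lt_one (by norm_num) (by norm_num))]
      exact ENNReal.ofReal_lt_top
  classical
  set β : ∀ x : X, TangentSpace (𝓡 m) x →ₗ[ℝ] ℂ := fun x =>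
    if h : ∃ β : TangentSpace (𝓡 m) x →ₗ[ℝ] ℂ, ∀ w, Tendsto (fun n => α n x w) atTop (𝓝 (β w))
    then h.choose else 0 with hβ
  have hlim : ∀ᵐ x ∂g.vol.restrict Ω, ∀ w, Tendsto (fun n => α n x w) atTop (𝓝 (β x w)) := by
    filter_upwards [hfin] with x hx
    have h' := g.exists_tendsto_of_summable_sq hx
    simp only [hβ, dif_pos h']
    exact h'.choose_spec
  have hβm : AEMeasurableCovector Ω β := fun e he i =>
    aestronglyMeasurable_of_tendsto_ae atTop (fun n => (hα n).aemeasurable e he i)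
      ((g.ae_coord_of_ae he hΩ hlim).mono fun y hy => hy _)
  have hFatou : ∀ N, ∫⁻ x in Ω, ENNReal.ofReal (g.cotNormSq x (α N x - β x)) ∂g.vol
      ≤ ENNReal.ofReal ((1 / 16) ^ N) := by
    intro N
    calc _ = ∫⁻ x in Ω, liminf (fun k => ENNReal.ofReal (g.cotNormSq x (α N x - α k x))) atTop
          ∂g.vol := by
          refine lintegral_congr_ae ?_
          filter_upwards [hlim] with x hx
          exact (ENNReal.tendsto_ofReal (g.tendsto_cotNormSq fun w =>
            tendsto_const_nhds.sub (hx w))).liminf_eq.symm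
      _ ≤ liminf (fun k => ∫⁻ x in Ω, ENNReal.ofReal (g.cotNormSq x (α N x - α k x)) ∂g.vol)
          atTop := lintegral_liminf_le' fun k => hm N k
      _ ≤ _ := by
          refine liminf_le_of_frequently_le' (Eventually.frequently ?_)
          filter_upwards [eventually_ge_atTop N] with k hk
          exact hl N N k le_rfl hk
  have hdiff : ∀ N, g.MemL2Covector Ω (α N - β) := fun N => by
    have hm' := (hα N).aemeasurable.sub hβm
    refine ⟨hm', g.aestronglyMeasurable_cotNormSq hΩ hm', ?_⟩
    rw [hasFiniteIntegral_iff_ofReal (Eventually.of_forall fun x => g.cotNormSq_nonneg _ _)]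
    exact (hFatou N).trans_lt ENNReal.ofReal_lt_top
  refine ⟨β, ?_, fun N => ?_⟩
  · have := (hα 0).sub hΩ (hdiff 0)
    rwa [sub_sub_cancel] at this
  · have h1 := hFatou N
    have h2 := (hdiff N).lintegral_eq
    simp only [Pi.sub_apply] at h2
    rw [h2] at h1
    exact (ENNReal.ofReal_le_ofReal_iff (by positivity)).1 h1

omit [SecondCountableTopology X] in
theorem HasWeakDifferential.hasWeakPartial {u : X → ℂ}
    {α : ∀ x : X, TangentSpace (𝓡 m) x →ₗ[ℝ] ℂ} (hΩ : IsOpen Ω)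
    (h : g.HasWeakDifferential Ω u α) (he : e ∈ atlas (EuclideanSpace ℝ (Fin m)) X) (i : Fin m) :
    HasWeakPartial (coordDomain Ω e) i (fun y => u (e.symm y))
      (fun y => α (e.symm y) (coordVec e y i)) := by
  obtain ⟨v, hv, hα⟩ := h
  exact (hα e he i).congr (g.ae_coord_of_ae he hΩ.measurableSet hv) (ae_eq_refl _)
    (isOpen_coordDomain e hΩ)

/-- On a compact set in a chart, Lebesgue integrals are controlled by Riemannian ones, and the i-th
component of a covector is controlled by its norm through g_ii. So L² convergence on Ω becomes local
L¹ convergence of components, under which weak derivatives are closed. -/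
theorem HasWeakDifferential.of_tendsto (hΩ : IsOpen Ω) {f : ℕ → X → ℂ} {u : X → ℂ}
    {α : ℕ → ∀ x : X, TangentSpace (𝓡 m) x →ₗ[ℝ] ℂ} {β : ∀ x : X, TangentSpace (𝓡 m) x →ₗ[ℝ] ℂ}
    (hf : ∀ n, g.HasWeakDifferential Ω (f n) (α n)) (hfm : ∀ n, MemLp (f n) 2 (g.vol.restrict Ω))
    (hu : AEStronglyMeasurable u (g.vol.restrict Ω)) (hα : ∀ n, g.MemL2Covector Ω (α n))
    (hβ : g.MemL2Covector Ω β)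
    (hfu : Tendsto (fun n => ∫⁻ x in Ω, ‖f n x - u x‖ₑ ^ 2 ∂g.vol) atTop (𝓝 0))
    (hαβ : Tendsto (fun n => ∫ x in Ω, g.cotNormSq x (α n x - β x) ∂g.vol) atTop (𝓝 0)) :
    g.HasWeakDifferential Ω u β := by
  refine ⟨u, ae_eq_refl _, fun e he i => ?_⟩
  refine HasWeakPartial.of_tendsto (isOpen_coordDomain e hΩ) fun K hKΩ hK =>
    ⟨_, _, fun n => (hf n).hasWeakPartial hΩ he i, ?_, ?_⟩
  all_goals
    have : IsFiniteMeasure (volume.restrict K) := ⟨by simpa using hK.measure_lt_top⟩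
    obtain ⟨C, hC, hle⟩ := g.lintegral_coord_le he hΩ.measurableSet hK hKΩ
  · refine TendstoL1.of_tendsto_sq
      (fun n => ((hf n).hasWeakPartial hΩ he i).1.integrableOn_compact_subset hKΩ hK)
      ((g.aestronglyMeasurable_coord he hΩ.measurableSet hu).mono_set hKΩ) ?_
    refine tendsto_of_tendsto_of_tendsto_of_le_of_le tendsto_const_nhds ?_ (fun _ => zero_le)
      fun n => hle (fun x => ‖f n x - u x‖ₑ ^ 2) (((hfm n).1.sub hu).enorm.pow_const 2)
    simpa using ENNReal.Tendsto.const_mul hfu (Or.inr hC)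
  · obtain ⟨M, hM⟩ := hK.exists_bound_of_continuousOn
      ((g.contDiffOn_coordGram he i i).continuousOn.mono fun y hy => (hKΩ hy).1)
    refine TendstoL1.of_tendsto_sq
      (fun n => ((hf n).hasWeakPartial hΩ he i).2.1.integrableOn_compact_subset hKΩ hK)
      ((hβ.aemeasurable e he i).mono_set hKΩ) ?_
    have hd := fun n => (hα n).sub hΩ.measurableSet hβ
    have h1 : ∀ n, ∫⁻ y in K, ‖α n (e.symm y) (coordVec e y i) - β (e.symm y) (coordVec e y i)‖ₑ ^ 2
        ≤ ENNReal.ofReal M * (C *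
          ENNReal.ofReal (∫ x in Ω, g.cotNormSq x (α n x - β x) ∂g.vol)) := by
      intro n
      have h2 := (hd n).lintegral_eq
      simp only [Pi.sub_apply] at h2
      rw [← h2]
      refine le_trans ?_ (mul_le_mul_right (hle _ ?_) _)
      · rw [← lintegral_const_mul' _ _ ENNReal.ofReal_ne_top]
        refine setLIntegral_mono' hK.measurableSet fun y hy => ?_
        have h3 := g.norm_apply_sq_le (e.symm y) (α n (e.symm y) - β (e.symm y)) (coordVec e y i)
        have h4 : g.inner (e.symm y) (coordVec e y i) (coordVec e y i) ≤ M :=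
          (le_abs_self _).trans (hM y hy)
        have h0 := g.cotNormSq_nonneg (e.symm y) (α n (e.symm y) - β (e.symm y))
        rw [← ENNReal.ofReal_mul' h0, ← ofReal_norm, ← ENNReal.ofReal_pow (norm_nonneg _)]
        exact ENNReal.ofReal_le_ofReal (h3.trans (mul_le_mul_of_nonneg_right h4 h0))
      · exact (hd n).integrable.1.aemeasurable.ennreal_ofReal
    refine tendsto_of_tendsto_of_tendsto_of_le_of_le tendsto_const_nhds ?_ (fun _ => zero_le) h1
    have h5 := ENNReal.tendsto_ofReal hαβ
    rw [ENNReal.ofReal_zero] at h5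
    simpa using ENNReal.Tendsto.const_mul (ENNReal.Tendsto.const_mul h5 (Or.inr hC))
      (Or.inr (ENNReal.ofReal_ne_top (r := M)))

omit [BorelSpace X] [SecondCountableTopology X] in
theorem lintegral_enorm_sub_sq {f k : g.L2 Ω} :
    ∫⁻ x in Ω, ‖f x - k x‖ₑ ^ 2 ∂g.vol = ENNReal.ofReal (‖f - k‖ ^ 2) := by
  have h1 : eLpNorm (f - k : g.L2 Ω) 2 (g.vol.restrict Ω) = ENNReal.ofReal ‖f - k‖ := by
    rw [Lp.norm_def, ENNReal.ofReal_toReal (Lp.eLpNorm_ne_top _)]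
  rw [ENNReal.ofReal_pow (norm_nonneg _), ← h1,
    eLpNorm_eq_lintegral_rpow_enorm_toReal (by norm_num) (by norm_num), ← ENNReal.rpow_ofNat,
    ← ENNReal.rpow_mul]
  simp only [ENNReal.toReal_ofNat, one_div, inv_mul_cancel₀ (two_ne_zero' ℝ), ENNReal.rpow_one,
    ENNReal.rpow_ofNat]
  refine lintegral_congr_ae ?_
  filter_upwards [Lp.coeFn_sub f k] with x hx
  rw [hx, Pi.sub_apply]

/-- It suffices to treat sequences that are Cauchy at rate 4⁻ⁿ, whose squared distances decay like
16⁻ⁿ. Functions and differentials converge separately in L², and closedness of the weak differential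
matches the limits. -/
theorem completeSpace_energyForm (g : RiemMetric m X) (hΩ : IsOpen Ω) :
    CompleteSpace (HilbertForm.FormDomain (g.isNonnegForm_energyForm hΩ)) := by
  have h := g.isNonnegForm_energyForm hΩ
  refine Metric.complete_of_convergent_controlled_sequences (fun n => (1 / 4) ^ n)
    (fun n => by positivity) fun s hs => ?_
  set f : ℕ → (g.energyForm Ω).dom := fun n => HilbertForm.FormDomain.toDom h (s n) with hf
  set α := fun n => g.weakDifferential Ω (f n) with hαd
  have hw : ∀ n, g.HasWeakDifferential Ω (f n : g.L2 Ω) (α n) := fun n =>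
    hasWeakDifferential_weakDifferential (f n)
  have hα : ∀ n, g.MemL2Covector Ω (α n) := fun n => memL2Covector_weakDifferential hΩ (f n)
  have hsub : ∀ (u v : (g.energyForm Ω).dom) (α β), g.HasWeakDifferential Ω (u : g.L2 Ω) α →
      g.HasWeakDifferential Ω (v : g.L2 Ω) β → (g.energyForm Ω).norm1 (u - v) ^ 2
        = ‖(u : g.L2 Ω) - v‖ ^ 2 + ∫ x in Ω, g.cotNormSq x (α x - β x) ∂g.vol := by
    intro u v α β hu hv
    have h1 : g.HasWeakDifferential Ω ((u - v : (g.energyForm Ω).dom) : g.L2 Ω) (α - β) := by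
      have h2 := (hu.add (hv.smul (-1))).congr (u' := ((u - v : (g.energyForm Ω).dom) : g.L2 Ω)) ?_
      · convert! h2 using 1
        funext x
        simp [sub_eq_add_neg]
      · filter_upwards [Lp.coeFn_sub (u : g.L2 Ω) (v : g.L2 Ω)] with x hx
        refine Eq.trans ?_ hx.symm
        simp [sub_eq_add_neg]
    exact norm1_sq_energyForm hΩ h1
  have hdist : ∀ n k, dist (s n) (s k) ^ 2 = ‖(f n : g.L2 Ω) - f k‖ ^ 2
      + ∫ x in Ω, g.cotNormSq x (α n x - α k x) ∂g.vol := by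
    intro n k
    rw [dist_eq_norm, HilbertForm.FormDomain.norm_eq, map_sub]
    exact hsub _ _ _ _ (hw n) (hw k)
  have hI0 : ∀ α : ∀ x : X, TangentSpace (𝓡 m) x →ₗ[ℝ] ℂ,
      0 ≤ ∫ x in Ω, g.cotNormSq x (α x) ∂g.vol := fun α =>
    integral_nonneg fun x => g.cotNormSq_nonneg _ _
  have hpow : ∀ N n k, N ≤ n → N ≤ k → dist (s n) (s k) ^ 2 ≤ (1 / 16) ^ N := by
    intro N n k hn hk
    refine (pow_le_pow_left₀ dist_nonneg (hs N n k hn hk).le 2).trans_eq ?_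
    rw [← pow_mul, mul_comm, pow_mul]
    norm_num
  obtain ⟨β, hβ, hαβ⟩ := MemL2Covector.exists_limit hΩ.measurableSet hα fun N n k hn hk => by
    have := hdist n k
    nlinarith [hpow N n k hn hk, sq_nonneg ‖(f n : g.L2 Ω) - f k‖]
  have hgeo : Tendsto (fun n : ℕ => (1 / 16 : ℝ) ^ n) atTop (𝓝 0) :=
    tendsto_pow_atTop_nhds_zero_of_lt_one (by norm_num) (by norm_num)
  have hαβ0 : Tendsto (fun n => ∫ x in Ω, g.cotNormSq x (α n x - β x) ∂g.vol) atTop (𝓝 0) :=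
    squeeze_zero (fun n => hI0 fun x => α n x - β x) hαβ hgeo
  have hcauchy : CauchySeq fun n => (f n : g.L2 Ω) := by
    refine cauchySeq_of_le_tendsto_0 (fun N => (1 / 4 : ℝ) ^ N) (fun n k N hn hk => ?_)
      (tendsto_pow_atTop_nhds_zero_of_lt_one (by norm_num) (by norm_num))
    refine le_trans ?_ (hs N n k hn hk).le
    refine abs_le_of_sq_le_sq' ?_ dist_nonneg |>.2
    rw [hdist, dist_eq_norm]
    exact le_add_of_nonneg_right (hI0 fun x => α n x - α k x)
  obtain ⟨u, hu⟩ := cauchySeq_tendsto_of_complete hcauchy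
  have hnorm : Tendsto (fun n => ‖(f n : g.L2 Ω) - u‖ ^ 2) atTop (𝓝 0) := by
    simpa using (tendsto_iff_norm_sub_tendsto_zero.1 hu).pow 2
  have hwu : g.HasWeakDifferential Ω u β := by
    refine HasWeakDifferential.of_tendsto hΩ hw (fun n => Lp.memLp _) (Lp.aestronglyMeasurable u)
      hα hβ ?_ hαβ0
    simp only [lintegral_enorm_sub_sq]
    simpa using ENNReal.tendsto_ofReal hnorm
  have hmem : u ∈ (g.energyForm Ω).dom := hwu.mem_sobolevOne hβ
  refine ⟨(HilbertForm.FormDomain.toDom h).symm ⟨u, hmem⟩, ?_⟩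
  rw [tendsto_iff_norm_sub_tendsto_zero]
  have hfin : Tendsto (fun n => (g.energyForm Ω).norm1 (f n - ⟨u, hmem⟩) ^ 2) atTop (𝓝 0) := by
    have := hnorm.add hαβ0
    rw [add_zero] at this
    exact this.congr fun n => (hsub (f n) ⟨u, hmem⟩ _ _ (hw n) hwu).symm
  have := (Real.continuous_sqrt.tendsto _).comp hfin
  rw [Real.sqrt_zero] at this
  refine this.congr fun n => ?_
  rw [Function.comp, Real.sqrt_sq (HilbertForm.norm1_nonneg _ _), HilbertForm.FormDomain.norm_eq,
    map_sub, LinearEquiv.apply_symm_apply]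

theorem isEnergyForm_energyForm [T2Space X] (g : RiemMetric m X) (hΩ : IsOpen Ω) :
    (g.energyForm Ω).IsEnergyForm :=
  haveI := g.completeSpace_energyForm hΩ
  HilbertForm.IsEnergyForm.of_completeSpace (g.isNonnegForm_energyForm hΩ) (g.dense_sobolevOne hΩ)

end RiemMetric

end

/-! ### Compatibility of the connection with the metric and the differential of the regularised
norm. -/

section

section QuadForm

variable {m : ℕ}

theorem quadForm_add_matrix (P Q : Matrix (Fin m) (Fin m) ℝ) (b c : Fin m → ℂ) :
    quadForm (P + Q) b c = quadForm P b c + quadForm Q b c := by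
  simp only [quadForm, Matrix.add_apply, add_mul, Finset.sum_add_distrib]

theorem quadForm_add_right (P : Matrix (Fin m) (Fin m) ℝ) (b c d : Fin m → ℂ) :
    quadForm P b (c + d) = quadForm P b c + quadForm P b d := by
  simp only [quadForm, Pi.add_apply, mul_add, Complex.add_re, Finset.sum_add_distrib]

theorem quadForm_mulVec (P Q : Matrix (Fin m) (Fin m) ℝ) (b c : Fin m → ℂ) :
    quadForm P b (fun l => ∑ k, (Q l k : ℂ) * c k) = quadForm (P * Q) b c := by
  simp only [quadForm, Matrix.mul_apply, Finset.sum_mul, Finset.mul_sum, Complex.re_sum]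
  refine Finset.sum_congr rfl fun j _ => ?_
  rw [Finset.sum_comm]
  refine Finset.sum_congr rfl fun k _ => Finset.sum_congr rfl fun l _ => ?_
  rw [mul_left_comm, Complex.re_ofReal_mul, mul_assoc]

theorem quadForm_self_of_antisymm {A : Matrix (Fin m) (Fin m) ℝ} (hA : A.transpose = -A)
    (b : Fin m → ℂ) : quadForm A b b = 0 := by
  have h : quadForm A b b = -quadForm A b b := by
    conv_lhs => rw [quadForm, Finset.sum_comm]
    rw [quadForm, ← Finset.sum_neg_distrib]
    refine Finset.sum_congr rfl fun j _ => ?_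
    rw [← Finset.sum_neg_distrib]
    refine Finset.sum_congr rfl fun k _ => ?_
    have h1 : A k j = -A j k := congrFun (congrFun hA j) k
    rw [h1]
    simp only [Complex.mul_re, Complex.conj_re, Complex.conj_im]
    ring
  linarith

end QuadForm

namespace RiemMetric

variable {m : ℕ} {X : Type*} [TopologicalSpace X] [ChartedSpace (EuclideanSpace ℝ (Fin m)) X]
  [IsManifold (𝓡 m) ∞ X] {e : OpenPartialHomeomorph X (EuclideanSpace ℝ (Fin m))} {Ω : Set X}

/-- The matrix of the partial derivatives `∂ᵢ gⱼₖ`. -/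
def coordGramDeriv (g : RiemMetric m X)
    (e : OpenPartialHomeomorph X (EuclideanSpace ℝ (Fin m))) (y : EuclideanSpace ℝ (Fin m))
    (i : Fin m) : Matrix (Fin m) (Fin m) ℝ :=
  Matrix.of fun j k => fderiv ℝ (fun z => g.coordGram e z j k) y (stdVec i)

/-- The matrix of the partial derivatives `∂ᵢ gʲᵏ`. -/
def coordGramInvDeriv (g : RiemMetric m X)
    (e : OpenPartialHomeomorph X (EuclideanSpace ℝ (Fin m))) (y : EuclideanSpace ℝ (Fin m))
    (i : Fin m) : Matrix (Fin m) (Fin m) ℝ :=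
  Matrix.of fun j k => fderiv ℝ (fun z => (g.coordGram e z)⁻¹ j k) y (stdVec i)

variable (g : RiemMetric m X)

theorem coordGram_mul_inv (he : e ∈ atlas (EuclideanSpace ℝ (Fin m)) X)
    {y : EuclideanSpace ℝ (Fin m)} (hy : y ∈ e.target) :
    g.coordGram e y * (g.coordGram e y)⁻¹ = 1 :=
  Matrix.mul_nonsing_inv _ (g.coordGram_posDef he hy).det_pos.ne'.isUnit

theorem coordGram_inv_mul (he : e ∈ atlas (EuclideanSpace ℝ (Fin m)) X)
    {y : EuclideanSpace ℝ (Fin m)} (hy : y ∈ e.target) :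
    (g.coordGram e y)⁻¹ * g.coordGram e y = 1 :=
  Matrix.nonsing_inv_mul _ (g.coordGram_posDef he hy).det_pos.ne'.isUnit

theorem coordGram_inv_transpose (he : e ∈ atlas (EuclideanSpace ℝ (Fin m)) X)
    {y : EuclideanSpace ℝ (Fin m)} (hy : y ∈ e.target) :
    ((g.coordGram e y)⁻¹).transpose = (g.coordGram e y)⁻¹ := by
  have := (g.coordGram_posDef he hy).inv.isHermitian
  rwa [Matrix.IsHermitian, Matrix.conjTranspose_eq_transpose_of_trivial] at this

/-- Obtained by differentiating G⁻¹ G = 1. -/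
theorem coordGramInvDeriv_eq (he : e ∈ atlas (EuclideanSpace ℝ (Fin m)) X)
    {y : EuclideanSpace ℝ (Fin m)} (hy : y ∈ e.target) (i : Fin m) :
    g.coordGramInvDeriv e y i
      = -((g.coordGram e y)⁻¹ * g.coordGramDeriv e y i * (g.coordGram e y)⁻¹) := by
  have hG : ∀ j k, DifferentiableAt ℝ (fun z => g.coordGram e z j k) y := fun j k =>
    ((g.contDiffOn_coordGram he j k).differentiableOn (by simp)).differentiableAt
      (e.open_target.mem_nhds hy)
  have hP : ∀ j k, DifferentiableAt ℝ (fun z => (g.coordGram e z)⁻¹ j k) y := fun j k =>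
    ((g.contDiffOn_coordGram_inv he j k).differentiableOn (by simp)).differentiableAt
      (e.open_target.mem_nhds hy)
  have h0 : g.coordGramInvDeriv e y i * g.coordGram e y
      + (g.coordGram e y)⁻¹ * g.coordGramDeriv e y i = 0 := by
    ext j k
    have h1 : (fun z => ∑ l, (g.coordGram e z)⁻¹ j l * g.coordGram e z l k)
        =ᶠ[𝓝 y] fun _ => (1 : Matrix (Fin m) (Fin m) ℝ) j k := by
      filter_upwards [e.open_target.mem_nhds hy] with z hz
      rw [← g.coordGram_inv_mul he hz, Matrix.mul_apply]
    have h2 := (HasFDerivAt.fun_sum (u := Finset.univ) fun l _ =>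
      (hP j l).hasFDerivAt.mul (hG l k).hasFDerivAt).unique
      ((hasFDerivAt_const _ _).congr_of_eventuallyEq h1)
    replace h2 := congrArg (fun L => L (stdVec i)) h2
    simp only [sum_apply, add_apply, smul_apply, smul_eq_mul, zero_apply] at h2
    simp only [Matrix.add_apply, Matrix.mul_apply, ← Finset.sum_add_distrib, coordGramInvDeriv,
      coordGramDeriv, Matrix.of_apply, Matrix.zero_apply]
    rw [← h2]
    exact Finset.sum_congr rfl fun l _ => by ring
  have h3 := congrArg (· * (g.coordGram e y)⁻¹) h0
  simp only [add_mul, zero_mul, Matrix.mul_assoc _ _ (g.coordGram e y)⁻¹,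
    g.coordGram_mul_inv he hy, Matrix.mul_one] at h3
  rw [eq_neg_of_add_eq_zero_left h3, Matrix.mul_assoc]

/-- For fixed i the symbols split into ∂ᵢG and a remainder antisymmetric in its two indices; the
remainder will not contribute to a quadratic form. -/
theorem christoffel_eq (y : EuclideanSpace ℝ (Fin m)) (i : Fin m) :
    (Matrix.of fun l k => g.christoffel e y k i l)
      = (1 / 2 : ℝ) • ((g.coordGramDeriv e y i + Matrix.of fun l s =>
          g.coordGramDeriv e y l i s - g.coordGramDeriv e y s i l)
            * ((g.coordGram e y)⁻¹).transpose) := by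
  ext l k
  simp only [Matrix.of_apply, christoffel, Matrix.smul_apply, Matrix.mul_apply, smul_eq_mul,
    Matrix.add_apply, Matrix.transpose_apply, coordGramDeriv]
  congr 1
  exact Finset.sum_congr rfl fun s _ => by ring

/-- Compatibility of the Levi-Civita connection with the metric on covectors. -/
theorem quadForm_covDeriv (he : e ∈ atlas (EuclideanSpace ℝ (Fin m)) X)
    {y : EuclideanSpace ℝ (Fin m)} (hy : y ∈ e.target) (i : Fin m) (a s : Fin m → ℂ) :
    quadForm (g.coordGram e y)⁻¹ a (fun l => s l + ∑ k, (g.christoffel e y k i l : ℂ) * a k)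
      + quadForm (fun j k => (1 / 2) * fderiv ℝ (fun z => (g.coordGram e z)⁻¹ j k) y (stdVec i)) a a
      = quadForm (g.coordGram e y)⁻¹ a s := by
  set P := (g.coordGram e y)⁻¹ with hP
  have hPt : P.transpose = P := g.coordGram_inv_transpose he hy
  set A : Matrix (Fin m) (Fin m) ℝ := Matrix.of fun l s =>
    g.coordGramDeriv e y l i s - g.coordGramDeriv e y s i l with hA
  have hAt : A.transpose = -A := by
    ext l s
    simp [hA]
  have e1 : (fun j k => (1 / 2) * fderiv ℝ (fun z => (g.coordGram e z)⁻¹ j k) y (stdVec i))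
      = (1 / 2 : ℝ) • g.coordGramInvDeriv e y i := rfl
  have e2 : (fun l => s l + ∑ k, (g.christoffel e y k i l : ℂ) * a k)
      = s + fun l => ∑ k, (((Matrix.of fun l k => g.christoffel e y k i l) l k : ℝ) : ℂ) * a k := rfl
  rw [e1, e2, quadForm_add_right, quadForm_mulVec, add_assoc, ← quadForm_add_matrix,
    g.christoffel_eq, g.coordGramInvDeriv_eq he hy, ← hP, ← hA, hPt]
  -- The derivative of P = G⁻¹ cancels the ∂ᵢG part of the Christoffel symbols. What remains, half
  -- of P A P, is antisymmetric and vanishes on the diagonal.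
  have e3 : P * ((1 / 2 : ℝ) • ((g.coordGramDeriv e y i + A) * P))
      + (1 / 2 : ℝ) • -(P * g.coordGramDeriv e y i * P) = (1 / 2 : ℝ) • (P * A * P) := by
    rw [Matrix.mul_smul, ← smul_add, Matrix.add_mul, Matrix.mul_add, Matrix.mul_assoc,
      Matrix.mul_assoc]
    congr 1
    abel
  rw [e3, quadForm_self_of_antisymm, add_zero]
  rw [Matrix.transpose_smul, Matrix.transpose_mul, Matrix.transpose_mul, hPt, hAt,
    Matrix.neg_mul, Matrix.mul_neg, smul_neg, Matrix.mul_assoc]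

theorem re_cotInner_coord (he : e ∈ atlas (EuclideanSpace ℝ (Fin m)) X)
    {y : EuclideanSpace ℝ (Fin m)} (hy : y ∈ e.target)
    (α β : TangentSpace (𝓡 m) (e.symm y) →ₗ[ℝ] ℂ) :
    (g.cotInner (e.symm y) α β).re = quadForm (g.coordGram e y)⁻¹ (fun i => α (coordVec e y i))
      (fun i => β (coordVec e y i)) := by
  rw [g.cotInner_coord he hy]
  simp only [Complex.re_sum, Complex.re_ofReal_mul, quadForm]

theorem exists_apply_coordVec (he : e ∈ atlas (EuclideanSpace ℝ (Fin m)) X)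
    {y : EuclideanSpace ℝ (Fin m)} (hy : y ∈ e.target) (b : Fin m → ℂ) :
    ∃ α : TangentSpace (𝓡 m) (e.symm y) →ₗ[ℝ] ℂ, ∀ i, α (coordVec e y i) = b i := by
  have hli := linearIndependent_coordVec he hy
  have : FiniteDimensional ℝ (TangentSpace (𝓡 m) (e.symm y)) :=
    inferInstanceAs (FiniteDimensional ℝ (EuclideanSpace ℝ (Fin m)))
  have hc : Fintype.card (Fin m) = Module.finrank ℝ (TangentSpace (𝓡 m) (e.symm y)) :=
    (Fintype.card_fin m).trans (finrank_euclideanSpace_fin (𝕜 := ℝ) (n := m)).symm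
  let B := Module.Basis.mk hli (hli.span_eq_top_of_card_eq_finrank' hc).ge
  refine ⟨B.constr ℝ b, fun i => ?_⟩
  have := B.constr_basis ℝ b i
  rwa [Module.Basis.mk_apply] at this

variable [MeasurableSpace X] [BorelSpace X] {g}
  {α : ∀ x : X, TangentSpace (𝓡 m) x →ₗ[ℝ] ℂ}
  {σ : ∀ x : X, TangentSpace (𝓡 m) x →ₗ[ℝ] TangentSpace (𝓡 m) x →ₗ[ℝ] ℂ}

/-- In each chart this is the weak chain rule with P the inverse metric and coercivity function κ_j
= g_jj. Metric compatibility then absorbs the Christoffel terms and the derivatives of P. -/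
theorem HasWeakCovDeriv.hasWeakDifferential_sqrt (hΩ : IsOpen Ω) (h : g.HasWeakCovDeriv Ω α σ)
    {η : ℝ} (hη : 0 < η) :
    g.HasWeakDifferential Ω
      (fun x => ((Real.sqrt (g.cotNormSq x (α x) + η ^ 2) - η : ℝ) : ℂ))
      (fun x => g.normDiff η x (α x) (σ x)) := by
  refine ⟨_, ae_eq_refl _, fun e he i => ?_⟩
  have hsub : coordDomain Ω e ⊆ e.target := inter_subset_left
  have hre : ∀ y ∈ coordDomain Ω e, ∀ b : Fin m → ℂ,
      ∃ γ : TangentSpace (𝓡 m) (e.symm y) →ₗ[ℝ] ℂ, (∀ j, γ (coordVec e y j) = b j) ∧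
        quadForm (g.coordGram e y)⁻¹ b b = g.cotNormSq (e.symm y) γ := by
    intro y hy b
    obtain ⟨γ, hγ⟩ := exists_apply_coordVec he hy.1 b
    refine ⟨γ, hγ, ?_⟩
    rw [cotNormSq, g.re_cotInner_coord he hy.1]
    simp only [hγ]
  have key := HasWeakPartial.sqrt_quadForm (isOpen_coordDomain e hΩ)
    (P := fun y => (g.coordGram e y)⁻¹)
    (fun j k => ((g.contDiffOn_coordGram_inv he j k).mono hsub).of_le (by simp))
    (fun y hy j k => congrFun (congrFun (g.coordGram_inv_transpose he hy.1) k) j)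
    (fun y hy b => by
      obtain ⟨γ, -, hγ⟩ := hre y hy b
      rw [hγ]
      exact g.cotNormSq_nonneg _ _)
    (κ := fun j y => g.coordGram e y j j)
    (fun j => (g.contDiffOn_coordGram he j j).continuousOn.mono hsub)
    (fun y hy b j => by
      obtain ⟨γ, h1, h2⟩ := hre y hy b
      rw [h2, ← h1]
      exact g.norm_apply_sq_le _ _ _) hη (h e he i)
  refine key.congr ?_ ?_ (isOpen_coordDomain e hΩ)
  · filter_upwards [ae_restrict_mem (measurableSet_coordDomain e hΩ.measurableSet)] with y hy
    rw [cotNormSq, g.re_cotInner_coord he hy.1]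
  · filter_upwards [ae_restrict_mem (measurableSet_coordDomain e hΩ.measurableSet)] with y hy
    change _ = (((g.cotInner (e.symm y) (α (e.symm y)) (σ (e.symm y) (coordVec e y i))).re /
      Real.sqrt (g.cotNormSq (e.symm y) (α (e.symm y)) + η ^ 2) : ℝ) : ℂ)
    rw [cotNormSq, g.re_cotInner_coord he hy.1, g.re_cotInner_coord he hy.1,
      g.quadForm_covDeriv he hy.1 i]

end RiemMetric

end

/-! ### Non-concentration of the differential of an H² function. -/

section

namespace RiemMetric

variable {m : ℕ} {X : Type*} [TopologicalSpace X] [ChartedSpace (EuclideanSpace ℝ (Fin m)) X]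
  [IsManifold (𝓡 m) ∞ X] {e : OpenPartialHomeomorph X (EuclideanSpace ℝ (Fin m))} {Ω : Set X}

theorem continuousOn_christoffel (g : RiemMetric m X)
    (he : e ∈ atlas (EuclideanSpace ℝ (Fin m)) X) (k i j : Fin m) :
    ContinuousOn (fun y => g.christoffel e y k i j) e.target := by
  have hd : ∀ a b c, ContinuousOn
      (fun y => fderiv ℝ (fun z => g.coordGram e z a b) y (stdVec c)) e.target := fun a b c =>
    ((g.contDiffOn_coordGram he a b).continuousOn_fderiv_of_isOpen e.open_target
      (by simp)).clm_apply continuousOn_const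
  exact continuousOn_const.mul (continuousOn_finsetSum _ fun l _ =>
    (g.contDiffOn_coordGram_inv he k l).continuousOn.mul (((hd _ _ _).add (hd _ _ _)).sub (hd _ _ _)))

theorem ext_coordVec₂ (he : e ∈ atlas (EuclideanSpace ℝ (Fin m)) X)
    {y : EuclideanSpace ℝ (Fin m)} (hy : y ∈ e.target)
    {σ τ : TangentSpace (𝓡 m) (e.symm y) →ₗ[ℝ] TangentSpace (𝓡 m) (e.symm y) →ₗ[ℝ] ℂ}
    (h : ∀ i j, σ (coordVec e y i) (coordVec e y j) = τ (coordVec e y i) (coordVec e y j)) :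
    σ = τ := by
  refine LinearMap.ext fun v => ext_coordVec he hy fun j => ?_
  exact congrArg (fun L : TangentSpace (𝓡 m) (e.symm y) →ₗ[ℝ] ℂ => L v)
    (ext_coordVec he hy (α := σ.flip (coordVec e y j)) (β := τ.flip (coordVec e y j))
      fun i => h i j)

variable [MeasurableSpace X] [BorelSpace X] [SecondCountableTopology X] {g : RiemMetric m X}
  {α : ∀ x : X, TangentSpace (𝓡 m) x →ₗ[ℝ] ℂ}
  {σ τ : ∀ x : X, TangentSpace (𝓡 m) x →ₗ[ℝ] TangentSpace (𝓡 m) x →ₗ[ℝ] ℂ}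

theorem HasWeakCovDeriv.unique (hΩ : IsOpen Ω) (h : g.HasWeakCovDeriv Ω α σ)
    (h' : g.HasWeakCovDeriv Ω α τ) : ∀ᵐ x ∂g.vol.restrict Ω, σ x = τ x := by
  refine (g.ae_iff_forall_coord hΩ.measurableSet).2 fun e he => ?_
  have h1 := fun i j => (h e he i j).unique (isOpen_coordDomain e hΩ) (h' e he i j) (ae_eq_refl _)
  filter_upwards [ae_all_iff.2 fun i => ae_all_iff.2 (h1 i),
    ae_restrict_mem (measurableSet_coordDomain e hΩ.measurableSet)] with y hy hyΩ
  exact ext_coordVec₂ he hyΩ.1 fun i j => add_right_cancel (hy i j)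

/-- The components of σ are the weak derivatives of those of α minus continuous Christoffel terms
times components of α, hence measurable. -/
theorem HasWeakCovDeriv.aestronglyMeasurable_tensorNormSq (hΩ : IsOpen Ω)
    (h : g.HasWeakCovDeriv Ω α σ) :
    AEStronglyMeasurable (fun x => g.tensorNormSq x (σ x)) (g.vol.restrict Ω) := by
  refine g.aestronglyMeasurable_of_forall_coord hΩ.measurableSet fun e he => ?_
  have hα : ∀ j, AEStronglyMeasurable (fun y => α (e.symm y) (coordVec e y j))
      (volume.restrict (coordDomain Ω e)) := fun j => (h e he j j).1.aestronglyMeasurable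
  have hcont : ∀ {f : EuclideanSpace ℝ (Fin m) → ℝ}, ContinuousOn f e.target →
      AEStronglyMeasurable (fun y => (f y : ℂ)) (volume.restrict (coordDomain Ω e)) := fun hf =>
    Complex.continuous_ofReal.comp_aestronglyMeasurable ((hf.aestronglyMeasurable
      e.open_target.measurableSet).mono_set inter_subset_left)
  have hσ : ∀ i j, AEStronglyMeasurable
      (fun y => σ (e.symm y) (coordVec e y i) (coordVec e y j))
      (volume.restrict (coordDomain Ω e)) := by
    intro i j
    have h1 := (h e he i j).2.1.aestronglyMeasurable
    have h2 : AEStronglyMeasurable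
        (fun y => ∑ k, (g.christoffel e y k i j : ℂ) * α (e.symm y) (coordVec e y k))
        (volume.restrict (coordDomain Ω e)) :=
      Finset.aestronglyMeasurable_fun_sum _ fun k _ =>
        (hcont (g.continuousOn_christoffel he k i j)).mul (hα k)
    exact (h1.sub h2).congr (Eventually.of_forall fun y => add_sub_cancel_right _ _)
  have hP : ∀ i j, AEStronglyMeasurable (fun y => (((g.coordGram e y)⁻¹ i j : ℝ) : ℂ))
      (volume.restrict (coordDomain Ω e)) := fun i j =>
    hcont (g.contDiffOn_coordGram_inv he i j).continuousOn
  have hF : AEStronglyMeasurable (fun y => (∑ i, ∑ k, (((g.coordGram e y)⁻¹ i k : ℝ) : ℂ) *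
      ∑ j, ∑ l, (((g.coordGram e y)⁻¹ j l : ℝ) : ℂ) *
        (conj (σ (e.symm y) (coordVec e y i) (coordVec e y j)) *
          σ (e.symm y) (coordVec e y k) (coordVec e y l))).re)
      (volume.restrict (coordDomain Ω e)) :=
    Complex.continuous_re.comp_aestronglyMeasurable <|
      Finset.aestronglyMeasurable_fun_sum _ fun i _ =>
      Finset.aestronglyMeasurable_fun_sum _ fun k _ => (hP i k).mul <|
      Finset.aestronglyMeasurable_fun_sum _ fun j _ =>
      Finset.aestronglyMeasurable_fun_sum _ fun l _ => (hP j l).mul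
        ((Complex.continuous_conj.comp_aestronglyMeasurable (hσ i j)).mul (hσ k l))
  refine hF.congr ?_
  filter_upwards [ae_restrict_mem (measurableSet_coordDomain e hΩ.measurableSet)] with y hy
  rw [g.tensorNormSq_eq_sum (linearIndependent_coordVec he hy.1)]
  simp only [g.cotInner_coord he hy.1]
  rfl

theorem MemSobolevTwo.weakHessian (hΩ : IsOpen Ω) {f : g.L2 Ω} (h : g.MemSobolevTwo Ω f) :
    g.HasWeakHessian Ω f (g.weakHessian Ω f) ∧
      Integrable (fun x => g.tensorNormSq x (g.weakHessian Ω f x)) (g.vol.restrict Ω) := by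
  obtain ⟨-, σ, hσ, F, hF, hle⟩ := h
  have h' : ∃ σ, g.HasWeakHessian Ω f σ := ⟨σ, hσ⟩
  have hH : g.HasWeakHessian Ω f (g.weakHessian Ω f) := by
    rw [RiemMetric.weakHessian, dif_pos h']
    exact h'.choose_spec
  refine ⟨hH, hF.mono' (hH.aestronglyMeasurable_tensorNormSq hΩ) ?_⟩
  filter_upwards [hle, hσ.unique hΩ hH] with x hx hx'
  rw [← hx', Real.norm_of_nonneg (g.tensorNormSq_nonneg _ _)]
  exact hx

theorem sqrt_add_sq_sub_sq_le {t η : ℝ} (ht : 0 ≤ t) (hη : 0 ≤ η) :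
    (Real.sqrt (t + η ^ 2) - η) ^ 2 ≤ t := by
  have h1 := Real.sq_sqrt (add_nonneg ht (sq_nonneg η))
  have h2 : η ≤ Real.sqrt (t + η ^ 2) := Real.le_sqrt_of_sq_le (by linarith)
  nlinarith

omit [BorelSpace X] [SecondCountableTopology X] in
theorem norm_sq_L2 (f : g.L2 Ω) : ‖f‖ ^ 2 = ∫ x in Ω, ‖f x‖ ^ 2 ∂g.vol := by
  have h : inner ℂ f f = ((∫ x in Ω, ‖f x‖ ^ 2 ∂g.vol : ℝ) : ℂ) := by
    rw [L2.inner_def, ← integral_complex_ofReal]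
    refine integral_congr_ae (Eventually.of_forall fun x => ?_)
    simp only [inner_self_eq_norm_sq_to_K]
    norm_num
  have h1 := congrArg Complex.re h
  rw [Complex.ofReal_re] at h1
  rw [← h1]
  exact (inner_self_eq_norm_sq (𝕜 := ℂ) f).symm

/-- On functions in `H²`, non-concentration passes to the differential by Kato's inequality. -/
theorem NonConcentrating.sqrt_setIntegral_cotNormSq_le {A : Set X} {δ : ℝ} (hΩ : IsOpen Ω)
    (hA : A ⊆ Ω) (h : g.NonConcentrating A Ω δ) {f : g.L2 Ω} (hf : g.MemSobolevTwo Ω f) :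
    Real.sqrt (∫ x in A, g.cotNormSq x (g.weakDifferential Ω f x) ∂g.vol)
      ≤ δ * g.sobolevTwoNorm Ω f := by
  obtain ⟨hH, hI⟩ := hf.weakHessian hΩ
  set α := g.weakDifferential Ω f with hα
  set σ := g.weakHessian Ω f with hσ
  have hαL : g.MemL2Covector Ω α := memL2Covector_weakDifferential hΩ ⟨f, hf.1⟩
  have hI0 : 0 ≤ ∫ x in Ω, g.cotNormSq x (α x) ∂g.vol :=
    integral_nonneg fun x => g.cotNormSq_nonneg _ _
  -- Non-concentration for the regularised norm, with a bound that does not depend on η.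
  have main : ∀ η > 0, ∫ x in A, (Real.sqrt (g.cotNormSq x (α x) + η ^ 2) - η) ^ 2 ∂g.vol
      ≤ (δ * g.sobolevTwoNorm Ω f) ^ 2 := by
    intro η hη
    have hd := HasWeakCovDeriv.hasWeakDifferential_sqrt hΩ hH hη
    set F : X → ℂ := fun x => ((Real.sqrt (g.cotNormSq x (α x) + η ^ 2) - η : ℝ) : ℂ) with hF
    have hFn : ∀ x, ‖F x‖ ^ 2 = (Real.sqrt (g.cotNormSq x (α x) + η ^ 2) - η) ^ 2 := fun x => by
      rw [hF, Complex.norm_real, Real.norm_eq_abs, sq_abs]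
    have hFle : ∀ x, ‖F x‖ ^ 2 ≤ g.cotNormSq x (α x) := fun x => by
      rw [hFn]
      exact sqrt_add_sq_sub_sq_le (g.cotNormSq_nonneg _ _) hη.le
    have hFm : AEStronglyMeasurable F (g.vol.restrict Ω) :=
      Complex.continuous_ofReal.comp_aestronglyMeasurable
        ((Real.continuous_sqrt.comp_aestronglyMeasurable
          (hαL.integrable.1.add aestronglyMeasurable_const)).sub aestronglyMeasurable_const)
    have hFI : Integrable (fun x => ‖F x‖ ^ 2) (g.vol.restrict Ω) :=
      hαL.integrable.mono' (hFm.norm.pow 2) (Eventually.of_forall fun x => by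
        rw [Real.norm_of_nonneg (sq_nonneg _)]
        exact hFle x)
    have hFL : MemLp F 2 (g.vol.restrict Ω) := (memLp_two_iff_integrable_sq_norm hFm).2 hFI
    have hνI : Integrable (fun x => g.cotNormSq x (g.normDiff η x (α x) (σ x)))
        (g.vol.restrict Ω) :=
      hI.mono' (g.aestronglyMeasurable_cotNormSq hΩ.measurableSet hd.aemeasurable)
        (Eventually.of_forall fun x => by
          rw [Real.norm_of_nonneg (g.cotNormSq_nonneg _ _)]
          exact g.cotNormSq_normDiff_le _ _ _ _)
    obtain ⟨k, hk⟩ : ∃ k : g.L2 Ω, k =ᵐ[g.vol.restrict Ω] F := ⟨hFL.toLp, hFL.coeFn_toLp⟩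
    have hd' := hd.congr hk.symm
    have hmem : k ∈ (g.energyForm Ω).dom :=
      hd'.mem_sobolevOne ⟨hd.aemeasurable, hνI⟩
    have h1 := h.2 ⟨k, hmem⟩
    have h2 : ∫ x in A, ‖k x‖ ^ 2 ∂g.vol
        = ∫ x in A, (Real.sqrt (g.cotNormSq x (α x) + η ^ 2) - η) ^ 2 ∂g.vol := by
      refine integral_congr_ae ?_
      filter_upwards [ae_restrict_of_ae_restrict_of_subset hA hk] with x hx
      rw [hx, hFn]
    -- The L² part of k is at most that of α and, by Kato, its differential is at most σ. The term
    -- ‖f‖² of the H² norm is not needed.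
    have h3 : (g.energyForm Ω).norm1 ⟨k, hmem⟩ ^ 2 ≤ g.sobolevTwoNorm Ω f ^ 2 := by
      have h5 : ‖k‖ ^ 2 ≤ ∫ x in Ω, g.cotNormSq x (α x) ∂g.vol := by
        have h6 : ‖k‖ ^ 2 = ∫ x in Ω, ‖F x‖ ^ 2 ∂g.vol := by
          rw [norm_sq_L2]
          exact integral_congr_ae (hk.mono fun x hx => by simp only [hx])
        rw [h6]
        exact integral_mono hFI hαL.integrable hFle
      have h6 : ∫ x in Ω, g.cotNormSq x (g.normDiff η x (α x) (σ x)) ∂g.vol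
          ≤ ∫ x in Ω, g.tensorNormSq x (σ x) ∂g.vol :=
        integral_mono hνI hI fun x => g.cotNormSq_normDiff_le _ _ _ _
      have h7 : 0 ≤ ∫ x in Ω, g.tensorNormSq x (σ x) ∂g.vol :=
        integral_nonneg fun x => g.tensorNormSq_nonneg _ _
      rw [norm1_sq_energyForm hΩ hd', sobolevTwoNorm, Real.sq_sqrt (by positivity)]
      change ‖k‖ ^ 2 + _ ≤ _
      linarith [sq_nonneg ‖f‖]
    have h4 : (g.energyForm Ω).norm1 ⟨k, hmem⟩ ≤ g.sobolevTwoNorm Ω f :=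
      (sq_le_sq₀ (HilbertForm.norm1_nonneg _ _) (Real.sqrt_nonneg _)).1 h3
    change Real.sqrt (∫ x in A, ‖k x‖ ^ 2 ∂g.vol) ≤ _ at h1
    rw [h2] at h1
    exact (Real.sqrt_le_left (mul_nonneg h.1.le (Real.sqrt_nonneg _))).1
      (h1.trans (mul_le_mul_of_nonneg_left h4 h.1.le))
  have hαA : Integrable (fun x => g.cotNormSq x (α x)) (g.vol.restrict A) :=
    hαL.integrable.mono_measure (Measure.restrict_mono hA le_rfl)
  -- Dominated convergence along η = 1/(n + 1), with |α|² as majorant.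
  have hlim : Tendsto (fun n : ℕ => ∫ x in A,
      (Real.sqrt (g.cotNormSq x (α x) + (1 / ((n : ℝ) + 1)) ^ 2) - 1 / ((n : ℝ) + 1)) ^ 2 ∂g.vol)
      atTop (𝓝 (∫ x in A, g.cotNormSq x (α x) ∂g.vol)) := by
    refine tendsto_integral_of_dominated_convergence (fun x => g.cotNormSq x (α x))
      (fun n => ?_) hαA (fun n => Eventually.of_forall fun x => ?_)
      (Eventually.of_forall fun x => ?_)
    · exact ((Real.continuous_sqrt.comp_aestronglyMeasurable
        (hαA.1.add aestronglyMeasurable_const)).sub aestronglyMeasurable_const).pow 2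
    · rw [Real.norm_of_nonneg (sq_nonneg _)]
      exact sqrt_add_sq_sub_sq_le (g.cotNormSq_nonneg _ _) (by positivity)
    · have h0 := tendsto_one_div_add_atTop_nhds_zero_nat (𝕜 := ℝ)
      have h1 : Continuous fun η : ℝ => (Real.sqrt (g.cotNormSq x (α x) + η ^ 2) - η) ^ 2 := by
        fun_prop
      have h2 := (h1.tendsto 0).comp h0
      simpa [Function.comp_def, Real.sq_sqrt (g.cotNormSq_nonneg _ _)] using h2
  exact Real.sqrt_le_iff.2 ⟨mul_nonneg h.1.le (Real.sqrt_nonneg _),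
    le_of_tendsto' hlim fun n => main _ (by positivity)⟩

end RiemMetric

end

/-! ### Restriction, extension by zero and the quasi-unitary equivalence. -/

section

namespace RiemMetric

variable {m : ℕ} {X : Type*} [TopologicalSpace X] [ChartedSpace (EuclideanSpace ℝ (Fin m)) X]
  [IsManifold (𝓡 m) ∞ X] [MeasurableSpace X] {g : RiemMetric m X} {Ω Ω' : Set X}

/-- Restriction of square integrable functions to a smaller set. -/
def restrictL2 (g : RiemMetric m X) (h : Ω' ⊆ Ω) : g.L2 Ω →L[ℂ] g.L2 Ω' :=
  LinearMap.mkContinuous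
    { toFun := fun f => ((Lp.memLp f).mono_measure (Measure.restrict_mono h le_rfl)).toLp
      map_add' := fun f k => by
        rw [← MemLp.toLp_add]
        exact MemLp.toLp_congr _ _
          (ae_mono (Measure.restrict_mono h le_rfl) (Lp.coeFn_add f k))
      map_smul' := fun c f => by
        rw [RingHom.id_apply, ← MemLp.toLp_const_smul]
        exact MemLp.toLp_congr _ _
          (ae_mono (Measure.restrict_mono h le_rfl) (Lp.coeFn_smul c f)) } 1 fun f => by
    rw [one_mul]
    change ‖MemLp.toLp f ((Lp.memLp f).mono_measure (Measure.restrict_mono h le_rfl))‖ ≤ ‖f‖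
    rw [Lp.norm_toLp, Lp.norm_def]
    exact ENNReal.toReal_mono (Lp.eLpNorm_ne_top f)
      (eLpNorm_mono_measure _ (Measure.restrict_mono h le_rfl))

theorem restrictL2_ae_eq (h : Ω' ⊆ Ω) (f : g.L2 Ω) :
    g.restrictL2 h f =ᵐ[g.vol.restrict Ω'] f :=
  MemLp.coeFn_toLp ((Lp.memLp f).mono_measure (Measure.restrict_mono h le_rfl))

theorem norm_restrictL2_le (h : Ω' ⊆ Ω) (f : g.L2 Ω) : ‖g.restrictL2 h f‖ ≤ ‖f‖ := by
  refine ((g.restrictL2 h).le_of_opNorm_le ?_ f).trans_eq (one_mul _)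
  exact LinearMap.mkContinuous_norm_le _ zero_le_one _

/-- Extension by zero enters as the adjoint of restriction, which makes its linearity, boundedness
and the adjointness clause automatic; this identifies its values. -/
theorem adjoint_restrictL2_ae_eq (h : Ω' ⊆ Ω) (hΩ' : MeasurableSet Ω') (u : g.L2 Ω') :
    (g.restrictL2 h).adjoint u =ᵐ[g.vol.restrict Ω] Ω'.indicator u := by
  have hr : (g.vol.restrict Ω).restrict Ω' = g.vol.restrict Ω' := by
    rw [Measure.restrict_restrict hΩ', inter_eq_left.2 h]
  have hL : MemLp (Ω'.indicator u) 2 (g.vol.restrict Ω) := by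
    rw [memLp_indicator_iff_restrict hΩ', hr]
    exact Lp.memLp u
  have he : (g.restrictL2 h).adjoint u = hL.toLp := by
    refine ext_inner_left ℂ fun f => ?_
    have h3 := integral_indicator (μ := g.vol.restrict Ω)
      (f := fun x => inner ℂ (g.restrictL2 h f x) (u x)) hΩ'
    rw [hr] at h3
    rw [ContinuousLinearMap.adjoint_inner_right, L2.inner_def, L2.inner_def, ← h3]
    refine integral_congr_ae ?_
    have h1 : ∀ᵐ x ∂g.vol.restrict Ω, x ∈ Ω' → g.restrictL2 h f x = f x := by
      rw [← ae_restrict_iff' hΩ', hr]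
      exact restrictL2_ae_eq h f
    filter_upwards [h1, hL.coeFn_toLp] with x hx hx'
    rw [hx']
    by_cases hxΩ : x ∈ Ω'
    · simp [hxΩ, hx hxΩ]
    · simp [hxΩ]
  rw [he]
  exact hL.coeFn_toLp

theorem norm_eq_sqrt_of_ae_eq_zero_compl {A : Set X} (hA : MeasurableSet A) (k : g.L2 univ)
    {f : X → ℂ} (h0 : ∀ᵐ x ∂g.vol.restrict Aᶜ, k x = 0) (hf : k =ᵐ[g.vol.restrict A] f) :
    ‖k‖ = Real.sqrt (∫ x in A, ‖f x‖ ^ 2 ∂g.vol) := by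
  have hI : Integrable (fun x => ‖k x‖ ^ 2) g.vol := by
    have h1 := (memLp_two_iff_integrable_sq_norm (Lp.aestronglyMeasurable k)).1 (Lp.memLp k)
    exact integrableOn_univ.1 h1
  have h1 : ∫ x in Aᶜ, ‖k x‖ ^ 2 ∂g.vol = 0 := by
    rw [integral_congr_ae (g := fun _ => 0) (h0.mono fun x hx => by simp [hx])]
    simp
  have h2 : ‖k‖ ^ 2 = ∫ x in A, ‖f x‖ ^ 2 ∂g.vol := by
    rw [norm_sq_L2, setIntegral_univ, ← integral_add_compl hA hI, h1, add_zero]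
    exact integral_congr_ae (hf.mono fun x hx => by simp only [hx])
  rw [← h2, Real.sqrt_sq (norm_nonneg _)]

variable [BorelSpace X] [SecondCountableTopology X]

omit [BorelSpace X] [SecondCountableTopology X] in
theorem HasWeakDifferential.restrictL2 {α : ∀ x : X, TangentSpace (𝓡 m) x →ₗ[ℝ] ℂ} (h : Ω' ⊆ Ω)
    {f : g.L2 Ω} (hf : g.HasWeakDifferential Ω f α) :
    g.HasWeakDifferential Ω' (g.restrictL2 h f) α :=
  (hf.mono h).congr (restrictL2_ae_eq h f).symm

/-- Restriction `H¹(Ω) → H¹(Ω')` to a smaller set. -/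
def restrictSobolevOne (g : RiemMetric m X) (hΩ : IsOpen Ω) (h : Ω' ⊆ Ω) :
    (g.energyForm Ω).dom →ₗ[ℂ] (g.energyForm Ω').dom :=
  (g.restrictL2 h).toLinearMap.restrict fun f hf =>
    ((hasWeakDifferential_weakDifferential ⟨f, hf⟩).restrictL2 h).mem_sobolevOne
      ((memL2Covector_weakDifferential hΩ ⟨f, hf⟩).mono h)

theorem coe_restrictSobolevOne (hΩ : IsOpen Ω) (h : Ω' ⊆ Ω) (f : (g.energyForm Ω).dom) :
    (g.restrictSobolevOne hΩ h f : g.L2 Ω') = g.restrictL2 h f := rfl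

theorem HasWeakDifferential.restrictSobolevOne {α : ∀ x : X, TangentSpace (𝓡 m) x →ₗ[ℝ] ℂ}
    (hΩ : IsOpen Ω) (h : Ω' ⊆ Ω) {f : (g.energyForm Ω).dom}
    (hf : g.HasWeakDifferential Ω (f : g.L2 Ω) α) :
    g.HasWeakDifferential Ω' (g.restrictSobolevOne hΩ h f : g.L2 Ω') α := by
  rw [coe_restrictSobolevOne]
  exact hf.restrictL2 h

omit [BorelSpace X] [SecondCountableTopology X] in
theorem setIntegral_cotNormSq_mono {α : ∀ x : X, TangentSpace (𝓡 m) x →ₗ[ℝ] ℂ} (h : Ω' ⊆ Ω)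
    (hα : g.MemL2Covector Ω α) :
    ∫ x in Ω', g.cotNormSq x (α x) ∂g.vol ≤ ∫ x in Ω, g.cotNormSq x (α x) ∂g.vol :=
  setIntegral_mono_set hα.integrable (Eventually.of_forall fun _ => g.cotNormSq_nonneg _ _)
    (Eventually.of_forall h)

theorem norm1_restrictSobolevOne_le (hΩ : IsOpen Ω) (hΩ' : IsOpen Ω') (h : Ω' ⊆ Ω)
    (f : (g.energyForm Ω).dom) :
    (g.energyForm Ω').norm1 (g.restrictSobolevOne hΩ h f) ≤ (g.energyForm Ω).norm1 f := by
  have hf : g.HasWeakDifferential Ω (f : g.L2 Ω) (g.weakDifferential Ω (f : g.L2 Ω)) :=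
    hasWeakDifferential_weakDifferential f
  have h1 := norm1_sq_energyForm hΩ' (hf.restrictSobolevOne hΩ h)
  have h2 := norm1_sq_energyForm hΩ hf
  have h3 := setIntegral_cotNormSq_mono h (memL2Covector_weakDifferential hΩ f)
  have h4 := pow_le_pow_left₀ (norm_nonneg _) (norm_restrictL2_le h (f : g.L2 Ω)) 2
  rw [coe_restrictSobolevOne] at h1
  refine (sq_le_sq₀ (HilbertForm.norm1_nonneg _ _) (HilbertForm.norm1_nonneg _ _)).1 ?_
  rw [h1, h2]
  exact add_le_add h4 h3

theorem quasiUnitarilyEquivalentTwo_energyForm (g : RiemMetric m X) {B : Set X} {δ' Cell Cext : ℝ}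
    (hB : IsClosed B) (hδ' : g.NonConcentrating B univ δ') (hCell : 1 ≤ Cell)
    (hell : g.EllipticallyRegular Cell) (hCext : 1 ≤ Cext) (hext : g.HasExtension B Cext) :
    (g.energyForm univ).QuasiUnitarilyEquivalentTwo (g.energyForm Bᶜ) (Cext * Cell * δ') := by
  obtain ⟨E, hE, hEn⟩ := hext
  have hδ0 : 0 < δ' := hδ'.1
  have hCC : 1 ≤ Cext * Cell := one_le_mul_of_one_le_of_one_le hCext hCell
  have hδ : 0 ≤ Cext * Cell * δ' := by positivity
  -- Both constants being at least 1, every estimate with a smaller constant fits under the common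
  -- δ.
  have hle : δ' ≤ Cext * Cell * δ' := le_mul_of_one_le_left hδ0.le hCC
  have hU : IsOpen (univ : Set X) := isOpen_univ
  have hBo : IsOpen Bᶜ := hB.isOpen_compl
  have hBm : MeasurableSet B := hB.measurableSet
  have hsub : Bᶜ ⊆ univ := subset_univ _
  have hJ' := fun u : g.L2 Bᶜ => adjoint_restrictL2_ae_eq hsub hBo.measurableSet u
  have hJ'c : ∀ u : g.L2 Bᶜ, (g.restrictL2 hsub).adjoint u =ᵐ[g.vol.restrict Bᶜ] u := by
    intro u
    filter_upwards [ae_restrict_of_ae_restrict_of_subset hsub (hJ' u),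
      ae_restrict_mem hBo.measurableSet] with x hx hxB
    rw [hx, indicator_of_mem hxB]
  have hJ'B : ∀ u : g.L2 Bᶜ, ∀ᵐ x ∂g.vol.restrict B, (g.restrictL2 hsub).adjoint u x = 0 := by
    intro u
    filter_upwards [ae_restrict_of_ae_restrict_of_subset (subset_univ B) (hJ' u),
      ae_restrict_mem hBm] with x hx hxB
    rw [hx, indicator_of_notMem (notMem_compl_iff.2 hxB)]
  -- Used twice: with u the restriction of f, and with f = Eu. In both cases the difference is f on
  -- B and zero outside.
  have hnorm : ∀ (f : (g.energyForm univ).dom) (u : g.L2 Bᶜ),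
      u =ᵐ[g.vol.restrict Bᶜ] (f : g.L2 univ) →
      ‖(f : g.L2 univ) - (g.restrictL2 hsub).adjoint u‖ ≤ δ' * (g.energyForm univ).norm1 f := by
    intro f u hu
    have hd := Lp.coeFn_sub (f : g.L2 univ) ((g.restrictL2 hsub).adjoint u)
    refine (norm_eq_sqrt_of_ae_eq_zero_compl hBm _ (f := (f : g.L2 univ)) ?_ ?_).trans_le
      (hδ'.2 f)
    · filter_upwards [ae_restrict_of_ae_restrict_of_subset hsub hd, hJ'c u, hu] with x h1 h2 h3
      rw [h1, Pi.sub_apply, h2, h3, sub_self]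
    · filter_upwards [ae_restrict_of_ae_restrict_of_subset (subset_univ B) hd, hJ'B u] with x h1 h2
      rw [h1, Pi.sub_apply, h2, sub_zero]
  refine ⟨hδ, g.restrictL2 hsub, (g.restrictL2 hsub).adjoint, g.restrictSobolevOne hU hsub, E,
    ⟨1, fun f => ?_⟩, ⟨Cext, hEn⟩, fun f => ?_, fun f u => ?_, fun f => ?_, fun u => ?_,
    fun f => ?_, fun u => ?_, fun f w hw u => ?_⟩
  · rw [one_mul]
    exact norm1_restrictSobolevOne_le hU hBo hsub f
  · exact (norm_restrictL2_le hsub f).trans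
      (le_mul_of_one_le_left (norm_nonneg _) (le_add_of_nonneg_right hδ))
  · rw [ContinuousLinearMap.adjoint_inner_right, sub_self, norm_zero]
    positivity
  · exact (hnorm f _ (restrictL2_ae_eq hsub _)).trans
      (mul_le_mul_of_nonneg_right hle (HilbertForm.norm1_nonneg _ _))
  · have : g.restrictL2 hsub ((g.restrictL2 hsub).adjoint u) = (u : g.L2 Bᶜ) :=
      Lp.ext ((restrictL2_ae_eq hsub _).trans (hJ'c u))
    rw [this, sub_self, norm_zero]
    exact mul_nonneg hδ (HilbertForm.norm1_nonneg _ _)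
  · have : (g.restrictSobolevOne hU hsub f : g.L2 Bᶜ) = g.restrictL2 hsub f := rfl
    rw [this, sub_self, norm_zero]
    exact mul_nonneg hδ (HilbertForm.norm1_nonneg _ _)
  · calc _ ≤ δ' * (g.energyForm univ).norm1 (E u) := hnorm (E u) u (hE u).symm
      _ ≤ δ' * (Cext * (g.energyForm Bᶜ).norm1 u) := mul_le_mul_of_nonneg_left (hEn u) hδ0.le
      _ = 1 * (Cext * δ' * (g.energyForm Bᶜ).norm1 u) := by ring
      _ ≤ Cell * (Cext * δ' * (g.energyForm Bᶜ).norm1 u) := by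
          refine mul_le_mul_of_nonneg_right hCell ?_
          have := HilbertForm.norm1_nonneg (g.energyForm Bᶜ) u
          positivity
      _ = _ := by ring
  · obtain ⟨hf2, hfn⟩ := hell f w hw
    have hf := hasWeakDifferential_weakDifferential f
    have hEu := hasWeakDifferential_weakDifferential (E u)
    have hfL := memL2Covector_weakDifferential hU f
    have hEL := memL2Covector_weakDifferential hU (E u)
    set α := g.weakDifferential univ (f : g.L2 univ)
    set β := g.weakDifferential univ (E u : g.L2 univ)
    -- Outside B the function u equals Eu, so d(Eu) serves as weak differential of u and the two
    -- forms share the integral over the complement of B.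
    have e1 : (g.energyForm Bᶜ).form (g.restrictSobolevOne hU hsub f) u
        = ∫ x in Bᶜ, g.cotInner x (α x) (β x) ∂g.vol :=
      energyForm_apply hBo (hf.restrictSobolevOne hU hsub) ((hEu.mono hsub).congr (hE u))
    have e2 : (g.energyForm univ).form f (E u) = (∫ x in B, g.cotInner x (α x) (β x) ∂g.vol)
        + ∫ x in Bᶜ, g.cotInner x (α x) (β x) ∂g.vol := by
      have hI := hfL.integrable_cotInner MeasurableSet.univ hEL
      rw [Measure.restrict_univ] at hI
      rw [integral_add_compl hBm hI, energyForm_apply hU hf hEu, Measure.restrict_univ]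
    have e3 : Real.sqrt (∫ x in B, g.cotNormSq x (β x) ∂g.vol)
        ≤ Cext * (g.energyForm Bᶜ).norm1 u := by
      refine le_trans ?_ (hEn u)
      refine (Real.sqrt_le_left (HilbertForm.norm1_nonneg _ _)).2 ?_
      rw [norm1_sq_energyForm hU hEu]
      refine le_add_of_nonneg_of_le (sq_nonneg _) ?_
      exact setIntegral_cotNormSq_mono (subset_univ B) hEL
    have e4 : Real.sqrt (∫ x in B, g.cotNormSq x (α x) ∂g.vol)
        ≤ δ' * (Cell * ‖w + (f : g.L2 univ)‖) :=
      (hδ'.sqrt_setIntegral_cotNormSq_le hU (subset_univ B) hf2).trans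
        (mul_le_mul_of_nonneg_left hfn hδ0.le)
    -- Only the integral over B survives; Cauchy-Schwarz splits it into `e4`, small by Kato and
    -- non-concentration, and `e3`, bounded by the extension constant.
    rw [e1, e2, sub_add_cancel_right, norm_neg]
    refine ((hfL.mono (subset_univ B)).norm_integral_cotInner_le hBm
      (hEL.mono (subset_univ B))).trans ?_
    refine (mul_le_mul e4 e3 (Real.sqrt_nonneg _) (by positivity)).trans_eq ?_
    ring

end RiemMetric

end

end

theorem mainTheorem1 {m : ℕ} (hm : 2 ≤ m) {X : Type*} [TopologicalSpace X] [T2Space X]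
    [SecondCountableTopology X] [ChartedSpace (EuclideanSpace ℝ (Fin m)) X]
    [IsManifold (𝓡 m) ∞ X] [MeasurableSpace X] [BorelSpace X]
    (g : RiemMetric m X) {ε₀ : ℝ} (hε₀ : 0 < ε₀) (B : ℝ → Set X) (δ' : ℝ → ℝ) (Cell Cext : ℝ)
    (hB : g.NeumannFading ε₀ B δ' Cell Cext) :
    (g.energyForm univ).IsEnergyForm ∧
    (∀ ε ∈ Ioc 0 ε₀, (g.energyForm (B ε)ᶜ).IsEnergyForm) ∧
    (∀ ε ∈ Ioc 0 ε₀, (g.energyForm univ).QuasiUnitarilyEquivalentTwo (g.energyForm (B ε)ᶜ)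
      (Cext * Cell * δ' ε)) ∧
    (g.energyForm univ).GeneralisedNormResolventConvergence (fun ε => g.energyForm (B ε)ᶜ) ε₀ := by
  have hq := g.isEnergyForm_energyForm isOpen_univ
  have hp : ∀ ε ∈ Ioc 0 ε₀, (g.energyForm (B ε)ᶜ).IsEnergyForm := fun ε hε =>
    g.isEnergyForm_energyForm (hB.isClosed ε hε).isOpen_compl
  have hQ : ∀ ε ∈ Ioc 0 ε₀, (g.energyForm univ).QuasiUnitarilyEquivalentTwo
      (g.energyForm (B ε)ᶜ) (Cext * Cell * δ' ε) := fun ε hε =>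
    g.quasiUnitarilyEquivalentTwo_energyForm (hB.isClosed ε hε) (hB.nonConcentrating ε hε)
      hB.one_le_Cell hB.ellipticallyRegular hB.one_le_Cext (hB.extension ε hε)
  refine ⟨hq, hp, hQ, .of_quasiUnitarilyEquivalentTwo hq hp ?_ hQ⟩
  simpa using hB.tendsto.const_mul (Cext * Cell)
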